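/- Fix a countable set of names $a,b,n,x,z,\ldots$; terms are $s,t ::= a \mid s\bullet t$. The processes of the synchronous monadic channel-based joining language $\mathcal L_S=\mathcal L_{S,M,C,NO,J}$ are, up to $\alpha$-equivalence, $$P,Q ::= 0 \mid \overline n\langle a\rangle.P \mid (n_1(a_1)\mid\cdots\mid n_i(a_i))\rhd Q \mid (\nu a)P \mid P\mid Q \mid \mathbf{if}\ s=t\ \mathbf{then}\ P\ \mathbf{else}\ Q \mid {*P} \mid \checkmark ,$$ with $i\ge 1$ and pairwise distinct binding names $a_1,\dots,a_i$, which are bound in $Q$. The asynchronous language $\mathcal L_A=\mathcal L_{A,M,C,NO,J}$ has outputs $\overline n\langle a\rangle$ without continuation instead. In each language, $\equiv$ is the least equivalence relation preserved by parallel composition and restriction such that $|$ is commutative and associative with unit $0$; $\mathbf{if}\ s=t\ \mathbf{then}\ P\ \mathbf{else}\ Q$ is equivalent to $P$ if $s=t$ and to $Q$ if $s\ne t$; $(\nu a)0\equiv 0$; $(\nu a)(\nu b)P\equiv(\nu b)(\nu a)P$; $P\mid(\nu a)Q\equiv(\nu a)(P\mid Q)$ if $a\notin \mathrm{fn}(P)$;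 and $*P\equiv P\mid {*P}$. Reduction $\mapsto$ is the least relation that is closed under parallel composition, restriction and $\equiv$ and contains, for $\sigma=\{b_1/a_1,\dots,b_k/a_k\}$, in $\mathcal L_S$ $$\overline{n_1}\langle b_1\rangle.P_1\mid\cdots\mid\overline{n_k}\langle b_k\rangle.P_k\mid(n_1(a_1)\mid\cdots\mid n_k(a_k))\rhd Q\ \mapsto\ P_1\mid\cdots\mid P_k\mid\sigma Q ,$$ and in $\mathcal L_A$ the same axiom with the $P_i$ omitted. Let $\Mapsto$ be its reflexive transitive closure; $P\mapsto^\omega$ means that $P$ has an infinite reduction sequence; $P\Downarrow$ means that $P\Mapsto P'\equiv P''\mid\checkmark$ for some $P',P''$. An encoding of $\mathcal L_1$ into $\mathcal L_2$ is a map $[\![\cdot]\!]$ from $\mathcal L_1$-processes to $\mathcal L_2$-processes together with a map $\varphi$ from names to $k$-tuples of names, $k>0$. Given an equivalence $\simeq$ on $\mathcal L_2$-processes, it is valid if: 1. (compositionality) for every $k$-ary operator $\mathsf{op}$ of $\mathcal L_1$ and every set $N$ of names there is a context $C$ of $\mathcal L_2$ with $k$ holes, each occurring exactly once, such that $[\![\mathsf{op}(S_1,\dots,S_k)]\!]=C[[\![S_1]\!];\dots;[\![S_k]\!]]$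 whenever $\mathrm{fn}(S_1,\dots,S_k)=N$; 2. (name invariance) for every substitution $\sigma$ (of names for names, with finite domain) there is a substitution $\sigma'$ with $\varphi(\sigma(a))=\sigma'(\varphi(a))$ for all names $a$, and for every such $\sigma'$ and every $S$, $[\![\sigma S]\!]=\sigma'[\![S]\!]$ if $\sigma$ is injective and $[\![\sigma S]\!]\simeq\sigma'[\![S]\!]$ otherwise; 3. (operational correspondence) if $S\Mapsto S'$ then $[\![S]\!]\Mapsto\simeq[\![S']\!]$; and if $[\![S]\!]\Mapsto T$ then there is $S'$ with $S\Mapsto S'$ and $T\Mapsto\simeq[\![S']\!]$; 4. (divergence reflection) if $[\![S]\!]\mapsto^\omega$ then $S\mapsto^\omega$; 5. (success sensitiveness) $S\Downarrow$ if and only if $[\![S]\!]\Downarrow$. **Theorem.** There is a valid encoding of $\mathcal L_{S,M,C,NO,J}$ into $\mathcal L_{A,M,C,NO,J}$. Specifically, let $[\![\cdot]\!]$ be the translation that commutes with all process forms other than outputs and joins, and satisfies, with fresh pairwise distinct names $x,z,x_j,z_j$, $$[\![\overline n\langle a\rangle.P]\!] = (\nu z)\bigl(\overline n\langle z\rangle\mid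 z(x)\rhd(\overline x\langle a\rangle\mid[\![P]\!])\bigr),$$ $$[\![(n_1(a_1)\mid\cdots\mid n_i(a_i))\rhd Q]\!] = (\nu x_1,\dots,x_i)\,(n_1(z_1)\mid\cdots\mid n_i(z_i))\rhd\bigl(\overline{z_1}\langle x_1\rangle\mid\cdots\mid\overline{z_i}\langle x_i\rangle\mid(x_1(a_1)\mid\cdots\mid x_i(a_i))\rhd[\![Q]\!]\bigr).$$ Then: (a) $[\![\cdot]\!]$, with the identity as $\varphi$, is a valid encoding with respect to every equivalence relation $\simeq$ on $\mathcal L_A$-processes that contains $\equiv$ (in particular with respect to $\equiv$ itself); (b) $P\equiv Q$ if and only if $[\![P]\!]\equiv[\![Q]\!]$; (c) if $P\mapsto P'$, then $[\![P]\!]$ reduces, in one or more steps, to some $T\equiv[\![P']\!]$; (d) if $[\![P]\!]\mapsto T$, then there is $P'$ with $P\mapsto P'$ and $T\Mapsto T'\equiv[\![P']\!]$ for some $T'$. -/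

import Mathlib

namespace Joining

/-- The synchronism parameter of a language. -/
inductive Synchronism where
  | sync
  | async

/-- Terms: names and compounds. The countable set of names is `ℕ` throughout. In the languages
below compounds can occur only in conditionals. -/
inductive Term where
  | name (a : ℕ)
  | comp (s t : Term)

namespace Term

/-- Application of a map on names to a term. -/
def rename (f : ℕ → ℕ) : Term → Term
  | name a => name (f a)
  | comp s t => comp (s.rename f) (t.rename f)

/-- The names of a term. -/
def fn : Term → Set ℕ
  | name a => {a}
  | comp s t => s.fn ∪ t.fn

end Term

/-- `Proc α` is the set of processes, up to alpha-equivalence, of the monadic, channel-based,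
no-matching, joining language whose synchronism is `α`.

Processes are in de Bruijn form, so that alpha-equivalence is equality: `res P` binds the index `0`
in `P`, and the join `join m c P` of the `m + 1` inputs on the channels `c 0, …, c m` binds the
indices `0, …, m` in `P`, the index `j` being the name bound by the input on `c j`. Below `d` binders
the free name `n` is written `n + d`. The operators with named binders are `Proc.nu` and
`Proc.joinNamed`. -/
inductive Proc : Synchronism → Type where
  /-- The null process. -/
  | nil {α : Synchronism} : Proc α
  /-- The success process. -/
  | ok {α : Synchronism} : Proc α
  /-- Asynchronous output of `b` on channel `a`. -/
  | aout (a b : ℕ) : Proc .async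
  /-- Synchronous output of `b` on channel `a`, with continuation `P`. -/
  | sout (a b : ℕ) (P : Proc .sync) : Proc .sync
  /-- Joining input. -/
  | join {α : Synchronism} (m : ℕ) (c : Fin (m + 1) → ℕ) (P : Proc α) : Proc α
  /-- Restriction. -/
  | res {α : Synchronism} (P : Proc α) : Proc α
  /-- Parallel composition. -/
  | par {α : Synchronism} (P Q : Proc α) : Proc α
  /-- The conditional `if s = t then P else Q`. -/
  | ite {α : Synchronism} (s t : Term) (P Q : Proc α) : Proc α
  /-- Replication. -/
  | rep {α : Synchronism} (P : Proc α) : Proc α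

/-- The map that `f` induces below `m` binders. -/
def liftBy (m : ℕ) (f : ℕ → ℕ) (n : ℕ) : ℕ :=
  if n < m then n else f (n - m) + m

/-- The map that replaces the `m + 1` innermost bound names by `b 0, …, b m`, and removes their
binders. -/
def inst {m : ℕ} (b : Fin (m + 1) → ℕ) (n : ℕ) : ℕ :=
  if h : n < m + 1 then b ⟨n, h⟩ else n - (m + 1)

/-- The map that turns the name `a` into the index `0` of a new binder. -/
def bindName (a : ℕ) (n : ℕ) : ℕ :=
  if n = a then 0 else n + 1

/-- The map that turns the names `x 0, …, x m` into the indices `0, …, m` of `m + 1` new binders. -/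
def bindNames {m : ℕ} (x : Fin (m + 1) ↪ ℕ) (n : ℕ) : ℕ :=
  if n ∈ List.ofFn x then (List.ofFn x).idxOf n else n + (m + 1)

/-- The exchange of the indices `0` and `1`. -/
def swap01 (n : ℕ) : ℕ :=
  if n = 0 then 1 else if n = 1 then 0 else n

namespace Proc

/-- Capture-avoiding application of a map on names to a process. -/
def rename : {α : Synchronism} → (ℕ → ℕ) → Proc α → Proc α
  | _, _, nil => nil
  | _, _, ok => ok
  | _, f, aout a b => aout (f a) (f b)
  | _, f, sout a b P => sout (f a) (f b) (P.rename f)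
  | _, f, join m c P => join m (fun i => f (c i)) (P.rename (liftBy (m + 1) f))
  | _, f, res P => res (P.rename (liftBy 1 f))
  | _, f, par P Q => par (P.rename f) (Q.rename f)
  | _, f, ite s t P Q => ite (s.rename f) (t.rename f) (P.rename f) (Q.rename f)
  | _, f, rep P => rep (P.rename f)

/-- The free names of a process. -/
def fn : {α : Synchronism} → Proc α → Set ℕ
  | _, nil => ∅
  | _, ok => ∅
  | _, aout a b => {a, b}
  | _, sout a b P => {a, b} ∪ P.fn
  | _, join m c P => Set.range c ∪ {n | n + (m + 1) ∈ P.fn}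
  | _, res P => {n | n + 1 ∈ P.fn}
  | _, par P Q => P.fn ∪ Q.fn
  | _, ite s t P Q => s.fn ∪ t.fn ∪ P.fn ∪ Q.fn
  | _, rep P => P.fn

/-- Restriction of the name `a` in `P`. -/
def nu {α : Synchronism} (a : ℕ) (P : Proc α) : Proc α :=
  res (P.rename (bindName a))

/-- The join of the inputs on the channels `c j` with (pairwise distinct) binding names `x j`. -/
def joinNamed {α : Synchronism} {m : ℕ} (c : Fin (m + 1) → ℕ) (x : Fin (m + 1) ↪ ℕ)
    (P : Proc α) : Proc α :=
  join m c (P.rename (bindNames x))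

/-- The parallel composition of `P 0, …, P m`. -/
def parAll {α : Synchronism} : (m : ℕ) → (Fin (m + 1) → Proc α) → Proc α
  | 0, P => P 0
  | m + 1, P => par (P 0) (parAll m (fun i => P i.succ))

/-- `k` nested restrictions. -/
def resN {α : Synchronism} : ℕ → Proc α → Proc α
  | 0, P => P
  | k + 1, P => res (resN k P)

end Proc

open Proc

/-- Structural equivalence: the least equivalence relation that contains the axioms and is
preserved by parallel composition and by restriction. -/
inductive StructEq {α : Synchronism} : Proc α → Proc α → Prop where
  | refl (P : Proc α) : StructEq P P
  | symm {P Q : Proc α} : StructEq P Q → StructEq Q P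
  | trans {P Q R : Proc α} : StructEq P Q → StructEq Q R → StructEq P R
  | par_congr {P P' : Proc α} (Q : Proc α) : StructEq P P' → StructEq (par P Q) (par P' Q)
  | res_congr {P P' : Proc α} : StructEq P P' → StructEq (res P) (res P')
  | par_nil (P : Proc α) : StructEq (par P nil) P
  | par_comm (P Q : Proc α) : StructEq (par P Q) (par Q P)
  | par_assoc (P Q R : Proc α) : StructEq (par P (par Q R)) (par (par P Q) R)
  | ite_eq (s : Term) (P Q : Proc α) : StructEq (ite s s P Q) P
  | ite_ne {s t : Term} (h : s ≠ t) (P Q : Proc α) : StructEq (ite s t P Q) Q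
  | res_nil : StructEq (res nil) nil
  | res_swap (P : Proc α) : StructEq (res (res P)) (res (res (P.rename swap01)))
  | extrude (P Q : Proc α) : StructEq (par P (res Q)) (res (par (P.rename Nat.succ) Q))
  | rep_unfold (P : Proc α) : StructEq (rep P) (par P (rep P))

/-- The reduction relation of the language with synchronism `α`. -/
inductive Red : {α : Synchronism} → Proc α → Proc α → Prop where
  /-- The interaction axiom of the synchronous language. -/
  | comm_sync (m : ℕ) (c b : Fin (m + 1) → ℕ) (P : Fin (m + 1) → Proc .sync)
      (Q : Proc .sync) :
      Red (par (parAll m (fun i => sout (c i) (b i) (P i))) (join m c Q))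
        (par (parAll m P) (Q.rename (inst b)))
  /-- The interaction axiom of the asynchronous language. -/
  | comm_async (m : ℕ) (c b : Fin (m + 1) → ℕ) (Q : Proc .async) :
      Red (par (parAll m (fun i => aout (c i) (b i))) (join m c Q)) (Q.rename (inst b))
  | par {α : Synchronism} {P P' : Proc α} (Q : Proc α) :
      Red P P' → Red (Proc.par P Q) (Proc.par P' Q)
  | res {α : Synchronism} {P P' : Proc α} : Red P P' → Red (Proc.res P) (Proc.res P')
  | struct {α : Synchronism} {P P' Q Q' : Proc α} :
      StructEq P Q → Red Q Q' → StructEq Q' P' → Red P P'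

/-- The reflexive transitive closure of reduction. -/
def Reds {α : Synchronism} (P Q : Proc α) : Prop :=
  Relation.ReflTransGen Red P Q

/-- There is an infinite sequence of reductions from `P`. -/
def Diverges {α : Synchronism} (P : Proc α) : Prop :=
  ∃ f : ℕ → Proc α, f 0 = P ∧ ∀ i, Red (f i) (f (i + 1))

/-- `P` can reduce to a process in which success is at top level. -/
def Succeeds {α : Synchronism} (P : Proc α) : Prop :=
  ∃ P' P'' : Proc α, Reds P P' ∧ StructEq P' (par P'' ok)

/-- The `k`-ary operators of the language with synchronism `α`, with named binders. -/
inductive Op : Synchronism → ℕ → Type where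
  | nil {α : Synchronism} : Op α 0
  | ok {α : Synchronism} : Op α 0
  | aout (a b : ℕ) : Op .async 0
  | sout (a b : ℕ) : Op .sync 1
  | join {α : Synchronism} {m : ℕ} (c : Fin (m + 1) → ℕ) (x : Fin (m + 1) ↪ ℕ) : Op α 1
  | nu {α : Synchronism} (a : ℕ) : Op α 1
  | par {α : Synchronism} : Op α 2
  | ite {α : Synchronism} (s t : Term) : Op α 2
  | rep {α : Synchronism} : Op α 1

/-- The application of an operator to processes. -/
def Op.apply : {α : Synchronism} → {k : ℕ} → Op α k → (Fin k → Proc α) → Proc α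
  | _, _, .nil, _ => Proc.nil
  | _, _, .ok, _ => Proc.ok
  | _, _, .aout a b, _ => Proc.aout a b
  | _, _, .sout a b, P => Proc.sout a b (P 0)
  | _, _, .join c x, P => Proc.joinNamed c x (P 0)
  | _, _, .nu a, P => Proc.nu a (P 0)
  | _, _, .par, P => Proc.par (P 0) (P 1)
  | _, _, .ite s t, P => Proc.ite s t (P 0) (P 1)
  | _, _, .rep, P => Proc.rep (P 0)

/-- Terms of the language with synchronism `α`, with named binders, in which holes numbered by
`Fin k` may occur. -/
inductive Ctx (α : Synchronism) (k : ℕ) where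
  | hole (i : Fin k) : Ctx α k
  | node {n : ℕ} (op : Op α n) (args : Fin n → Ctx α k) : Ctx α k

namespace Ctx

/-- Filling of the holes of a context (binders of the context capture names of the fillers). -/
def fill {α : Synchronism} {k : ℕ} (P : Fin k → Proc α) : Ctx α k → Proc α
  | hole i => P i
  | node op args => op.apply (fun j => (args j).fill P)

/-- The number of occurrences of the hole `i`. -/
def occ {α : Synchronism} {k : ℕ} (i : Fin k) : Ctx α k → ℕ
  | hole j => if j = i then 1 else 0
  | node _ args => ∑ j, (args j).occ i

/-- Every hole occurs exactly once: the context is a `k`-ary context. -/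
def Linear {α : Synchronism} {k : ℕ} (C : Ctx α k) : Prop :=
  ∀ i, C.occ i = 1

end Ctx

/-- An encoding of the language with synchronism `α` into the one with synchronism `β`:
a translation of processes, and a renaming policy that maps names to tuples of `k > 0` names. -/
structure Encoding (α β : Synchronism) where
  trans : Proc α → Proc β
  k : ℕ
  k_pos : 0 < k
  policy : ℕ → Fin k → ℕ

/-- A substitution: a map from names to names with finite domain. -/
def IsSubst (σ : ℕ → ℕ) : Prop :=
  {a | σ a ≠ a}.Finite

/-- The renaming policy of `E` carries `σ` to `σ'`. -/
def Encoding.Transports {α β : Synchronism} (E : Encoding α β) (σ σ' : ℕ → ℕ) : Prop :=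
  ∀ a i, E.policy (σ a) i = σ' (E.policy a i)

/-- Validity of an encoding, with respect to the reference behavioural equivalence `beq` of the
target language. -/
structure Encoding.Valid {α β : Synchronism} (E : Encoding α β) (beq : Proc β → Proc β → Prop) :
    Prop where
  compositionality : ∀ (k : ℕ) (op : Op α k) (N : Set ℕ), ∃ C : Ctx β k, C.Linear ∧
    ∀ S : Fin k → Proc α, (⋃ i, (S i).fn) = N →
      E.trans (op.apply S) = C.fill (fun i => E.trans (S i))
  name_invariance : ∀ σ, IsSubst σ →
    (∃ σ', IsSubst σ' ∧ E.Transports σ σ') ∧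
    ∀ σ', IsSubst σ' → E.Transports σ σ' → ∀ S : Proc α,
      (Function.Injective σ → E.trans (S.rename σ) = (E.trans S).rename σ') ∧
      (¬ Function.Injective σ → beq (E.trans (S.rename σ)) ((E.trans S).rename σ'))
  completeness : ∀ S S' : Proc α, Reds S S' → ∃ T, Reds (E.trans S) T ∧ beq T (E.trans S')
  soundness : ∀ (S : Proc α) (T : Proc β), Reds (E.trans S) T →
    ∃ S', Reds S S' ∧ ∃ T', Reds T T' ∧ beq T' (E.trans S')
  divergence_reflection : ∀ S : Proc α, Diverges (E.trans S) → Diverges S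
  success_sensitiveness : ∀ S : Proc α, Succeeds S ↔ Succeeds (E.trans S)

/-- The handshake translation, homomorphic except on outputs and joins.

An output of `a` on `n` followed by `P` becomes `(νz)(n⟨z⟩ | z(x) ▷ (x⟨a⟩ | ⟦P⟧))`; below the
restriction `z` is `0`, and below the input `x` is `0` and `z` is `1`.

A join of the inputs `c j (a j)`, for `j ≤ m`, with body `Q` becomes
`(νx₀, …, xₘ)((c₀(z₀) | … | cₘ(zₘ)) ▷ (z₀⟨x₀⟩ | … | zₘ⟨xₘ⟩ | (x₀(a₀) | … | xₘ(aₘ)) ▷ ⟦Q⟧))`;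
below the restrictions `x j` is `j`, below the outer join `z j` is `j` and `x j` is `m + 1 + j`, and
below the inner join `a j` is `j`, while `z` and `x` take up the next `2 * (m + 1)` indices. -/
def handshake : Proc .sync → Proc .async
  | .nil => .nil
  | .ok => .ok
  | .sout n a P =>
      res (par (aout (n + 1) 0)
        (join 0 (fun _ => 0) (par (aout 0 (a + 2)) ((handshake P).rename (fun k => k + 2)))))
  | .join m c Q =>
      resN (m + 1) (join m (fun j => c j + (m + 1))
        (par (parAll m (fun j => aout (j : ℕ) (m + 1 + j)))
          (join m (fun j => m + 1 + j)
            ((handshake Q).rename (liftBy (m + 1) (fun k => k + 2 * (m + 1)))))))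
  | .res P => .res (handshake P)
  | .par P Q => .par (handshake P) (handshake Q)
  | .ite s t P Q => .ite s t (handshake P) (handshake Q)
  | .rep P => .rep (handshake P)

/-- The handshake encoding: the handshake translation, with the identity as renaming policy. -/
def handshakeEncoding : Encoding .sync .async where
  trans := handshake
  k := 1
  k_pos := Nat.one_pos
  policy a _ := a

end Joining

namespace Joining
open Proc

/-! A source interaction of `m + 1` outputs with a join becomes `m + 3` target interactions. The
first consumes the outputs on the original channels and hands the join the private names `z j`. Then
`m + 1` interactions on the `z j` release the continuations and tell each sender the private name `x
j`, and a last one on the `x j` delivers the payloads. Only the first makes a choice. The others use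
channels that occur nowhere else, so they commute with every other interaction (`Admin.diamond`) and
can always be completed (`Enc.complete`).

The main obstacle is structural equivalence, which may be used in any direction around a reduction.
It is tamed by a normal form. `Opens` instantiates the top-level restrictions by distinct fresh
names, resolves conditionals and collects the remaining guarded processes in a multiset. Such a
multiset is unique up to a permutation of the fresh names (`Opens.unique`) and determines the
process up to equivalence (`Opens.structEq`). The only axiom that leaves a trace is the unfolding of
replications. Together with changes of private names it is a confluent rewriting `Step`, so
structural equivalence is joinability of components (`structEq_iff_eqv`). Reduction becomes multiset
rewriting `Comm`, which is stable under `Step` (`Comm.steps`, `Red.commEqv`).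

`Encodes S T` says that `T` is an opening of the translations of the components `S`. Since
equivalence does not act below prefixes or replications, bodies of components are compared as
syntax; as the translation is injective, `T` determines `S` (`Encodes.injective`). Each `Step` of
`T` is matched by one of `S` (`Encodes.step`), so a common reduct of two translations comes from a
common reduct of their sources: the translation reflects equivalence.

For reductions, every `Comm` of `T` begins the translation of a `Comm` of `S`, and conversely
(`Encodes.comm`, `Encodes.exists_comm`). Intermediate states are described by `Tracks P n T`, with
`n` private interactions pending. By the diamond, a further interaction either lowers `n` or reduces
`P` (`Tracks.comm`). Operational correspondence follows, and so does divergence reflection, because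
`n` cannot decrease forever. Success is preserved and reflected because private interactions never
consume the success process. -/

/-! ### Renamings of terms and processes. -/

theorem liftBy_id (m : ℕ) : liftBy m id = id := by
  funext n; simp only [liftBy, id]; split <;> omega

theorem liftBy_comp (m : ℕ) (g f : ℕ → ℕ) : liftBy m g ∘ liftBy m f = liftBy m (g ∘ f) := by
  funext n; simp only [liftBy, Function.comp]; split <;> simp_all

theorem liftBy_injective {f : ℕ → ℕ} (m : ℕ) (hf : Function.Injective f) :
    Function.Injective (liftBy m f) := by
  intro a b h
  simp only [liftBy] at h
  split at h <;> split at h <;> try omega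
  have := hf (Nat.add_right_cancel h)
  omega

/-- The map that replaces the indices below `k` by `x` and removes their binders. -/
def instBelow {k : ℕ} (x : Fin k → ℕ) (n : ℕ) : ℕ :=
  if h : n < k then x ⟨n, h⟩ else n - k

theorem inst_eq_instBelow {m : ℕ} (b : Fin (m + 1) → ℕ) : inst b = instBelow b := rfl

/-- The map that replaces the index `0` by `z` and removes its binder. -/
def sub (z : ℕ) : ℕ → ℕ
  | 0 => z
  | n + 1 => n

@[simp] theorem sub_zero (z : ℕ) : sub z 0 = z := rfl
@[simp] theorem sub_succ (z n : ℕ) : sub z (n + 1) = n := rfl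

theorem instBelow_comp_liftBy {k : ℕ} (x : Fin k → ℕ) (f : ℕ → ℕ) :
    instBelow (fun i => f (x i)) ∘ liftBy k f = f ∘ instBelow x := by
  funext n
  simp only [instBelow, liftBy, Function.comp]
  by_cases h : n < k <;> simp [h]

theorem sub_comp_liftBy (z : ℕ) (f : ℕ → ℕ) : sub (f z) ∘ liftBy 1 f = f ∘ sub z := by
  funext n
  cases n <;> simp [sub, liftBy]

namespace Term

@[simp] theorem rename_id (s : Term) : s.rename id = s := by
  induction s <;> simp_all [rename]

theorem rename_rename (g f : ℕ → ℕ) (s : Term) : (s.rename f).rename g = s.rename (g ∘ f) := by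
  induction s <;> simp_all [rename]

theorem rename_congr {f g : ℕ → ℕ} (s : Term) (h : ∀ n ∈ s.fn, f n = g n) :
    s.rename f = s.rename g := by
  induction s with
  | name a => simpa [rename, fn] using h
  | comp s t hs ht =>
    simp only [rename, comp.injEq]
    exact ⟨hs fun n hn => h n (Or.inl hn), ht fun n hn => h n (Or.inr hn)⟩

theorem fn_rename (f : ℕ → ℕ) (s : Term) : (s.rename f).fn = f '' s.fn := by
  induction s <;> simp_all [rename, fn, Set.image_union]

theorem fn_finite (s : Term) : s.fn.Finite := by
  induction s with
  | name a => exact Set.finite_singleton a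
  | comp s t hs ht => exact hs.union ht

theorem rename_injective {f : ℕ → ℕ} (hf : Function.Injective f) :
    Function.Injective (rename f) := by
  intro s
  induction s with
  | name a => intro t h; cases t <;> simp_all [rename]; exact hf h
  | comp s t hs ht =>
    intro u h
    cases u with
    | name => simp [rename] at h
    | comp u v =>
      simp only [rename, comp.injEq] at h
      rw [hs h.1, ht h.2]

end Term

namespace Proc
variable {α : Synchronism}

@[simp] theorem rename_id (P : Proc α) : P.rename id = P := by
  induction P <;> simp_all [rename, liftBy_id]

theorem rename_rename (g f : ℕ → ℕ) (P : Proc α) :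
    (P.rename f).rename g = P.rename (g ∘ f) := by
  induction P generalizing f g <;>
    simp_all [rename, liftBy_comp, Term.rename_rename]

theorem rename_congr {f g : ℕ → ℕ} (P : Proc α) (h : ∀ n ∈ P.fn, f n = g n) :
    P.rename f = P.rename g := by
  have lift : ∀ (m : ℕ) (f g : ℕ → ℕ) (S : Set ℕ), (∀ n, n + m ∈ S → f n = g n) →
      ∀ n ∈ S, liftBy m f n = liftBy m g n := by
    intro m f g S h n hn
    simp only [liftBy]
    split
    · rfl
    · rw [h (n - m) (by rwa [Nat.sub_add_cancel (by omega)])]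
  induction P generalizing f g with
  | nil => rfl
  | ok => rfl
  | aout a b => simp_all [rename, fn]
  | sout a b P ih =>
    simp only [rename, sout.injEq]
    refine ⟨h _ (by simp [fn]), h _ (by simp [fn]), ih fun n hn => h n (by simp [fn, hn])⟩
  | join m c P ih =>
    simp only [rename, join.injEq, true_and, heq_eq_eq]
    refine ⟨funext fun i => h _ (Or.inl ⟨i, rfl⟩), ih (lift _ _ _ _ fun n hn => h n (Or.inr hn))⟩
  | res P ih => simp only [rename, ih (lift _ _ _ _ fun n hn => h n hn)]
  | par P Q ihP ihQ =>
    simp only [rename, ihP fun n hn => h n (Or.inl hn), ihQ fun n hn => h n (Or.inr hn)]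
  | ite s t P Q ihP ihQ =>
    simp only [fn, Set.mem_union] at h
    simp only [rename, ihP fun n hn => h n (by tauto), ihQ fun n hn => h n (by tauto),
      Term.rename_congr s fun n hn => h n (by tauto),
      Term.rename_congr t fun n hn => h n (by tauto)]
  | rep P ih => simp only [rename, ih h]

theorem rename_eq_self {f : ℕ → ℕ} (P : Proc α) (h : ∀ n ∈ P.fn, f n = n) :
    P.rename f = P := by
  rw [rename_congr (g := id) P h, rename_id]

theorem fn_rename (f : ℕ → ℕ) (P : Proc α) : (P.rename f).fn = f '' P.fn := by
  have lift : ∀ (m : ℕ) (f : ℕ → ℕ) (S : Set ℕ),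
      {n | n + m ∈ liftBy m f '' S} = f '' {n | n + m ∈ S} := by
    intro m f S
    ext n
    simp only [Set.mem_ofPred_eq, Set.mem_image, liftBy]
    constructor
    · rintro ⟨k, hk, e⟩
      split at e
      · omega
      · exact ⟨k - m, by rwa [Nat.sub_add_cancel (by omega)], by omega⟩
    · rintro ⟨k, hk, rfl⟩
      exact ⟨k + m, hk, by simp⟩
  induction P generalizing f with
  | nil => simp [rename, fn]
  | ok => simp [rename, fn]
  | aout a b => simp [rename, fn, Set.image_pair]
  | sout a b P ih => simp [rename, fn, ih, Set.image_union, Set.image_insert_eq]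
  | join m c P ih =>
    simp only [rename, fn, ih, Set.image_union, lift]
    rw [← Set.range_comp]; rfl
  | res P ih => simp only [rename, fn, ih, lift]
  | par P Q ihP ihQ => simp only [rename, fn, ihP, ihQ, Set.image_union]
  | ite s t P Q ihP ihQ => simp only [rename, fn, ihP, ihQ, Set.image_union, Term.fn_rename]
  | rep P ih => simp only [rename, fn, ih]

theorem fn_finite (P : Proc α) : P.fn.Finite := by
  have lift : ∀ (m : ℕ) (S : Set ℕ), S.Finite → {n | n + m ∈ S}.Finite := fun m S h =>
    h.preimage (f := fun n => n + m) (fun a _ b _ e => Nat.add_right_cancel e)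
  induction P with
  | nil => exact Set.finite_empty
  | ok => exact Set.finite_empty
  | aout a b => exact Set.toFinite {a, b}
  | sout a b P ih => exact (Set.toFinite {a, b}).union ih
  | join m c P ih => exact (Set.finite_range c).union (lift _ _ ih)
  | res P ih => exact lift _ _ ih
  | par P Q ihP ihQ => exact ihP.union ihQ
  | ite s t P Q ihP ihQ => exact ((s.fn_finite.union t.fn_finite).union ihP).union ihQ
  | rep P ih => exact ih

theorem rename_injective {f : ℕ → ℕ} (hf : Function.Injective f) :
    Function.Injective (rename f : Proc α → Proc α) := by
  intro P Q h
  have hg := Function.leftInverse_invFun hf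
  have := congrArg (rename (Function.invFun f)) h
  simpa [rename_rename, hg.comp_eq_id] using this

/-- The processes that are neither empty nor decomposed by structural equivalence, except that
replications can be unfolded. -/
inductive Guarded : {α : Synchronism} → Proc α → Prop
  | ok {α : Synchronism} : Guarded (ok (α := α))
  | aout (a b : ℕ) : Guarded (aout a b)
  | sout (a b : ℕ) (P : Proc .sync) : Guarded (sout a b P)
  | join {α : Synchronism} (m : ℕ) (c : Fin (m + 1) → ℕ) (P : Proc α) : Guarded (join m c P)
  | rep {α : Synchronism} (P : Proc α) : Guarded (rep P)

theorem Guarded.rename {p : Proc α} (h : Guarded p) (f : ℕ → ℕ) : Guarded (p.rename f) := by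
  cases h <;> constructor

end Proc

/-! ### Multisets of processes. -/

/-- The free names of a multiset of processes. -/
def names {α : Synchronism} (M : Multiset (Proc α)) : Set ℕ :=
  {n | ∃ p ∈ M, n ∈ p.fn}

/-- Renaming of a multiset of processes. -/
def ren {α : Synchronism} (f : ℕ → ℕ) (M : Multiset (Proc α)) : Multiset (Proc α) :=
  M.map (Proc.rename f)

section
variable {α : Synchronism}

@[simp] theorem names_zero : names (0 : Multiset (Proc α)) = ∅ := by simp [names]

@[simp] theorem names_singleton (p : Proc α) : names {p} = p.fn := by simp [names]

@[simp] theorem names_add (M N : Multiset (Proc α)) : names (M + N) = names M ∪ names N := by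
  ext n; simp only [names, Multiset.mem_add, Set.mem_ofPred_eq, Set.mem_union]
  grind

@[simp] theorem names_cons (p : Proc α) (N : Multiset (Proc α)) :
    names (p ::ₘ N) = p.fn ∪ names N := by
  rw [← Multiset.singleton_add, names_add, names_singleton]

theorem fn_subset_names {p : Proc α} {M : Multiset (Proc α)} (h : p ∈ M) : p.fn ⊆ names M :=
  fun _ hn => ⟨p, h, hn⟩

theorem names_finite (M : Multiset (Proc α)) : (names M).Finite := by
  induction M using Multiset.induction with
  | empty => simp
  | cons p M ih => simpa using ⟨p.fn_finite, ih⟩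

@[simp] theorem ren_zero (f : ℕ → ℕ) : ren f (0 : Multiset (Proc α)) = 0 := rfl

@[simp] theorem ren_add (f : ℕ → ℕ) (M N : Multiset (Proc α)) :
    ren f (M + N) = ren f M + ren f N := Multiset.map_add ..

@[simp] theorem ren_cons (f : ℕ → ℕ) (p : Proc α) (N : Multiset (Proc α)) :
    ren f (p ::ₘ N) = p.rename f ::ₘ ren f N := Multiset.map_cons ..

@[simp] theorem ren_singleton (f : ℕ → ℕ) (p : Proc α) : ren f {p} = {p.rename f} := rfl

theorem ren_ren (g f : ℕ → ℕ) (M : Multiset (Proc α)) : ren g (ren f M) = ren (g ∘ f) M := by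
  simp [ren, Multiset.map_map, Function.comp_def, rename_rename]

@[simp] theorem ren_id (M : Multiset (Proc α)) : ren id M = M := by
  simp [ren]

theorem ren_congr {f g : ℕ → ℕ} {M : Multiset (Proc α)} (h : ∀ n ∈ names M, f n = g n) :
    ren f M = ren g M :=
  Multiset.map_congr rfl fun p hp => p.rename_congr fun n hn => h n ⟨p, hp, hn⟩

theorem ren_eq_self {f : ℕ → ℕ} {M : Multiset (Proc α)} (h : ∀ n ∈ names M, f n = n) :
    ren f M = M := by
  rw [ren_congr (g := id) h, ren_id]

theorem names_ren (f : ℕ → ℕ) (M : Multiset (Proc α)) : names (ren f M) = f '' names M := by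
  induction M using Multiset.induction with
  | empty => simp
  | cons p M ih => simp [ih, fn_rename, Set.image_union]

@[simp] theorem ren_symm_ren (π : Equiv.Perm ℕ) (M : Multiset (Proc α)) :
    ren π.symm (ren π M) = M := by
  simp [ren_ren]

@[simp] theorem ren_ren_symm (π : Equiv.Perm ℕ) (M : Multiset (Proc α)) :
    ren π (ren π.symm M) = M := by
  simp [ren_ren]

theorem fn_sub (P : Proc α) (z : ℕ) : (P.rename (sub z)).fn ⊆ insert z (res P).fn := by
  rw [Proc.fn_rename]
  rintro _ ⟨n, hn, rfl⟩
  cases n with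
  | zero => simp
  | succ n => exact Or.inr hn

theorem rename_sub_rename (P : Proc α) (f : ℕ → ℕ) (z : ℕ) :
    (P.rename (liftBy 1 f)).rename (sub (f z)) = (P.rename (sub z)).rename f := by
  simp only [rename_rename, sub_comp_liftBy]

end

/-! ### Opening a process into its top-level components. -/

/-- `Opens A P X`: the guarded components of `P` at top level are `X`, when its restricted names
are instantiated by distinct names outside `A` and conditionals are resolved. -/
inductive Opens {α : Synchronism} : Set ℕ → Proc α → Multiset (Proc α) → Prop
  | nil (A : Set ℕ) : Opens A nil 0
  | guarded (A : Set ℕ) {p : Proc α} (h : Guarded p) : Opens A p {p}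
  | par {A : Set ℕ} {P Q : Proc α} {X Y : Multiset (Proc α)} :
      Opens A P X → Opens (A ∪ names X) Q Y → Opens A (par P Q) (X + Y)
  | res {A : Set ℕ} {P : Proc α} {X : Multiset (Proc α)} {z : ℕ} :
      z ∉ A → Opens (insert z A) (P.rename (sub z)) X → Opens A (res P) X
  | ite_eq {A : Set ℕ} {P : Proc α} {X : Multiset (Proc α)} (s : Term) (Q : Proc α) :
      Opens A P X → Opens A (ite s s P Q) X
  | ite_ne {A : Set ℕ} {Q : Proc α} {X : Multiset (Proc α)} {s t : Term} (h : s ≠ t)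
      (P : Proc α) : Opens A Q X → Opens A (ite s t P Q) X

theorem infinite_compl_union {A F : Set ℕ} (hA : Aᶜ.Infinite) (hF : F.Finite) :
    (A ∪ F)ᶜ.Infinite := by
  rw [Set.compl_union, ← Set.sdiff_eq]
  exact hA.sdiff hF

namespace Opens
variable {α : Synchronism} {A B : Set ℕ} {P Q : Proc α} {X Y : Multiset (Proc α)}

theorem nil_iff : Opens A (Proc.nil : Proc α) X ↔ X = 0 := by
  constructor
  · intro h
    cases h with
    | nil => rfl
    | guarded _ h => cases h
  · rintro rfl; exact .nil A

theorem guarded_iff {p : Proc α} (hp : Guarded p) : Opens A p X ↔ X = {p} := by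
  constructor
  · intro h
    cases h with
    | guarded => rfl
    | _ => cases hp
  · rintro rfl; exact .guarded A hp

theorem par_inv {Z : Multiset (Proc α)} (h : Opens A (Proc.par P Q) Z) :
    ∃ X Y, Z = X + Y ∧ Opens A P X ∧ Opens (A ∪ names X) Q Y := by
  cases h with
  | guarded _ h => cases h
  | par h h' => exact ⟨_, _, rfl, h, h'⟩

theorem res_iff : Opens A (Proc.res P) X ↔
    ∃ z, z ∉ A ∧ Opens (insert z A) (P.rename (sub z)) X := by
  constructor
  · intro h
    cases h with
    | guarded _ h => cases h
    | res h h' => exact ⟨_, h, h'⟩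
  · rintro ⟨z, h, h'⟩; exact .res h h'

theorem ite_eq_iff {s : Term} : Opens A (Proc.ite s s P Q) X ↔ Opens A P X := by
  constructor
  · intro h
    cases h with
    | guarded _ h => cases h
    | ite_eq _ _ h => exact h
    | ite_ne h => exact absurd rfl h
  · exact .ite_eq s Q

theorem ite_ne_iff {s t : Term} (hst : s ≠ t) :
    Opens A (Proc.ite s t P Q) X ↔ Opens A Q X := by
  constructor
  · intro h
    cases h with
    | guarded _ h => cases h
    | ite_eq _ _ h => exact absurd rfl hst
    | ite_ne _ _ h => exact h
  · exact .ite_ne hst P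

theorem of_mem (h : Opens A P X) : ∀ p ∈ X, Guarded p := by
  induction h with
  | nil => simp
  | guarded _ h => simpa
  | par _ _ h h' => intro p hp; exact (Multiset.mem_add.1 hp).elim (h p) (h' p)
  | res _ _ h => exact h
  | ite_eq _ _ _ h => exact h
  | ite_ne _ _ _ h => exact h

theorem anti (h : Opens A P X) (hB : B ⊆ A) : Opens B P X := by
  induction h generalizing B with
  | nil => exact .nil B
  | guarded _ h => exact .guarded B h
  | par _ _ h h' => exact .par (h hB) (h' (Set.union_subset_union_left _ hB))
  | res hz _ h => exact .res (fun hz' => hz (hB hz')) (h (Set.insert_subset_insert hB))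
  | ite_eq s Q _ h => exact .ite_eq s Q (h hB)
  | ite_ne hst P _ h => exact .ite_ne hst P (h hB)

/-- Injectivity keeps fresh names fresh and distinct, and keeps unequal terms of a conditional
unequal. -/
theorem map (h : Opens A P X) {f : ℕ → ℕ} (hf : Function.Injective f) :
    Opens (f '' A) (P.rename f) (ren f X) := by
  induction h with
  | nil => exact .nil _
  | guarded _ h => exact .guarded _ (h.rename f)
  | par _ _ h h' =>
    rw [Set.image_union, ← names_ren] at h'
    rw [ren_add]
    exact .par h h'
  | @res A P X z hz _ h =>
    rw [Set.image_insert_eq, ← rename_sub_rename] at h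
    exact .res (by simpa [hf.eq_iff] using hz) h
  | ite_eq s Q _ h => exact .ite_eq _ _ h
  | ite_ne hst P _ h => exact .ite_ne (fun e => hst (Term.rename_injective hf e)) _ h

theorem names_subset (h : Opens A P X) : names X ⊆ P.fn ∪ Aᶜ := by
  induction h with
  | nil => simp
  | guarded _ h => simp
  | par _ _ h h' =>
    intro n hn
    rcases (names_add _ _ ▸ hn) with hn | hn
    · have := h hn; simp [fn] at *; tauto
    · have := h' hn; simp [fn] at *; tauto
  | res hz _ h =>
    intro n hn
    rcases h hn with hn | hn
    · rcases fn_sub _ _ hn with rfl | hn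
      · exact Or.inr hz
      · exact Or.inl hn
    · exact Or.inr fun hA => hn (Or.inr hA)
  | ite_eq _ _ _ h => exact h.trans fun n => by simp [fn]; tauto
  | ite_ne _ _ _ h => exact h.trans fun n => by simp [fn]; tauto

theorem exists_of_infinite (P : Proc α) (hA : Aᶜ.Infinite) : ∃ X, Opens A P X := by
  -- The body of a restriction is opened after an instantiation, so the induction on `P` has to
  -- allow an arbitrary renaming.
  suffices h : ∀ f : ℕ → ℕ, ∃ X, Opens A (P.rename f) X by simpa using h id
  induction P generalizing A with
  | nil => exact fun f => ⟨_, .nil A⟩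
  | ok => exact fun f => ⟨_, .guarded A .ok⟩
  | aout a b => exact fun f => ⟨_, .guarded A (.aout _ _)⟩
  | sout a b P _ => exact fun f => ⟨_, .guarded A (.sout _ _ _)⟩
  | join m c P _ => exact fun f => ⟨_, .guarded A (.join _ _ _)⟩
  | rep P _ => exact fun f => ⟨_, .guarded A (.rep _)⟩
  | res P ih =>
    intro f
    obtain ⟨z, hz⟩ := hA.nonempty
    have hA' : (insert z A)ᶜ.Infinite := by
      have := hA.sdiff (Set.finite_singleton z)
      rwa [show (insert z A)ᶜ = Aᶜ \ {z} by ext; simp; tauto]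
    obtain ⟨X, hX⟩ := ih hA' (sub z ∘ liftBy 1 f)
    exact ⟨X, .res hz (by rwa [Proc.rename_rename])⟩
  | par P Q ihP ihQ =>
    intro f
    obtain ⟨X, hX⟩ := ihP hA f
    have hA' : (A ∪ names X)ᶜ.Infinite := by
      have := hA.sdiff (names_finite X)
      rwa [Set.compl_union, ← Set.sdiff_eq]
    obtain ⟨Y, hY⟩ := ihQ hA' f
    exact ⟨_, .par hX hY⟩
  | ite s t P Q ihP ihQ =>
    intro f
    by_cases hst : s.rename f = t.rename f
    · obtain ⟨X, hX⟩ := ihP hA f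
      exact ⟨X, by simp only [Proc.rename]; rw [hst]; exact .ite_eq _ _ hX⟩
    · obtain ⟨X, hX⟩ := ihQ hA f
      exact ⟨X, .ite_ne hst _ hX⟩

/-- Two openings differ only in the choice of fresh names, and a permutation fixing the free names
of `P` translates one choice into the other. The set `C` of further fixed names lets the induction
protect names already matched. -/
theorem unique (h : Opens A P X) {B C : Set ℕ} (h' : Opens B P Y) (hP : P.fn ⊆ C)
    (hCA : C ⊆ A) (hCB : C ⊆ B) :
    ∃ π : Equiv.Perm ℕ, (∀ n ∈ C, π n = n) ∧ Y = ren π X := by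
  induction h generalizing B C Y with
  | nil => exact ⟨1, by simp, by simpa using nil_iff.1 h'⟩
  | guarded _ h => exact ⟨1, by simp, by simpa using (guarded_iff h).1 h'⟩
  | ite_eq s Q _ h =>
    refine h (ite_eq_iff.1 h') (fun n hn => hP ?_) hCA hCB
    simp [fn]; tauto
  | ite_ne hst P _ h =>
    refine h ((ite_ne_iff hst).1 h') (fun n hn => hP ?_) hCA hCB
    simp [fn]; tauto
  | @par A P Q X₁ X₂ _ _ h₁ h₂ =>
    obtain ⟨Y₁, Y₂, rfl, h₁', h₂'⟩ := par_inv h'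
    obtain ⟨π, hπ, rfl⟩ := h₁ h₁' (fun n hn => hP (Or.inl hn)) hCA hCB
    have hC : ∀ n ∈ C, π.symm n = n := fun n hn => by
      rw [Equiv.symm_apply_eq, hπ n hn]
    -- Undoing `π` on the second factor makes the components of the first factor agree in both
    -- openings; their names can then join the fixed set.
    have h₃ := h₂'.map π.symm.injective
    rw [Proc.rename_eq_self Q fun n hn => hC n (hP (Or.inr hn)), Set.image_union, ← names_ren,
      ren_symm_ren] at h₃
    obtain ⟨ρ, hρ, e⟩ := h₂ (C := C ∪ names X₁) h₃ (fun n hn => Or.inl (hP (Or.inr hn)))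
      (Set.union_subset_union_left _ hCA)
      (Set.union_subset_union_left _ fun n hn => ⟨n, hCB hn, hC n hn⟩)
    refine ⟨ρ.trans π, fun n hn => by simp [hρ n (Or.inl hn), hπ n hn], ?_⟩
    have e' := congrArg (ren π) e
    rw [ren_ren_symm, ren_ren] at e'
    rw [e', ren_add, Equiv.coe_trans]
    congr 1
    exact ren_congr fun n hn => by simp [hρ n (Or.inr hn)]
  | @res A P X z hz _ ih =>
    obtain ⟨w, hw, h'⟩ := res_iff.1 h'
    -- The two witnesses of the restriction are exchanged; both lie outside `C`.
    have hsw : ∀ n ∈ C, Equiv.swap z w n = n := fun n hn =>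
      Equiv.swap_apply_of_ne_of_ne (fun e => hz (hCA (e ▸ hn))) (fun e => hw (hCB (e ▸ hn)))
    have h₃ := h'.map (Equiv.swap z w).injective
    rw [← rename_sub_rename, Equiv.swap_apply_right,
      show (P.rename (liftBy 1 (Equiv.swap z w))) = P from
        (Proc.res.injEq _ _).mp (Proc.rename_eq_self (Proc.res P) fun n hn => hsw n (hP hn)),
      Set.image_insert_eq, Equiv.swap_apply_right] at h₃
    obtain ⟨π, hπ, e⟩ := ih (C := insert z C) h₃
      ((fn_sub P z).trans (Set.insert_subset_insert hP)) (Set.insert_subset_insert hCA)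
      (Set.insert_subset_insert fun n hn => ⟨n, hCB hn, hsw n hn⟩)
    refine ⟨π.trans (Equiv.swap z w), fun n hn => ?_, ?_⟩
    · simp [hπ n (Or.inr hn), hsw n hn]
    · rw [Equiv.coe_trans, ← ren_ren, ← e, ren_ren]
      simp [← Equiv.coe_trans]

/-- Names that do not occur in the result may be declared forbidden afterwards. The only difficulty
is a witness of a vacuous restriction: it can lie in `D` without occurring in `X`, and is then
replaced by another name. -/
theorem enlarge (h : Opens A P X) {D : Set ℕ} (hD : D ∩ names X ⊆ A) (hP : P.fn ⊆ A)
    (hi : (A ∪ D)ᶜ.Infinite) : Opens (A ∪ D) P X := by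
  induction h generalizing D with
  | nil => exact .nil _
  | guarded _ h => exact .guarded _ h
  | ite_eq s Q _ h =>
    exact .ite_eq s Q (h hD (fun n hn => hP (by simp [fn]; tauto)) hi)
  | ite_ne hst P _ h =>
    exact .ite_ne hst P (h hD (fun n hn => hP (by simp [fn]; tauto)) hi)
  | @par A P Q X₁ X₂ _ _ h₁ h₂ =>
    rw [names_add] at hD
    refine .par (h₁ (fun n hn => hD ⟨hn.1, Or.inl hn.2⟩) (fun n hn => hP (Or.inl hn)) hi) ?_
    rw [Set.union_right_comm]
    refine h₂ (fun n hn => Or.inl (hD ⟨hn.1, Or.inr hn.2⟩)) (fun n hn => Or.inl (hP (Or.inr hn))) ?_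
    rw [Set.union_right_comm, Set.compl_union, ← Set.sdiff_eq]
    exact hi.sdiff (names_finite _)
  | @res A P X z hz h ih =>
    by_cases hzD : z ∈ D
    · have hzX : z ∉ names X := fun hzX => hz (hD ⟨hzD, hzX⟩)
      obtain ⟨w, hw, hwX⟩ := (hi.sdiff (names_finite X)).nonempty
      have hwAD : w ∉ A ∧ w ∉ D := by simpa [not_or] using hw
      -- `w` is forbidden as well so that the exchange of `z` and `w` turns it into `z`, which
      -- belongs to `D` and has to remain forbidden.
      have h₁ := ih (D := insert w D) (fun n hn => Or.inr (hD ⟨hn.1.resolve_left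
        (fun e => hwX (e ▸ hn.2)), hn.2⟩)) ((fn_sub P z).trans (Set.insert_subset_insert hP)) (by
          refine (hi.sdiff (Set.finite_singleton w)).mono fun n hn => ?_
          simp only [Set.mem_sdiff, Set.mem_compl_iff, Set.mem_union, Set.mem_singleton_iff,
            Set.mem_insert_iff] at hn ⊢
          rintro ((rfl | h) | (rfl | h)) <;> tauto)
      have h₂ := h₁.map (Equiv.swap z w).injective
      have hsw : ∀ n ∈ A, Equiv.swap z w n = n := fun n hn =>
        Equiv.swap_apply_of_ne_of_ne (fun e => hz (e ▸ hn)) (fun e => hwAD.1 (e ▸ hn))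
      rw [← rename_sub_rename, Equiv.swap_apply_left,
        show (P.rename (liftBy 1 (Equiv.swap z w))) = P from
          (Proc.res.injEq _ _).mp (Proc.rename_eq_self (Proc.res P) fun n hn => hsw n (hP hn)),
        ren_eq_self (f := Equiv.swap z w) fun n hn =>
            Equiv.swap_apply_of_ne_of_ne (fun e => hzX (e ▸ hn))
          (fun e => hwX (e ▸ hn))] at h₂
      refine .res hw (h₂.anti ?_)
      rintro n (rfl | hn)
      · exact ⟨z, by simp, by simp⟩
      by_cases hnz : n = z
      · exact ⟨w, by simp, by simp [hnz]⟩
      · refine ⟨n, ?_, Equiv.swap_apply_of_ne_of_ne hnz fun e => hw (e ▸ hn)⟩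
        rcases hn with hn | hn <;> simp [hn]
    · refine .res (z := z) (by simp [hz, hzD]) ?_
      rw [← Set.insert_union]
      refine ih (fun n hn => Or.inr (hD hn)) ((fn_sub P z).trans (Set.insert_subset_insert hP)) ?_
      refine (hi.sdiff (Set.finite_singleton z)).mono fun n hn => ?_
      simp only [Set.mem_sdiff, Set.mem_compl_iff, Set.mem_union, Set.mem_singleton_iff,
            Set.mem_insert_iff] at hn ⊢
      tauto

/-- The rule for parallel composition opens the second factor away from the first. This
reformulation is symmetric in the two factors, and gives commutativity. -/
theorem par_iff {Z : Multiset (Proc α)} (hA : Aᶜ.Infinite) (hQ : Q.fn ⊆ A) :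
    Opens A (Proc.par P Q) Z ↔
      ∃ X Y, Z = X + Y ∧ Opens A P X ∧ Opens A Q Y ∧ names X ∩ names Y ⊆ A := by
  constructor
  · intro h
    obtain ⟨X, Y, rfl, hX, hY⟩ := par_inv h
    refine ⟨X, Y, rfl, hX, hY.anti Set.subset_union_left, fun n hn => ?_⟩
    rcases hY.names_subset hn.2 with h | h
    · exact hQ h
    · exact absurd (Or.inr hn.1) h
  · rintro ⟨X, Y, rfl, hX, hY, h⟩
    exact .par hX (hY.enlarge h hQ (infinite_compl_union hA (names_finite X)))

/-- Form of uniqueness in which the components `N` next to `P` stay fixed. -/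
theorem unique_add (h : Opens A P X) (h' : Opens B P Y) {N : Multiset (Proc α)} {C : Set ℕ}
    (hP : P.fn ⊆ C ∪ names N) (hA : C ∪ names N ⊆ A) (hB : C ∪ names N ⊆ B) :
    ∃ π : Equiv.Perm ℕ, (∀ n ∈ C, π n = n) ∧ N + Y = ren π (N + X) := by
  obtain ⟨π, hπ, rfl⟩ := h.unique h' hP hA hB
  refine ⟨π, fun n hn => hπ n (Or.inl hn), ?_⟩
  rw [ren_add, ren_eq_self fun n hn => hπ n (Or.inr hn)]

end Opens

/-! ### Structural equivalence with named restrictions; prenex normal form. -/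

section
variable {α : Synchronism} {P Q R : Proc α}

instance : Trans (StructEq (α := α)) StructEq StructEq := ⟨.trans⟩

theorem StructEq.par_congr_right (P : Proc α) (h : StructEq Q R) :
    StructEq (par P Q) (par P R) :=
  (par_comm ..).trans ((par_congr P h).trans (par_comm ..))

theorem StructEq.par_congr₂ {P' Q' : Proc α} (h : StructEq P P') (h' : StructEq Q Q') :
    StructEq (par P Q) (par P' Q') :=
  (par_congr Q h).trans (par_congr_right P' h')

theorem StructEq.of_eq (h : P = Q) : StructEq P Q := h ▸ .refl P

theorem StructEq.par_left_comm (P Q R : Proc α) :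
    StructEq (par P (par Q R)) (par Q (par P R)) :=
  (par_assoc P Q R).trans ((par_congr R (par_comm P Q)).trans (par_assoc Q P R).symm)

theorem StructEq.rename (h : StructEq P Q) {f : ℕ → ℕ} (hf : Function.Injective f) :
    StructEq (P.rename f) (Q.rename f) := by
  induction h generalizing f with
  | refl P => exact .refl _
  | symm _ h => exact (h hf).symm
  | trans _ _ h h' => exact (h hf).trans (h' hf)
  | par_congr Q _ h => exact .par_congr _ (h hf)
  | res_congr _ h => exact .res_congr (h (liftBy_injective 1 hf))
  | par_nil P => exact .par_nil _
  | par_comm P Q => exact .par_comm _ _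
  | par_assoc P Q R => exact .par_assoc _ _ _
  | ite_eq s P Q => exact .ite_eq _ _ _
  | ite_ne h P Q => exact .ite_ne (fun e => h (Term.rename_injective hf e)) _ _
  | res_nil => exact .res_nil
  | res_swap P =>
    refine (StructEq.res_swap (P.rename (liftBy 1 (liftBy 1 f)))).trans (.of_eq ?_)
    simp only [Proc.rename, rename_rename]
    congr 3
    funext n
    rcases n with _ | _ | n <;> simp [swap01, liftBy]
  | extrude P Q =>
    refine (StructEq.extrude (P.rename f) (Q.rename (liftBy 1 f))).trans (.of_eq ?_)
    simp only [Proc.rename, rename_rename]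
    congr 3
  | rep_unfold P => exact .rep_unfold _

theorem bindName_injective (a : ℕ) : Function.Injective (bindName a) := by
  intro m n h
  simp only [bindName] at h
  split at h <;> split at h <;> omega

theorem fn_nu (a : ℕ) (P : Proc α) : (nu a P).fn = P.fn \ {a} := by
  ext n
  simp only [nu, fn, fn_rename, Set.mem_ofPred_eq, Set.mem_image, bindName, Set.mem_sdiff,
    Set.mem_singleton_iff]
  constructor
  · rintro ⟨k, hk, e⟩
    split at e
    · omega
    · obtain rfl : k = n := by omega
      tauto
  · rintro ⟨h, h'⟩
    exact ⟨n, h, by simp [h']⟩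

theorem nu_rename {f : ℕ → ℕ} (hf : Function.Injective f) (a : ℕ) (P : Proc α) :
    (nu a P).rename f = nu (f a) (P.rename f) := by
  simp only [nu, Proc.rename, rename_rename]
  congr 2
  funext n
  by_cases h : n = a <;> simp [bindName, liftBy, hf.eq_iff, h]

/-- Instantiating a binder by a fresh name and restricting that name again is alpha-conversion. -/
theorem nu_rename_sub {z : ℕ} (h : z ∉ (res P).fn) : nu z (P.rename (sub z)) = res P := by
  rw [nu, rename_rename, rename_eq_self]
  rintro (_ | n) hn
  · simp [bindName]
  · have : n ≠ z := by rintro rfl; exact h hn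
    simp [bindName, this]

theorem rename_bindName_of_notMem {a : ℕ} (h : a ∉ P.fn) :
    P.rename (bindName a) = P.rename Nat.succ :=
  rename_congr P fun n hn => by
    rw [bindName, if_neg (by rintro rfl; exact h hn)]

theorem StructEq.nu_congr (a : ℕ) (h : StructEq P Q) : StructEq (nu a P) (nu a Q) :=
  .res_congr (h.rename (bindName_injective a))

theorem StructEq.nu_comm (a b : ℕ) (P : Proc α) :
    StructEq (nu a (nu b P)) (nu b (nu a P)) := by
  by_cases hab : a = b
  · subst hab; exact .refl _
  refine (StructEq.res_swap _).trans (.of_eq ?_)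
  simp only [nu, Proc.rename, rename_rename]
  congr 3
  funext n
  by_cases ha : n = a
  · subst ha; simp [bindName, liftBy, swap01, hab]
  · by_cases hb : n = b
    · subst hb; simp [bindName, liftBy, swap01, ha]
    · simp [bindName, liftBy, swap01, ha, hb]

theorem StructEq.nu_extrude {a : ℕ} (h : a ∉ P.fn) (Q : Proc α) :
    StructEq (par P (nu a Q)) (nu a (par P Q)) := by
  refine (StructEq.extrude P _).trans (.of_eq ?_)
  rw [nu, Proc.rename, rename_bindName_of_notMem h]

/-- A vacuous restriction is garbage: add a null process, extrude backwards so that the restriction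
covers only it, and remove both. -/
theorem StructEq.nu_unused {a : ℕ} (h : a ∉ P.fn) : StructEq (nu a P) P := by
  rw [nu, rename_bindName_of_notMem h]
  calc StructEq (res (P.rename Nat.succ)) (res (par (P.rename Nat.succ) nil)) :=
        .res_congr (StructEq.par_nil _).symm
    StructEq _ (par P (res nil)) := (StructEq.extrude P nil).symm
    StructEq _ (par P nil) := .par_congr_right P .res_nil
    StructEq _ P := .par_nil P

/-- Restriction of the names in a list. -/
def nuL (l : List ℕ) (P : Proc α) : Proc α := l.foldr nu P

@[simp] theorem nuL_nil (P : Proc α) : nuL [] P = P := rfl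
@[simp] theorem nuL_cons (a : ℕ) (l : List ℕ) (P : Proc α) :
    nuL (a :: l) P = nu a (nuL l P) := rfl
theorem nuL_append (l l' : List ℕ) (P : Proc α) : nuL (l ++ l') P = nuL l (nuL l' P) :=
  List.foldr_append

theorem fn_nuL (l : List ℕ) (P : Proc α) : (nuL l P).fn = P.fn \ {a | a ∈ l} := by
  induction l with
  | nil => simp
  | cons a l ih => ext n; simp [fn_nu, ih]; tauto

theorem nuL_rename {f : ℕ → ℕ} (hf : Function.Injective f) (l : List ℕ) (P : Proc α) :
    (nuL l P).rename f = nuL (l.map f) (P.rename f) := by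
  induction l with
  | nil => rfl
  | cons a l ih => simp [nu_rename hf, ih]

theorem StructEq.nuL_congr (l : List ℕ) (h : StructEq P Q) : StructEq (nuL l P) (nuL l Q) := by
  induction l with
  | nil => exact h
  | cons a l ih => exact ih.nu_congr a

theorem StructEq.nuL_perm {l l' : List ℕ} (h : l.Perm l') (P : Proc α) :
    StructEq (nuL l P) (nuL l' P) := by
  induction h with
  | nil => exact .refl _
  | cons a _ ih => exact ih.nu_congr a
  | swap a b l => exact .nu_comm b a _
  | trans _ _ h h' => exact h.trans h'

theorem StructEq.nuL_extrude {l : List ℕ} (h : ∀ a ∈ l, a ∉ P.fn) (Q : Proc α) :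
    StructEq (par P (nuL l Q)) (nuL l (par P Q)) := by
  induction l with
  | nil => exact .refl _
  | cons a l ih =>
    exact (StructEq.nu_extrude (h a (by simp)) _).trans
      ((ih fun b hb => h b (by simp [hb])).nu_congr a)

/-- The parallel composition of a list of processes. -/
def parL (l : List (Proc α)) : Proc α := l.foldr par nil

@[simp] theorem parL_nil : parL ([] : List (Proc α)) = nil := rfl
@[simp] theorem parL_cons (p : Proc α) (l : List (Proc α)) : parL (p :: l) = par p (parL l) := rfl

theorem StructEq.parL_perm {l l' : List (Proc α)} (h : l.Perm l') :
    StructEq (parL l) (parL l') := by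
  induction h with
  | nil => exact .refl _
  | cons a _ ih => exact .par_congr_right a ih
  | swap a b l => exact .par_left_comm ..
  | trans _ _ h h' => exact h.trans h'

theorem StructEq.parL_append (l l' : List (Proc α)) :
    StructEq (parL (l ++ l')) (par (parL l) (parL l')) := by
  induction l with
  | nil => exact ((StructEq.par_comm ..).trans (.par_nil _)).symm
  | cons p l ih => exact (StructEq.par_congr_right p ih).trans (.par_assoc ..)

theorem parL_rename (f : ℕ → ℕ) (l : List (Proc α)) :
    (parL l).rename f = parL (l.map (Proc.rename f)) := by
  induction l with
  | nil => rfl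
  | cons p l ih => simp [Proc.rename, ih]

theorem fn_parL (l : List (Proc α)) : (parL l).fn = names (l : Multiset (Proc α)) := by
  induction l with
  | nil => simp [fn]
  | cons p l ih => rw [← Multiset.cons_coe, names_cons, ← ih]; rfl

/-- The parallel composition of a multiset of processes. -/
noncomputable def parM (X : Multiset (Proc α)) : Proc α := parL X.toList

theorem fn_parM (X : Multiset (Proc α)) : (parM X).fn = names X := by
  rw [parM, fn_parL, Multiset.coe_toList]

theorem StructEq.parM_coe (l : List (Proc α)) :
    StructEq (parM (l : Multiset (Proc α))) (parL l) :=
  .parL_perm (Multiset.coe_eq_coe.1 (Multiset.coe_toList _))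

theorem StructEq.parM_add (X Y : Multiset (Proc α)) :
    StructEq (parM (X + Y)) (par (parM X) (parM Y)) := by
  refine StructEq.trans (.parL_perm (Multiset.coe_eq_coe.1 ?_)) (.parL_append X.toList Y.toList)
  rw [Multiset.coe_toList, ← Multiset.coe_add, Multiset.coe_toList, Multiset.coe_toList]

theorem StructEq.parM_cons (p : Proc α) (X : Multiset (Proc α)) :
    StructEq (parM (p ::ₘ X)) (par p (parM X)) := by
  refine StructEq.trans (.parL_perm (Multiset.coe_eq_coe.1 ?_)) (.refl (parL (p :: X.toList)))
  rw [Multiset.coe_toList, ← Multiset.cons_coe, Multiset.coe_toList]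

theorem StructEq.parM_singleton (p : Proc α) : StructEq (parM {p}) p := by
  simp only [parM, Multiset.toList_singleton, parL_cons, parL_nil]
  exact .par_nil p

theorem StructEq.parM_rename (f : ℕ → ℕ) (X : Multiset (Proc α)) :
    StructEq ((parM X).rename f) (parM (ren f X)) := by
  rw [parM, parL_rename]
  refine .symm (StructEq.trans (.of_eq ?_) (.parM_coe _))
  rw [← Multiset.map_coe, Multiset.coe_toList]; rfl

/-- The names of `X` outside `A`. -/
noncomputable def priv (A : Set ℕ) (X : Multiset (Proc α)) : List ℕ :=
  ((names_finite X).sdiff (t := A)).toFinset.toList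

theorem mem_priv {A : Set ℕ} {X : Multiset (Proc α)} {n : ℕ} :
    n ∈ priv A X ↔ n ∈ names X ∧ n ∉ A := by
  simp [priv]

theorem nodup_priv (A : Set ℕ) (X : Multiset (Proc α)) : (priv A X).Nodup :=
  Finset.nodup_toList _

theorem perm_priv {A : Set ℕ} {X : Multiset (Proc α)} {l : List ℕ} (hl : l.Nodup)
    (h : ∀ n, n ∈ l ↔ n ∈ names X ∧ n ∉ A) : l.Perm (priv A X) :=
  (List.perm_ext_iff_of_nodup hl (nodup_priv A X)).2 fun n => by rw [h, mem_priv]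

theorem perm_priv_add {A : Set ℕ} {X Y : Multiset (Proc α)} :
    (priv A X ++ priv (A ∪ names X) Y).Perm (priv A (X + Y)) := by
  refine perm_priv (List.nodup_append.2 ⟨nodup_priv _ _, nodup_priv _ _, ?_⟩) fun n => ?_
  · intro a ha b hb e
    rw [mem_priv] at ha hb
    exact hb.2 (Or.inr (e ▸ ha.1))
  · simp only [List.mem_append, mem_priv, names_add, Set.mem_union]
    tauto

/-- The normal form represents the process: restrictions are extruded to the front, where each fresh
name either occurs in a component or is discarded as unused. -/
theorem Opens.structEq {A : Set ℕ} {X : Multiset (Proc α)} (h : Opens A P X) (hP : P.fn ⊆ A) :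
    StructEq P (nuL (priv A X) (parM X)) := by
  induction h with
  | nil A =>
    have : priv A (0 : Multiset (Proc α)) = [] := by simp [List.eq_nil_iff_forall_not_mem, mem_priv]
    rw [this]; simp only [parM, Multiset.toList_zero]; exact .refl _
  | @guarded A p h =>
    have : priv A ({p} : Multiset (Proc α)) = [] := by
      simp only [List.eq_nil_iff_forall_not_mem, mem_priv, names_singleton]
      exact fun n hn => hn.2 (hP hn.1)
    rw [this]; exact (StructEq.parM_singleton p).symm
  | ite_eq s Q _ h =>
    exact (StructEq.ite_eq ..).trans (h fun n hn => hP (by simp [fn]; tauto))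
  | ite_ne hst P _ h =>
    exact (StructEq.ite_ne hst ..).trans (h fun n hn => hP (by simp [fn]; tauto))
  | @par A P Q X Y hX hY ihX ihY =>
    have hPA : P.fn ⊆ A := fun n hn => hP (Or.inl hn)
    have hQA : Q.fn ⊆ A := fun n hn => hP (Or.inr hn)
    calc StructEq (Proc.par P Q)
          (Proc.par (nuL (priv A X) (parM X)) (nuL (priv (A ∪ names X) Y) (parM Y))) :=
          .par_congr₂ (ihX hPA) (ihY fun n hn => Or.inl (hQA hn))
      StructEq _ (nuL (priv (A ∪ names X) Y) (Proc.par (nuL (priv A X) (parM X)) (parM Y))) := by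
          refine .nuL_extrude (fun a ha hn => ?_) _
          rw [fn_nuL, fn_parM] at hn
          exact (mem_priv.1 ha).2 (Or.inr hn.1)
      StructEq _ (nuL (priv (A ∪ names X) Y) (nuL (priv A X) (Proc.par (parM Y) (parM X)))) := by
          refine .nuL_congr _ ((StructEq.par_comm ..).trans (.nuL_extrude (fun a ha hn => ?_) _))
          rw [fn_parM] at hn
          rw [mem_priv] at ha
          rcases hY.names_subset hn with hn | hn
          · exact ha.2 (hQA hn)
          · exact hn (Or.inr ha.1)
      StructEq _ (nuL (priv A (X + Y)) (parM (X + Y))) := by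
          rw [← nuL_append]
          exact (StructEq.nuL_perm (List.perm_append_comm.trans perm_priv_add) _).trans
            (.nuL_congr _ ((StructEq.par_comm ..).trans (StructEq.parM_add X Y).symm))
  | @res A P X z hz h ih =>
    have ih := ih ((fn_sub P z).trans (Set.insert_subset_insert hP))
    have ih := ih.nu_congr z
    rw [nu_rename_sub fun hn => hz (hP hn)] at ih
    by_cases hzX : z ∈ names X
    · refine ih.trans (.nuL_perm (l := z :: _) (perm_priv ?_ fun n => ?_) _)
      · exact List.nodup_cons.2 ⟨by simp [mem_priv], nodup_priv _ _⟩
      · simp only [List.mem_cons, mem_priv, Set.mem_insert_iff]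
        by_cases hn : n = z
        · subst hn; tauto
        · tauto
    · refine ih.trans ((StructEq.nu_unused ?_).trans (.nuL_perm (perm_priv (nodup_priv _ _)
        fun n => ?_) _))
      · rw [fn_nuL, fn_parM]; exact fun h => hzX h.1
      · simp only [mem_priv, Set.mem_insert_iff]
        by_cases hn : n = z
        · subst hn; tauto
        · tauto

end

/-! ### Public and private names; from components back to processes. -/

/-- The public names, which stand for the free names of a process. -/
def Pub : Set ℕ := Set.range fun n => 2 * n

/-- The odd numbers remain as private names. Doubling the free names gives one set `Pub` that
contains them for every process and still leaves infinitely many fresh names. -/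
theorem infinite_compl_pub : Pubᶜ.Infinite := by
  refine Set.infinite_of_injective_forall_mem (f := fun n : ℕ => 2 * n + 1) ?_ ?_
  · intro a b h; simpa using h
  · rintro n ⟨m, hm⟩; simp only at hm; omega

/-- The public name of a free name. -/
def dbl (n : ℕ) : ℕ := 2 * n

theorem dbl_injective : Function.Injective dbl := fun a b h => by
  simp only [dbl] at h; omega

section
variable {α : Synchronism} {P Q R : Proc α} {X Y : Multiset (Proc α)}

/-- The process with top-level components `X`, in which the names that are not public are
restricted. -/
noncomputable def readback (X : Multiset (Proc α)) : Proc α :=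
  nuL (priv Pub X) (parM X)

theorem fn_rename_dbl (P : Proc α) : (P.rename dbl).fn ⊆ Pub := by
  rw [fn_rename]; rintro _ ⟨n, _, rfl⟩; exact ⟨n, rfl⟩

theorem fn_readback (X : Multiset (Proc α)) : (readback X).fn ⊆ Pub := by
  intro n hn
  rw [readback, fn_nuL, fn_parM] at hn
  by_contra h
  exact hn.2 (mem_priv.2 ⟨hn.1, h⟩)

/-- A process without private names is the public version of a process. -/
theorem exists_rename_dbl (hP : P.fn ⊆ Pub) : ∃ Q : Proc α, Q.rename dbl = P := by
  refine ⟨P.rename (fun n => n / 2), ?_⟩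
  rw [rename_rename]
  refine rename_eq_self P fun n hn => ?_
  obtain ⟨m, rfl⟩ := hP hn
  simp [dbl]

/-- On finitely many names, the passage to public names can be undone by an injective map. -/
theorem exists_undo {F : Set ℕ} (hF : F.Finite) :
    ∃ h : ℕ → ℕ, Function.Injective h ∧ ∀ n ∈ F, h (dbl n) = n := by
  obtain ⟨B, hB⟩ := hF.bddAbove
  -- Even numbers up to `2 * B` are halved, and land in `0, …, B`; everything else is pushed above
  -- `B`, so the map stays injective.
  refine ⟨fun m => if m % 2 = 0 ∧ m / 2 ≤ B then m / 2 else m + B + 1, ?_, fun n hn => ?_⟩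
  · intro a b h
    simp only at h
    split at h <;> split at h <;> omega
  · have : n ≤ B := hB hn
    simp [dbl, this]

/-- Equivalence is preserved by injective renamings of all names, so a one-sided inverse of `dbl` is
not enough; the map of `exists_undo` is injective and inverts `dbl` on the names that matter. -/
theorem StructEq.of_rename_dbl (h : StructEq (P.rename dbl) (Q.rename dbl)) : StructEq P Q := by
  obtain ⟨g, hg, hg'⟩ := exists_undo (P.fn_finite.union Q.fn_finite)
  have := h.rename hg
  rwa [rename_rename, rename_rename,
    rename_eq_self (f := g ∘ dbl) P fun n hn => hg' n (Or.inl hn),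
    rename_eq_self (f := g ∘ dbl) Q fun n hn => hg' n (Or.inr hn)] at this

/-- The multisets agree up to a change of private names. -/
def Iso (X Y : Multiset (Proc α)) : Prop :=
  ∃ π : Equiv.Perm ℕ, (∀ n ∈ Pub, π n = n) ∧ Y = ren π X

theorem Iso.symm (h : Iso X Y) : Iso Y X := by
  obtain ⟨π, hπ, rfl⟩ := h
  exact ⟨π.symm, fun n hn => by rw [Equiv.symm_apply_eq, hπ n hn], by simp⟩

theorem Iso.trans {Z : Multiset (Proc α)} (h : Iso X Y) (h' : Iso Y Z) : Iso X Z := by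
  obtain ⟨π, hπ, rfl⟩ := h
  obtain ⟨ρ, hρ, rfl⟩ := h'
  exact ⟨π.trans ρ, fun n hn => by simp [hπ n hn, hρ n hn], by simp [ren_ren]⟩

/-- A change of private names acts below their restrictions, and the process read back has only
public free names, which are fixed. -/
theorem Iso.readback (h : Iso X Y) : StructEq (readback X) (readback Y) := by
  obtain ⟨π, hπ, rfl⟩ := h
  rw [← rename_eq_self (f := π) (Joining.readback X) fun n hn => hπ n (fn_readback X hn),
    Joining.readback, nuL_rename π.injective]
  have hπ' : ∀ n, π n ∈ Pub ↔ n ∈ Pub := fun n =>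
    ⟨fun h => by rwa [← π.injective (hπ _ h)], fun h => by rwa [hπ n h]⟩
  refine (StructEq.nuL_congr _ (.parM_rename π X)).trans (.nuL_perm (perm_priv
    ((nodup_priv _ _).map π.injective) fun n => ?_) _)
  obtain ⟨n, rfl⟩ := π.surjective n
  simp [names_ren, mem_priv, hπ']

theorem StructEq.nuL_unused {l : List ℕ} (h : ∀ a ∈ l, a ∉ P.fn) : StructEq (nuL l P) P := by
  induction l with
  | nil => exact .refl _
  | cons a l ih =>
    refine (StructEq.nu_unused ?_).trans (ih fun b hb => h b (by simp [hb]))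
    change a ∉ (nuL l P).fn
    rw [fn_nuL]; exact fun hn => h a (by simp) hn.1

theorem StructEq.nuL_readback {l : List ℕ} (hl : l.Nodup) (h : ∀ n ∈ l, n ∉ Pub)
    (hX : ∀ n ∈ names X, n ∉ Pub → n ∈ l) : StructEq (nuL l (parM X)) (readback X) := by
  classical
  have hp := List.filter_append_perm (fun n => decide (n ∈ names X)) l
  refine (StructEq.nuL_perm hp.symm _).trans ?_
  rw [nuL_append]
  refine (StructEq.nuL_congr _ (.nuL_unused fun a ha hn => ?_)).trans
    (.nuL_perm (perm_priv (hl.filter _) fun n => ?_) _)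
  · rw [fn_parM] at hn
    simp [hn] at ha
  · simp only [List.mem_filter, decide_eq_true_eq]
    exact ⟨fun hn => ⟨hn.2, h n hn.1⟩, fun hn => ⟨hX n hn.1 hn.2, hn.1⟩⟩

/-- Normalizes a process `P` that has appeared next to components `N`, under restrictions of the
private names of `M`. It serves for unfolding, where `N = M`, and for interaction, where `N` is what
the redex leaves of `M`. -/
theorem Opens.readback_add {M N : Multiset (Proc α)} (h : Opens (Pub ∪ names M) P X)
    (hN : names N ⊆ names M) (hP : P.fn ⊆ Pub ∪ names M) :
    StructEq (nuL (priv Pub M) (Proc.par P (parM N))) (readback (N + X)) := by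
  have hl : (priv Pub M ++ priv (Pub ∪ names M) X).Nodup :=
    (perm_priv_add (A := Pub) (X := M) (Y := X)).nodup_iff.2 (nodup_priv _ _)
  calc StructEq (nuL (priv Pub M) (Proc.par P (parM N)))
        (nuL (priv Pub M) (Proc.par (parM N) (nuL (priv (Pub ∪ names M) X) (parM X)))) :=
        .nuL_congr _ ((StructEq.par_comm ..).trans (.par_congr_right _ (h.structEq hP)))
    StructEq _ (nuL (priv Pub M) (nuL (priv (Pub ∪ names M) X) (parM (N + X)))) := by
        refine .nuL_congr _ ((StructEq.nuL_extrude (fun a ha hn => ?_) _).trans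
          (.nuL_congr _ (StructEq.parM_add N X).symm))
        rw [fn_parM] at hn
        exact (mem_priv.1 ha).2 (Or.inr (hN hn))
    StructEq _ (readback (N + X)) := by
        rw [← nuL_append]
        refine .nuL_readback hl (fun n hn => ?_) fun n hn hn' => ?_
        · simp only [List.mem_append, mem_priv, Set.mem_union] at hn
          tauto
        · rw [names_add] at hn
          simp only [List.mem_append, mem_priv, Set.mem_union]
          by_cases n ∈ names M
          · tauto
          · rcases hn with hn | hn
            · exact absurd (hN hn) ‹_›
            · tauto

end

/-! ### Unfolding of replications, confluence, and structural equivalence as joinability. -/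

section
variable {α : Synchronism} {P Q R : Proc α} {M N X Y Z : Multiset (Proc α)}

theorem infinite_compl_pub_union (M : Multiset (Proc α)) : (Pub ∪ names M)ᶜ.Infinite :=
  infinite_compl_union infinite_compl_pub (names_finite M)

/-- The unfolding of a replication at top level. -/
def Unf (M N : Multiset (Proc α)) : Prop :=
  ∃ P X, rep P ∈ M ∧ Opens (Pub ∪ names M) P X ∧ N = M + X

theorem Unf.readback (h : Unf M N) : StructEq (readback M) (readback N) := by
  obtain ⟨P, X, hP, hX, rfl⟩ := h
  have hfn : P.fn ⊆ names M := fun n hn => fn_subset_names hP hn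
  refine StructEq.trans (.nuL_congr _ ?_) (hX.readback_add subset_rfl fun n hn => Or.inr (hfn hn))
  obtain ⟨M, rfl⟩ := Multiset.exists_cons_of_mem hP
  calc StructEq (parM (rep P ::ₘ M)) (par (rep P) (parM M)) := .parM_cons ..
    StructEq _ (par (par P (rep P)) (parM M)) := .par_congr _ (.rep_unfold P)
    StructEq _ (par P (par (rep P) (parM M))) := (StructEq.par_assoc ..).symm
    StructEq _ (par P (parM (rep P ::ₘ M))) := .par_congr_right _ (StructEq.parM_cons ..).symm

/-- A change of private names, or the unfolding of a replication at top level. -/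
def Step (M N : Multiset (Proc α)) : Prop := Iso M N ∨ Unf M N

theorem Step.readback (h : Step M N) : StructEq (readback M) (readback N) :=
  h.elim Iso.readback Unf.readback

theorem Opens.map_perm {A : Set ℕ} (h : Opens A P X) (π : Equiv.Perm ℕ) :
    Opens (π '' A) (P.rename π) (ren π X) := h.map π.injective

theorem image_pub_union {π : Equiv.Perm ℕ} (hπ : ∀ n ∈ Pub, π n = n) (M : Multiset (Proc α)) :
    π '' (Pub ∪ names M) = Pub ∪ names (ren π M) := by
  rw [Set.image_union, names_ren]
  congr 1
  exact (Set.image_congr hπ).trans (Set.image_id' _)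

theorem Unf.map {π : Equiv.Perm ℕ} (hπ : ∀ n ∈ Pub, π n = n) (h : Unf M N) :
    Unf (ren π M) (ren π N) := by
  obtain ⟨P, X, hP, hX, rfl⟩ := h
  refine ⟨P.rename π, ren π X, Multiset.mem_map.2 ⟨_, hP, rfl⟩, ?_, by simp⟩
  rw [← image_pub_union hπ]
  exact hX.map_perm π

/-- Two processes are opened in either order, with the same result up to private names. -/
theorem Opens.swap_iso {A : Set ℕ} {X₁ X₂ Y₁ Y₂ : Multiset (Proc α)} (hA : Aᶜ.Infinite)
    (hP : P.fn ⊆ A) (hQ : Q.fn ⊆ A) (hN : Pub ∪ names N ⊆ A)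
    (h₁ : Opens A P X₁) (h₂ : Opens (A ∪ names X₁) Q X₂) (h₃ : Opens A Q Y₁)
    (h₄ : Opens (A ∪ names Y₁) P Y₂) : Iso (N + X₁ + X₂) (N + Y₁ + Y₂) := by
  have h : Opens A (Proc.par P Q) (X₁ + X₂) := .par h₁ h₂
  have h' : Opens A (Proc.par P Q) (Y₁ + Y₂) := by
    obtain ⟨_, _, e, h₅, h₆, h₇⟩ := (par_iff hA hP).1 (Opens.par h₃ h₄)
    rw [e, add_comm]
    exact (par_iff hA hQ).2 ⟨_, _, rfl, h₆, h₅, by rwa [Set.inter_comm]⟩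
  have hPQ : (Proc.par P Q).fn ⊆ A := Set.union_subset hP hQ
  rw [add_assoc, add_assoc]
  obtain ⟨π, hπ, e⟩ := h.unique h' hPQ subset_rfl subset_rfl
  refine ⟨π, fun n hn => hπ n (hN (Or.inl hn)), ?_⟩
  rw [ren_add, ← e, ren_eq_self fun n hn => hπ n (hN (Or.inr hn))]

/-- Unfolding removes nothing, so each of two unfoldings is still possible after the other; the
results differ only in the fresh names chosen. -/
theorem Unf.diamond {M₁ M₂ : Multiset (Proc α)} (h₁ : Unf M M₁) (h₂ : Unf M M₂) :
    ∃ N₁ N₂, Unf M₁ N₁ ∧ Unf M₂ N₂ ∧ Iso N₁ N₂ := by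
  obtain ⟨P, X, hP, hX, rfl⟩ := h₁
  obtain ⟨Q, Y, hQ, hY, rfl⟩ := h₂
  have hPM : P.fn ⊆ Pub ∪ names M := fun n hn => Or.inr (fn_subset_names hP hn)
  have hQM : Q.fn ⊆ Pub ∪ names M := fun n hn => Or.inr (fn_subset_names hQ hn)
  obtain ⟨X', hX'⟩ := Opens.exists_of_infinite P (infinite_compl_pub_union (M + Y))
  obtain ⟨Y', hY'⟩ := Opens.exists_of_infinite Q (infinite_compl_pub_union (M + X))
  refine ⟨M + X + Y', M + Y + X', ⟨Q, Y', by simp [hQ], hY', rfl⟩,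
    ⟨P, X', by simp [hP], hX', rfl⟩, ?_⟩
  rw [names_add, ← Set.union_assoc] at hX' hY'
  exact Opens.swap_iso (infinite_compl_pub_union M) hPM hQM subset_rfl hX hY' hY hX'

/-- Strong confluence: one side closes the diagram in at most one step. This makes joinability
transitive, hence an equivalence relation. -/
theorem Step.confluent {M₁ M₂ : Multiset (Proc α)} (h₁ : Step M M₁) (h₂ : Step M M₂) :
    ∃ N, Relation.ReflGen Step M₁ N ∧ Relation.ReflTransGen Step M₂ N := by
  rcases h₁ with h₁ | h₁
  · rcases h₂ with h₂ | h₂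
    · exact ⟨M₂, .single (.inl (h₁.symm.trans h₂)), .refl⟩
    · obtain ⟨π, hπ, rfl⟩ := h₁
      exact ⟨ren π M₂, .single (.inr (h₂.map hπ)), .single (.inl ⟨π, hπ, rfl⟩)⟩
  · rcases h₂ with h₂ | h₂
    · obtain ⟨π, hπ, rfl⟩ := h₂
      exact ⟨ren π M₁, .single (.inl ⟨π, hπ, rfl⟩), .single (.inr (h₁.map hπ))⟩
    · obtain ⟨N₁, N₂, h, h', i⟩ := h₁.diamond h₂
      exact ⟨N₁, .single (.inr h), (Relation.ReflTransGen.single (.inr h')).tail (.inl i.symm)⟩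

/-- Equality up to changes of private names and unfoldings of replications. -/
def Eqv (M N : Multiset (Proc α)) : Prop := Relation.Join (Relation.ReflTransGen Step) M N

theorem eqv_equivalence : Equivalence (Eqv (α := α)) :=
  Relation.equivalence_join_reflTransGen fun _ _ _ => Step.confluent

theorem Eqv.refl (M : Multiset (Proc α)) : Eqv M M := eqv_equivalence.refl M
theorem Eqv.symm (h : Eqv M N) : Eqv N M := eqv_equivalence.symm h
theorem Eqv.trans (h : Eqv M N) (h' : Eqv N X) : Eqv M X := eqv_equivalence.trans h h'

theorem Eqv.of_steps (h : Relation.ReflTransGen Step M N) : Eqv M N := ⟨N, h, .refl⟩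
theorem Step.eqv (h : Step M N) : Eqv M N := .of_steps (.single h)
theorem Iso.eqv (h : Iso M N) : Eqv M N := Step.eqv (.inl h)

/-- Proof by induction for consequences of `Eqv` that are equivalence relations. -/
theorem Eqv.lift {r : Multiset (Proc α) → Multiset (Proc α) → Prop} (hr : Equivalence r)
    (h : ∀ M N, Step M N → r M N) (hMN : Eqv M N) : r M N := by
  have hs : ∀ M N, Relation.ReflTransGen Step M N → r M N := fun M N h' => by
    induction h' with
    | refl => exact hr.refl _
    | tail _ h' ih => exact hr.trans ih (h _ _ h')
  obtain ⟨L, h₁, h₂⟩ := hMN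
  exact hr.trans (hs _ _ h₁) (hr.symm (hs _ _ h₂))

theorem Eqv.readback (h : Eqv M N) : StructEq (readback M) (readback N) :=
  h.lift (r := fun M N => StructEq (Joining.readback M) (Joining.readback N))
    ⟨fun _ => .refl _, .symm, .trans⟩ fun _ _ => Step.readback

theorem Opens.iso_add {A B : Set ℕ} (h : Opens A P X) (h' : Opens B P Y)
    (hP : P.fn ⊆ Pub ∪ names N) (hA : Pub ∪ names N ⊆ A) (hB : Pub ∪ names N ⊆ B) :
    Iso (N + X) (N + Y) := by
  obtain ⟨π, hπ, e⟩ := h.unique_add h' hP hA hB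
  exact ⟨π, hπ, e⟩

theorem Step.frame (h : Step M N) (hP : P.fn ⊆ Pub) (hX : Opens (Pub ∪ names M) P X)
    (hY : Opens (Pub ∪ names N) P Y) : Eqv (M + X) (N + Y) := by
  have hP' : ∀ S : Set ℕ, P.fn ⊆ Pub ∪ S := fun S n hn => Or.inl (hP hn)
  rcases h with ⟨π, hπ, rfl⟩ | ⟨Q, U, hQ, hU, rfl⟩
  · have h := hX.map_perm π
    rw [image_pub_union hπ, rename_eq_self P fun n hn => hπ n (hP hn)] at h
    have i : Iso (M + X) (ren π M + ren π X) := ⟨π, hπ, by simp⟩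
    exact (i.trans (h.iso_add hY (hP' _) subset_rfl subset_rfl)).eqv
  -- `Y` avoids the unfolded components `U` as well. Once `X` is exchanged for `Y`, the same
  -- unfolding can be done next to it.
  · have h : Iso (M + X) (M + Y) :=
      hX.iso_add hY (hP' _) subset_rfl (by rw [names_add]; grind)
    refine h.eqv.trans (Step.eqv (.inr ⟨Q, U, by simp [hQ], ?_, add_right_comm ..⟩))
    rw [names_add, ← Set.union_assoc]
    refine hU.enlarge (fun n hn => ?_) (fun n hn => Or.inr (fn_subset_names hQ hn)) ?_
    · rcases hY.names_subset hn.1 with h | h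
      · exact Or.inl (hP h)
      · exact absurd (Or.inr (by rw [names_add]; exact Or.inr hn.2)) h
    · exact infinite_compl_union (infinite_compl_pub_union M) (names_finite Y)

theorem Eqv.frame (h : Eqv M N) (hP : P.fn ⊆ Pub) (hX : Opens (Pub ∪ names M) P X)
    (hY : Opens (Pub ∪ names N) P Y) : Eqv (M + X) (N + Y) := by
  have hP' : ∀ S : Set ℕ, P.fn ⊆ Pub ∪ S := fun S n hn => Or.inl (hP hn)
  refine h.lift (r := fun M N => ∀ X Y, Opens (Pub ∪ names M) P X → Opens (Pub ∪ names N) P Y →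
    Eqv (M + X) (N + Y)) ⟨?_, ?_, ?_⟩ (fun M N h X Y hX hY => h.frame hP hX hY) X Y hX hY
  · intro M X Y hX hY
    exact (hX.iso_add hY (hP' _) subset_rfl subset_rfl).eqv
  · exact fun h X Y hX hY => (h Y X hY hX).symm
  · intro M N L h h' X Z hX hZ
    obtain ⟨Y, hY⟩ := Opens.exists_of_infinite P (infinite_compl_pub_union N)
    exact (h X Y hX hY).trans (h' Y Z hY hZ)

/-- The bijection that makes the public name of `0` private. -/
def hide : Equiv.Perm ℕ where
  toFun n := if n = 0 then 1 else if n % 2 = 0 then n - 2 else n + 2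
  invFun n := if n = 1 then 0 else if n % 2 = 0 then n + 2 else n - 2
  left_inv n := by grind
  right_inv n := by grind

theorem image_hide_pub : hide '' Pub = insert 1 Pub := by
  ext n
  simp only [Set.mem_image, Pub, Set.mem_range, exists_exists_eq_and, Set.mem_insert_iff]
  constructor
  · rintro ⟨m, rfl⟩
    rcases m with _ | m
    · left; rfl
    · right; exact ⟨m, by simp [hide]; omega⟩
  · rintro (rfl | ⟨m, rfl⟩)
    · exact ⟨0, rfl⟩
    · exact ⟨m + 1, by simp [hide]; omega⟩

/-- Passing below a restriction shifts all free names. Opening `res P` with witness `1` therefore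
amounts to applying the single permutation `hide` to an opening of `P`, and congruence for
restriction reduces to invariance under `hide`. -/
theorem hide_comp_dbl : hide ∘ dbl = sub 1 ∘ liftBy 1 dbl := by
  funext n
  rcases n with _ | n
  · simp [hide, dbl, liftBy]
  · simp [hide, dbl, liftBy]; omega

theorem image_hide_superset (M : Multiset (Proc α)) :
    Pub ∪ names (ren hide M) ⊆ hide '' (Pub ∪ names M) := by
  rw [Set.image_union, image_hide_pub, names_ren]
  exact Set.union_subset_union_left _ (Set.subset_insert _ _)

theorem Step.hide (h : Step M N) : Step (ren hide M) (ren hide N) := by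
  rcases h with ⟨π, hπ, rfl⟩ | ⟨Q, U, hQ, hU, rfl⟩
  -- The conjugate of `π` by `hide` fixes `hide '' Pub`, which contains `Pub`.
  · refine .inl ⟨Joining.hide.symm.trans (π.trans Joining.hide), fun n hn => ?_, ?_⟩
    · have : n ∈ Joining.hide '' Pub := by rw [image_hide_pub]; exact Or.inr hn
      obtain ⟨m, hm, rfl⟩ := this
      simp [hπ m hm]
    · simp only [ren_ren, ← Equiv.coe_trans]
      congr 2
      ext n; simp
  · refine .inr ⟨Q.rename Joining.hide, ren Joining.hide U, Multiset.mem_map.2 ⟨_, hQ, rfl⟩, ?_,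
      by simp⟩
    exact (hU.map_perm Joining.hide).anti (image_hide_superset M)

theorem Eqv.hide (h : Eqv M N) : Eqv (ren hide M) (ren hide N) :=
  h.lift (r := fun M N => Eqv (ren Joining.hide M) (ren Joining.hide N))
    ⟨fun _ => .refl _, .symm, .trans⟩ fun _ _ h => h.hide.eqv

/-- `X` consists of the top-level components of `P`, with its free names made public. -/
def Top (P : Proc α) (X : Multiset (Proc α)) : Prop := Opens Pub (P.rename dbl) X

theorem Top.exists (P : Proc α) : ∃ X, Top P X :=
  Opens.exists_of_infinite _ infinite_compl_pub

theorem Top.unique (h : Top P X) (h' : Top P Y) : Iso X Y := by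
  obtain ⟨π, hπ, e⟩ := Opens.unique h h' (fn_rename_dbl P) subset_rfl subset_rfl
  exact ⟨π, hπ, e⟩

theorem Top.readback (h : Top P X) : StructEq (P.rename dbl) (readback X) :=
  Opens.structEq h (fn_rename_dbl P)

theorem Top.res (h : Top P X) : Top (res P) (ren hide X) := by
  have h := Opens.map_perm h hide
  rw [image_hide_pub, rename_rename, hide_comp_dbl, ← rename_rename] at h
  exact Opens.res (fun ⟨n, hn⟩ => by simp only at hn; omega) h

/-- Structurally equivalent processes have equivalent top-level components. -/
theorem StructEq.eqv (h : StructEq P Q) : ∀ X Y, Top P X → Top Q Y → Eqv X Y := by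
  -- Components are unique up to private names, so one convenient choice on each side suffices. For
  -- most axioms, `same`, both sides even have a common opening.
  have of : ∀ {P Q : Proc α}, (∃ X Y, Top P X ∧ Top Q Y ∧ Eqv X Y) →
      ∀ X Y, Top P X → Top Q Y → Eqv X Y := by
    rintro P Q ⟨X, Y, hX, hY, h⟩ X' Y' hX' hY'
    exact (hX'.unique hX).eqv.trans (h.trans (hY.unique hY').eqv)
  have same : ∀ {P Q : Proc α}, (∃ X, Top P X ∧ Top Q X) →
      ∀ X Y, Top P X → Top Q Y → Eqv X Y := fun ⟨X, h, h'⟩ => of ⟨X, X, h, h', .refl X⟩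
  have ex := fun {M} (P : Proc α) =>
    Opens.exists_of_infinite P (infinite_compl_pub_union (α := α) M)
  induction h with
  | refl P => obtain ⟨X, hX⟩ := Top.exists P; exact same ⟨X, hX, hX⟩
  | symm _ h => exact fun X Y hX hY => (h Y X hY hX).symm
  | @trans P Q R _ _ h h' =>
    intro X Z hX hZ
    obtain ⟨Y, hY⟩ := Top.exists Q
    exact (h X Y hX hY).trans (h' Y Z hY hZ)
  | @par_congr P P' Q _ h =>
    obtain ⟨X, hX⟩ := Top.exists P
    obtain ⟨X', hX'⟩ := Top.exists P'
    obtain ⟨Y, hY⟩ := ex (M := X) (Q.rename dbl)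
    obtain ⟨Y', hY'⟩ := ex (M := X') (Q.rename dbl)
    exact of ⟨_, _, .par hX hY, .par hX' hY', (h X X' hX hX').frame (fn_rename_dbl Q) hY hY'⟩
  | @res_congr P P' _ h =>
    obtain ⟨X, hX⟩ := Top.exists P
    obtain ⟨X', hX'⟩ := Top.exists P'
    exact of ⟨_, _, hX.res, hX'.res, (h X X' hX hX').hide⟩
  | par_nil P =>
    obtain ⟨X, hX⟩ := Top.exists P
    exact same ⟨X + 0, .par hX (.nil _), by rwa [add_zero]⟩
  | par_comm P Q =>
    obtain ⟨Z, hZ⟩ := Top.exists (par P Q)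
    refine same ⟨Z, hZ, ?_⟩
    obtain ⟨X, Y, e, hX, hY, h⟩ := (Opens.par_iff infinite_compl_pub (fn_rename_dbl Q)).1 hZ
    refine (Opens.par_iff infinite_compl_pub (fn_rename_dbl P)).2 ⟨Y, X, ?_, hY, hX, ?_⟩
    · rw [e, add_comm]
    · rwa [Set.inter_comm]
  | par_assoc P Q R =>
    obtain ⟨Z, hZ⟩ := Top.exists (par P (par Q R))
    refine same ⟨Z, hZ, ?_⟩
    obtain ⟨X, W, rfl, hX, hW⟩ := Opens.par_inv hZ
    obtain ⟨Y, Z, rfl, hY, hZ⟩ := Opens.par_inv hW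
    rw [← add_assoc]
    rw [Set.union_assoc, ← names_add] at hZ
    exact .par (.par hX hY) hZ
  | ite_eq s P Q =>
    obtain ⟨X, hX⟩ := Top.exists P
    exact same ⟨X, .ite_eq _ _ hX, hX⟩
  | ite_ne h P Q =>
    obtain ⟨X, hX⟩ := Top.exists Q
    exact same ⟨X, .ite_ne (fun e => h (Term.rename_injective dbl_injective e)) _ hX, hX⟩
  | res_nil => exact same ⟨0, Top.res (P := nil) (X := 0) (.nil _), .nil _⟩
  | res_swap P =>
    obtain ⟨X, hX⟩ := Top.exists (res (res P))
    refine same ⟨X, hX, ?_⟩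
    obtain ⟨z, hz, hX⟩ := Opens.res_iff.1 hX
    obtain ⟨w, hw, hX⟩ := Opens.res_iff.1 hX
    rw [Set.mem_insert_iff, not_or] at hw
    -- Exchanging the binders corresponds to using the two witnesses in the opposite order.
    refine Opens.res hw.2 (.res (z := z) (by simp [hz, Ne.symm hw.1]) ?_)
    rw [Set.insert_comm]
    simp only [rename_rename] at hX ⊢
    convert hX using 2
    funext n
    rcases n with _ | _ | n <;> simp [swap01, liftBy]
  | extrude P Q =>
    obtain ⟨X, hX⟩ := Top.exists (res (par (P.rename Nat.succ) Q))
    refine same ⟨X, ?_, hX⟩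
    obtain ⟨z, hz, hX⟩ := Opens.res_iff.1 hX
    obtain ⟨X, Y, rfl, hX, hY⟩ := Opens.par_inv hX
    simp only [rename_rename] at hX
    have e : sub z ∘ liftBy 1 dbl ∘ Nat.succ = dbl := by
      funext n; simp [liftBy]
    rw [e] at hX
    refine .par (hX.anti (Set.subset_insert _ _)) (.res (z := z) ?_ (by rwa [← Set.insert_union]))
    rintro (h | h)
    · exact hz h
    · rcases hX.names_subset h with h | h
      · exact hz (fn_rename_dbl P h)
      · exact h (Set.mem_insert _ _)
  | rep_unfold P =>
    have h : Top (rep P) {rep (P.rename dbl)} := .guarded _ (.rep _)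
    obtain ⟨X, hX⟩ := Top.exists P
    have hn : names {rep (P.rename dbl)} ⊆ Pub := by
      rw [names_singleton]; exact fn_rename_dbl P
    refine of ⟨_, _, h, Opens.par hX (.guarded _ (.rep _)), Step.eqv (.inr ⟨_, X,
      Multiset.mem_singleton_self _, ?_, add_comm _ _⟩)⟩
    rwa [Set.union_eq_self_of_subset_right hn]

/-- Structural equivalence, generated by symmetric closure, is thereby characterized by directed
confluent rewriting of components. -/
theorem structEq_iff_eqv (hX : Top P X) (hY : Top Q Y) : StructEq P Q ↔ Eqv X Y :=
  ⟨fun h => h.eqv X Y hX hY, fun h =>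
    .of_rename_dbl (hX.readback.trans (h.readback.trans hY.readback.symm))⟩

end

/-! ### Reduction as interaction of top-level components. -/

section
variable {α : Synchronism}

theorem parAll_rename (f : ℕ → ℕ) (m : ℕ) (P : Fin (m + 1) → Proc α) :
    (parAll m P).rename f = parAll m (fun i => (P i).rename f) := by
  induction m with
  | zero => rfl
  | succ m ih => simp [parAll, Proc.rename, ih]

theorem StructEq.parAll_parL (m : ℕ) (P : Fin (m + 1) → Proc α) :
    StructEq (parAll m P) (parL (List.ofFn P)) := by
  induction m with
  | zero => simpa [parAll] using (StructEq.par_nil (P 0)).symm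
  | succ m ih =>
    rw [List.ofFn_succ]
    exact .par_congr_right _ (ih _)

theorem fn_parAll (m : ℕ) (P : Fin (m + 1) → Proc α) : (parAll m P).fn = ⋃ i, (P i).fn := by
  induction m with
  | zero =>
    ext n
    simp only [parAll, Set.mem_iUnion]
    exact ⟨fun h => ⟨0, h⟩, fun ⟨i, h⟩ => by rwa [Fin.fin_one_eq_zero i] at h⟩
  | succ m ih =>
    simp only [parAll, fn, ih]
    ext n
    simp [Fin.exists_fin_succ]

theorem Opens.parAll {A : Set ℕ} (m : ℕ) {P : Fin (m + 1) → Proc α} (h : ∀ i, Guarded (P i)) :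
    Opens A (parAll m P) (List.ofFn P) := by
  induction m generalizing A with
  | zero => simpa [Proc.parAll] using Opens.guarded A (h 0)
  | succ m ih =>
    rw [List.ofFn_succ, ← Multiset.cons_coe, ← Multiset.singleton_add]
    exact .par (.guarded A (h 0)) (ih fun i => h i.succ)

theorem inst_rename {m : ℕ} (b : Fin (m + 1) → ℕ) (f : ℕ → ℕ) (Q : Proc α) :
    (Q.rename (liftBy (m + 1) f)).rename (inst fun i => f (b i)) =
      (Q.rename (inst b)).rename f := by
  simp only [rename_rename, inst_eq_instBelow, instBelow_comp_liftBy]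

theorem fn_instBelow {k : ℕ} (x : Fin k → ℕ) (P : Proc α) :
    (P.rename (instBelow x)).fn ⊆ Set.range x ∪ {n | n + k ∈ P.fn} := by
  rw [Proc.fn_rename]
  rintro _ ⟨n, hn, rfl⟩
  by_cases h : n < k
  · exact Or.inl ⟨⟨n, h⟩, by simp [instBelow, h]⟩
  · refine Or.inr ?_
    simp only [instBelow, h, dite_false, Set.mem_ofPred_eq]
    rwa [Nat.sub_add_cancel (by omega)]

theorem names_ofFn {n : ℕ} (P : Fin n → Proc α) :
    names (List.ofFn P : Multiset (Proc α)) = ⋃ i, (P i).fn := by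
  ext k
  simp [names, List.mem_ofFn]

theorem ren_ofFn {n : ℕ} (f : ℕ → ℕ) (P : Fin n → Proc α) :
    ren f (List.ofFn P : Multiset (Proc α)) = (List.ofFn fun i => (P i).rename f) := by
  simp [ren, List.map_ofFn, Function.comp_def]

/-- `Redex K R`: the components `K` can interact, with result `R`. -/
inductive Redex : {α : Synchronism} → Multiset (Proc α) → Proc α → Prop
  | sync (m : ℕ) (c b : Fin (m + 1) → ℕ) (P : Fin (m + 1) → Proc .sync) (Q : Proc .sync) :
      Redex (join m c Q ::ₘ (List.ofFn fun i => sout (c i) (b i) (P i)))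
        (par (parAll m P) (Q.rename (inst b)))
  | async (m : ℕ) (c b : Fin (m + 1) → ℕ) (Q : Proc .async) :
      Redex (join m c Q ::ₘ (List.ofFn fun i => aout (c i) (b i))) (Q.rename (inst b))

end

section
variable {α : Synchronism} {P Q R : Proc α} {K M N X Y Z : Multiset (Proc α)}

theorem Redex.map (h : Redex K R) (f : ℕ → ℕ) : Redex (ren f K) (R.rename f) := by
  cases h with
  | sync m c b P Q =>
    simp only [ren_cons, ren_ofFn, Proc.rename, parAll_rename, ← inst_rename]
    exact .sync ..
  | async m c b Q =>
    simp only [ren_cons, ren_ofFn, Proc.rename, ← inst_rename]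
    exact .async ..

theorem Redex.fn_subset (h : Redex K R) : R.fn ⊆ names K := by
  cases h with
  | sync m c b P Q =>
    rw [names_cons, names_ofFn]
    rintro n (hn | hn)
    · rw [fn_parAll, Set.mem_iUnion] at hn
      obtain ⟨i, hi⟩ := hn
      exact Or.inr (Set.mem_iUnion.2 ⟨i, Or.inr hi⟩)
    · rcases fn_instBelow _ _ hn with ⟨i, rfl⟩ | hn
      · exact Or.inr (Set.mem_iUnion.2 ⟨i, by simp [fn]⟩)
      · exact Or.inl (Or.inr hn)
  | async m c b Q =>
    rw [names_cons, names_ofFn]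
    intro n hn
    rcases fn_instBelow _ _ hn with ⟨i, rfl⟩ | hn
    · exact Or.inr (Set.mem_iUnion.2 ⟨i, by simp [fn]⟩)
    · exact Or.inl (Or.inr hn)

/-- An interaction consumes only outputs and a join. Hence an unfolded replication always lies
outside the redex. -/
theorem Redex.rep_notMem (h : Redex K R) (P : Proc α) : rep P ∉ K := by
  cases h <;> simp [List.mem_ofFn]

theorem Redex.red (h : Redex K R) : Red (parM K) R := by
  have key : ∀ (m : ℕ) (p : Proc α) (P : Fin (m + 1) → Proc α),
      StructEq (parM (p ::ₘ (List.ofFn P : Multiset (Proc α)))) (par (parAll m P) p) := fun m p P =>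
    (StructEq.parM_cons _ _).trans ((StructEq.par_comm _ _).trans
      (.par_congr p ((StructEq.parM_coe _).trans (StructEq.parAll_parL m P).symm)))
  cases h with
  | sync m c b P Q => exact .struct (key ..) (.comm_sync m c b P Q) (.refl _)
  | async m c b Q => exact .struct (key ..) (.comm_async m c b Q) (.refl _)

theorem Red.rename (h : Red P Q) {f : ℕ → ℕ} (hf : Function.Injective f) :
    Red (P.rename f) (Q.rename f) := by
  induction h generalizing f with
  | comm_sync m c b P Q =>
    simp only [Proc.rename, parAll_rename, ← inst_rename]
    exact .comm_sync ..
  | comm_async m c b Q =>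
    simp only [Proc.rename, parAll_rename, ← inst_rename]
    exact .comm_async ..
  | par Q _ h => exact .par _ (h hf)
  | res _ h => exact .res (h (liftBy_injective 1 hf))
  | struct h _ h' ih => exact .struct (h.rename hf) (ih hf) (h'.rename hf)

theorem Red.nuL (h : Red P Q) (l : List ℕ) : Red (nuL l P) (nuL l Q) := by
  induction l with
  | nil => exact h
  | cons a l ih => exact .res (ih.rename (bindName_injective a))

/-- Reduction on top-level components. -/
def Comm (M N : Multiset (Proc α)) : Prop :=
  ∃ K L R X, Redex K R ∧ M = K + L ∧ Opens (Pub ∪ names M) R X ∧ N = L + X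

theorem Redex.fn_subset_pub_union (h : Redex K R) (L : Multiset (Proc α)) :
    R.fn ⊆ Pub ∪ names (K + L) := fun n hn => by
  rw [names_add]; exact Or.inr (Or.inl (h.fn_subset hn))

theorem Comm.readback (h : Comm M N) : Red (readback M) (readback N) := by
  obtain ⟨K, L, R, X, h, rfl, hX, rfl⟩ := h
  exact .struct (.nuL_congr _ (.parM_add K L)) ((h.red.par (parM L)).nuL _)
    (hX.readback_add (by simp) (h.fn_subset_pub_union L))

theorem Comm.map {π : Equiv.Perm ℕ} (hπ : ∀ n ∈ Pub, π n = n) (h : Comm M N) :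
    Comm (ren π M) (ren π N) := by
  obtain ⟨K, L, R, X, h, rfl, hX, rfl⟩ := h
  refine ⟨_, ren π L, _, ren π X, h.map π, by simp, ?_, by simp⟩
  rw [← image_pub_union hπ]
  exact hX.map_perm π

theorem Comm.hide (h : Comm M N) : Comm (ren hide M) (ren hide N) := by
  obtain ⟨K, L, R, X, h, rfl, hX, rfl⟩ := h
  exact ⟨_, ren Joining.hide L, _, ren Joining.hide X, h.map Joining.hide, by simp,
    (hX.map_perm Joining.hide).anti (image_hide_superset _), by simp⟩

/-- A replication is unfolded next to an interaction. -/
theorem Redex.unf {L M' : Multiset (Proc α)} (h : Redex K R)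
    (hX : Opens (Pub ∪ names (K + L)) R X) (h' : Unf (K + L) M') :
    ∃ U X', M' = K + (L + U) ∧ names U ⊆ names L ∪ (names (K + L))ᶜ ∧
      Opens (Pub ∪ names M') R X' ∧ Relation.ReflTransGen Step (L + X) (L + U + X') := by
  obtain ⟨P, U, hP, hU, rfl⟩ := h'
  have hPL : rep P ∈ L := (Multiset.mem_add.1 hP).resolve_left (h.rep_notMem P)
  have hPn : P.fn ⊆ names L := fun n hn => fn_subset_names hPL hn
  have hUn := hU.names_subset
  have hi := infinite_compl_pub_union (K + L)
  -- The residue is opened away from the unfolded `U`, and the replicated process away from the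
  -- residue `X`; the two orders agree by `Opens.swap_iso`.
  obtain ⟨X', hX'⟩ := Opens.exists_of_infinite R (infinite_compl_union hi (names_finite U))
  obtain ⟨U', hU'⟩ := Opens.exists_of_infinite P (infinite_compl_union hi (names_finite X))
  refine ⟨U, X', add_assoc .., by grind, ?_, ?_⟩
  · rwa [names_add, ← Set.union_assoc]
  · refine (Relation.ReflTransGen.single (.inr ⟨P, U', by simp [hPL], ?_, rfl⟩)).tail
      (.inl (Opens.swap_iso hi (h.fn_subset_pub_union L)
        (P := R) (Q := P)
        (fun n hn => Or.inr (fn_subset_names hP hn)) ?_ hX hU' hU hX'))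
    · simp only [names_add]; grind
    · refine hU'.anti ?_
      simp only [names_add]; grind

/-- Interaction is stable under rewriting of its source: private names can be permuted throughout,
and unfolding does not touch the redex. -/
theorem Comm.step {M' : Multiset (Proc α)} (h : Comm M N) (h' : Step M M') :
    ∃ N', Comm M' N' ∧ Relation.ReflTransGen Step N N' := by
  rcases h' with ⟨π, hπ, rfl⟩ | h'
  · exact ⟨ren π N, h.map hπ, .single (.inl ⟨π, hπ, rfl⟩)⟩
  obtain ⟨K, L, R, X, h, rfl, hX, rfl⟩ := h
  obtain ⟨U, X', rfl, -, hX', hs⟩ := h.unf hX h'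
  exact ⟨_, ⟨K, L + U, R, X', h, rfl, hX', rfl⟩, hs⟩

theorem Comm.steps {M' : Multiset (Proc α)} (h : Comm M N)
    (h' : Relation.ReflTransGen Step M M') :
    ∃ N', Comm M' N' ∧ Relation.ReflTransGen Step N N' := by
  induction h' with
  | refl => exact ⟨N, h, .refl⟩
  | tail _ h' ih =>
    obtain ⟨N', h, hN⟩ := ih
    obtain ⟨N'', h, hN'⟩ := h.step h'
    exact ⟨N'', h, hN.trans hN'⟩

/-- Reduction on top-level components, up to equivalence. -/
def CommEqv (M N : Multiset (Proc α)) : Prop :=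
  ∃ M' N', Eqv M M' ∧ Comm M' N' ∧ Eqv N' N

theorem Comm.frame (h : Comm M N) (hP : P.fn ⊆ Pub) (hX : Opens (Pub ∪ names M) P X)
    (hY : Opens (Pub ∪ names N) P Y) : CommEqv (M + X) (N + Y) := by
  have hP' : ∀ S : Set ℕ, P.fn ⊆ Pub ∪ S := fun S n hn => Or.inl (hP hn)
  obtain ⟨K, L, R, U, h, rfl, hU, rfl⟩ := h
  -- `Z` opens the idle process away from the names both before and after the interaction, so it can
  -- stand next to both states.
  obtain ⟨Z, hZ⟩ := Opens.exists_of_infinite P (infinite_compl_union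
    (infinite_compl_pub_union (K + L)) (names_finite (L + U)))
  have h₁ : Iso (K + L + X) (K + L + Z) :=
    hX.iso_add hZ (hP' _) subset_rfl Set.subset_union_left
  have h₂ : Iso (L + U + Z) (L + U + Y) :=
    hZ.iso_add hY (hP' _) (by grind) subset_rfl
  refine ⟨K + L + Z, L + Z + U, h₁.eqv, ⟨K, L + Z, R, U, h, add_assoc .., ?_, rfl⟩, ?_⟩
  · rw [names_add, ← Set.union_assoc]
    refine hU.enlarge (fun n hn => ?_) (h.fn_subset_pub_union L)
      (infinite_compl_union (infinite_compl_pub_union _) (names_finite Z))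
    rcases hZ.names_subset hn.1 with h | h
    · exact Or.inl (hP h)
    · exact absurd (Or.inr (by rw [names_add]; exact Or.inr hn.2)) h
  · rw [add_right_comm]; exact h₂.eqv

theorem CommEqv.frame (h : CommEqv M N) (hP : P.fn ⊆ Pub) (hX : Opens (Pub ∪ names M) P X)
    (hY : Opens (Pub ∪ names N) P Y) : CommEqv (M + X) (N + Y) := by
  obtain ⟨M', N', h₁, h₂, h₃⟩ := h
  obtain ⟨X', hX'⟩ := Opens.exists_of_infinite P (infinite_compl_pub_union M')
  obtain ⟨Y', hY'⟩ := Opens.exists_of_infinite P (infinite_compl_pub_union N')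
  obtain ⟨M'', N'', h₄, h₅, h₆⟩ := h₂.frame hP hX' hY'
  exact ⟨M'', N'', (h₁.frame hP hX hX').trans h₄, h₅, h₆.trans (h₃.frame hP hY' hY)⟩

theorem Opens.parAll_par {A : Set ℕ} (m : ℕ) {P : Fin (m + 1) → Proc α} {p : Proc α}
    (h : ∀ i, Guarded (P i)) (hp : Guarded p) :
    Opens A (Proc.par (Proc.parAll m P) p) (p ::ₘ (List.ofFn P : Multiset (Proc α))) := by
  rw [← Multiset.singleton_add, add_comm]
  exact .par (.parAll m h) (.guarded _ hp)

theorem Redex.comm (h : Redex K R) (hK : names K ⊆ Pub) (hX : Opens Pub R X) : Comm K X := by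
  refine ⟨K, 0, R, X, h, (add_zero K).symm, ?_, (zero_add X).symm⟩
  rwa [Set.union_eq_self_of_subset_right hK]

theorem Redex.commEqv (h : Redex K R) (hX : Top R X) : CommEqv (ren dbl K) X := by
  refine ⟨_, _, .refl _, (h.map dbl).comm ?_ hX, .refl _⟩
  rw [names_ren]
  rintro _ ⟨n, _, rfl⟩
  exact ⟨n, rfl⟩

/-- Inversion of reduction. In a derivation, uses of structural equivalence are absorbed by `Eqv`,
parallel contexts by `CommEqv.frame` and restrictions by `hide`; what remains is a single
interaction of components. -/
theorem Red.commEqv (h : Red P Q) : ∀ X Y, Top P X → Top Q Y → CommEqv X Y := by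
  have of : ∀ {α : Synchronism} {P Q : Proc α}, (∃ X Y, Top P X ∧ Top Q Y ∧ CommEqv X Y) →
      ∀ X Y, Top P X → Top Q Y → CommEqv X Y := by
    rintro α P Q ⟨X, Y, hX, hY, M, N, h, h', h''⟩ X' Y' hX' hY'
    exact ⟨M, N, (hX'.unique hX).eqv.trans h, h', h''.trans (hY.unique hY').eqv⟩
  induction h with
  | comm_sync m c b P Q =>
    obtain ⟨X, hX⟩ := Top.exists (Proc.par (parAll m P) (Q.rename (inst b)))
    refine of ⟨_, X, ?_, hX, (Redex.sync m c b P Q).commEqv hX⟩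
    simp only [Top, Proc.rename, parAll_rename, ren_cons, ren_ofFn]
    exact .parAll_par m (fun i => .sout ..) (.join ..)
  | comm_async m c b Q =>
    obtain ⟨X, hX⟩ := Top.exists (Q.rename (inst b))
    refine of ⟨_, X, ?_, hX, (Redex.async m c b Q).commEqv hX⟩
    simp only [Top, Proc.rename, parAll_rename, ren_cons, ren_ofFn]
    exact .parAll_par m (fun i => .aout ..) (.join ..)
  | @par α P P' Q _ h =>
    obtain ⟨X, hX⟩ := Top.exists P
    obtain ⟨X', hX'⟩ := Top.exists P'
    obtain ⟨Y, hY⟩ := Opens.exists_of_infinite (Q.rename dbl) (infinite_compl_pub_union X)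
    obtain ⟨Y', hY'⟩ := Opens.exists_of_infinite (Q.rename dbl) (infinite_compl_pub_union X')
    exact of ⟨_, _, .par hX hY, .par hX' hY', (h X X' hX hX').frame (fn_rename_dbl Q) hY hY'⟩
  | @res α P P' _ h =>
    obtain ⟨X, hX⟩ := Top.exists P
    obtain ⟨X', hX'⟩ := Top.exists P'
    obtain ⟨M, N, h₁, h₂, h₃⟩ := h X X' hX hX'
    exact of ⟨_, _, hX.res, hX'.res, _, _, h₁.hide, h₂.hide, h₃.hide⟩
  | @struct α P P' Q Q' hPQ _ hQP ih =>
    intro X Y hX hY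
    obtain ⟨X', hX'⟩ := Top.exists Q
    obtain ⟨Y', hY'⟩ := Top.exists Q'
    obtain ⟨M, N, h₁, h₂, h₃⟩ := ih X' Y' hX' hY'
    exact ⟨M, N, (hPQ.eqv X X' hX hX').trans h₁, h₂, h₃.trans (hQP.eqv Y' Y hY' hY)⟩

theorem Red.of_rename_dbl (h : Red (P.rename dbl) (Q.rename dbl)) : Red P Q := by
  obtain ⟨g, hg, hg'⟩ := exists_undo (P.fn_finite.union Q.fn_finite)
  have := h.rename hg
  rwa [rename_rename, rename_rename,
    rename_eq_self (f := g ∘ dbl) P fun n hn => hg' n (Or.inl hn),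
    rename_eq_self (f := g ∘ dbl) Q fun n hn => hg' n (Or.inr hn)] at this

end

/-! ### The handshake translation: nested restrictions, free names, injectivity. -/

section
variable {α : Synchronism}

theorem liftBy_add (k : ℕ) (f : ℕ → ℕ) (n : ℕ) : liftBy k f (n + k) = f n + k := by
  simp [liftBy]

theorem liftBy_coe {k : ℕ} (f : ℕ → ℕ) (j : Fin k) : liftBy k f j = j := by
  simp [liftBy]

theorem instBelow_add {k : ℕ} (x : Fin k → ℕ) (n : ℕ) : instBelow x (n + k) = n := by
  simp [instBelow]

theorem instBelow_coe {k : ℕ} (x : Fin k → ℕ) (j : Fin k) : instBelow x j = x j := by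
  simp [instBelow]

theorem liftBy_zero (f : ℕ → ℕ) : liftBy 0 f = f := by
  funext n; simp [liftBy]

theorem resN_rename (k : ℕ) (f : ℕ → ℕ) (P : Proc α) :
    (resN k P).rename f = resN k (P.rename (liftBy k f)) := by
  induction k generalizing f with
  | zero => simp [resN, liftBy_zero]
  | succ k ih =>
    have : liftBy k (liftBy 1 f) = liftBy (k + 1) f := by
      funext n; simp only [liftBy]; grind
    simp only [resN, Proc.rename, ih, this]

theorem fn_resN (k : ℕ) (P : Proc α) : (resN k P).fn = {n | n + k ∈ P.fn} := by
  induction k with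
  | zero => rfl
  | succ k ih =>
    ext n
    simp only [resN, fn, ih, Set.mem_ofPred_eq]
    rw [show n + 1 + k = n + (k + 1) by omega]

theorem resN_add (k l : ℕ) (P : Proc α) : resN (k + l) P = resN k (resN l P) := by
  induction k with
  | zero => simp [resN]
  | succ k ih => rw [Nat.add_right_comm]; simp [resN, ih]

/-- Successive instantiations of nested binders combine into one simultaneous instantiation by
distinct fresh names. -/
theorem Opens.resN_inv {A : Set ℕ} {k : ℕ} {P : Proc α} {X : Multiset (Proc α)}
    (hP : Guarded P) (h : Opens A (resN k P) X) :
    ∃ x : Fin k → ℕ, Function.Injective x ∧ (∀ i, x i ∉ A) ∧ X = {P.rename (instBelow x)} := by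
  induction k generalizing A P with
  | zero =>
    refine ⟨Fin.elim0, fun i => i.elim0, fun i => i.elim0, ?_⟩
    rw [(guarded_iff hP).1 h, rename_eq_self P fun n _ => by simp [instBelow]]
  | succ k ih =>
    obtain ⟨z, hz, h⟩ := res_iff.1 h
    rw [resN_rename] at h
    obtain ⟨x, hx, hx', rfl⟩ := ih (hP.rename _) h
    -- The outermost restriction is opened first but has the largest index, so its witness comes
    -- last.
    refine ⟨Fin.snoc x z, ?_, ?_, ?_⟩
    · refine Fin.snoc_injective_iff.2 ⟨hx, ?_⟩
      rintro ⟨i, rfl⟩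
      exact hx' i (Set.mem_insert _ _)
    · refine Fin.lastCases (by simpa using hz) fun i => ?_
      simpa using fun h => hx' i (Set.mem_insert_of_mem _ h)
    · rw [rename_rename]
      congr 2
      funext n
      simp only [Function.comp, liftBy, instBelow]
      rcases lt_trichotomy n k with h | rfl | h
      · simp [h, Nat.lt_succ_of_lt h, Fin.snoc]
      · simp [Fin.snoc]
      · obtain ⟨j, rfl⟩ := Nat.exists_eq_add_of_lt h
        have e : k + j + 1 - k = j + 1 := by omega
        have e' : ¬ k + j + 1 < k := by omega
        have e'' : ¬ k + j + 1 < k + 1 := by omega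
        simp only [e, e', e'', if_false, dite_false, sub_succ]
        rw [dif_neg (by omega)]
        omega

end

/-- The body of the translation of a join, with instantiated names. -/
def joinBody {m : ℕ} (x : Fin (m + 1) → ℕ) (Q : Proc .sync) : Proc .async :=
  par (parAll m fun j => aout j (x j + (m + 1)))
    (join m (fun j => x j + (m + 1)) ((handshake Q).rename (liftBy (m + 1) (· + (m + 1)))))

/-- The input that releases the continuation of an output, with instantiated names. -/
def answer (z a : ℕ) (P : Proc .sync) : Proc .async :=
  join 0 (fun _ => z) (par (aout 0 (a + 1)) ((handshake P).rename Nat.succ))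

/-- All names that the translation adds are bound, so it commutes with every renaming, injective or
not. -/
theorem handshake_rename : ∀ (P : Proc .sync) (f : ℕ → ℕ),
    handshake (P.rename f) = (handshake P).rename f
  | .nil, f => by simp only [Proc.rename, handshake]
  | .ok, f => by simp only [Proc.rename, handshake]
  | .sout n a P, f => by
    simp only [Proc.rename, handshake, handshake_rename P, rename_rename]
    congr 5
  | .join m c Q, f => by
    simp only [Proc.rename, handshake, handshake_rename Q, rename_rename, resN_rename,
      parAll_rename]
    congr 1
    simp only [Proc.join.injEq, Proc.par.injEq, heq_eq_eq, true_and]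
    refine ⟨?_, ?_, ?_, ?_⟩
    · funext j; simp only [liftBy]; grind
    · congr 1; funext j; simp only [liftBy]; grind
    · funext j; simp only [liftBy]; grind
    · congr 1
      funext k
      simp only [Function.comp, liftBy]
      grind
  | .res P, f => by simp only [Proc.rename, handshake, handshake_rename P]
  | .par P Q, f => by simp only [Proc.rename, handshake, handshake_rename P, handshake_rename Q]
  | .ite s t P Q, f => by
    simp only [Proc.rename, handshake, handshake_rename P, handshake_rename Q]
  | .rep P, f => by simp only [Proc.rename, handshake, handshake_rename P]

theorem fn_handshake : ∀ P : Proc .sync, (handshake P).fn = P.fn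
  | .nil => by simp only [handshake, fn]
  | .ok => by simp only [handshake, fn]
  | .sout n a P => by
    ext k
    simp only [handshake, fn, fn_rename, fn_handshake P, Set.mem_ofPred_eq, Set.mem_union,
      Set.mem_insert_iff, Set.mem_singleton_iff, Set.mem_image, Set.mem_range]
    constructor
    · rintro ((h | h) | ⟨_, h⟩ | (h | h) | ⟨j, hj, h⟩)
      · grind
      · grind
      · grind
      · grind
      · grind
      · obtain rfl : j = k := by omega
        exact Or.inr hj
    · rintro ((rfl | rfl) | h)
      · simp
      · simp
      · exact Or.inr (Or.inr (Or.inr ⟨k, h, rfl⟩))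
  | .join m c Q => by
    ext k
    simp only [handshake, fn_resN, fn, fn_rename, fn_handshake Q, fn_parAll, Set.mem_ofPred_eq,
      Set.mem_union, Set.mem_insert_iff, Set.mem_singleton_iff, Set.mem_image, Set.mem_range,
      Set.mem_iUnion]
    constructor
    · rintro (⟨y, h⟩ | (⟨i, h | h⟩ | ⟨i, h⟩ | ⟨j, hj, h⟩))
      · exact Or.inl ⟨y, by omega⟩
      · omega
      · omega
      · omega
      · simp only [liftBy] at h
        split at h
        · omega
        · obtain rfl : j = k + (m + 1) := by omega
          exact Or.inr hj
    · rintro (⟨y, rfl⟩ | h)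
      · exact Or.inl ⟨y, rfl⟩
      · refine Or.inr (Or.inr (Or.inr ⟨_, h, ?_⟩))
        simp only [liftBy]
        rw [if_neg (by omega)]
        omega
  | .res P => by simp only [handshake, fn, fn_handshake P]
  | .par P Q => by simp only [handshake, fn, fn_handshake P, fn_handshake Q]
  | .ite s t P Q => by simp only [handshake, fn, fn_handshake P, fn_handshake Q]
  | .rep P => by simp only [handshake, fn, fn_handshake P]

theorem handshake_ne_aout (P : Proc .sync) (a b : ℕ) : handshake P ≠ aout a b := by
  cases P <;> simp [handshake, resN]

theorem resN_join_inj {α : Synchronism} {k l m n : ℕ} {c : Fin (m + 1) → ℕ}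
    {d : Fin (n + 1) → ℕ} {P Q : Proc α} (h : resN k (join m c P) = resN l (join n d Q)) :
    k = l ∧ join m c P = join n d Q := by
  induction k generalizing l with
  | zero =>
    cases l with
    | zero => exact ⟨rfl, h⟩
    | succ l => cases h
  | succ k ih =>
    cases l with
    | zero => cases h
    | succ l =>
      obtain ⟨rfl, h'⟩ := ih ((Proc.res.injEq _ _).mp h)
      exact ⟨rfl, h'⟩

/-- A translated join of `m + 1` inputs has at least `m + 1` restrictions in front of it. Counting
restrictions thus separates translated joins from the joins the translation creates inside them, and
from translated joins with a restriction stripped. -/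
theorem lt_of_handshake_eq_resN_join : ∀ (P : Proc .sync) {k m : ℕ} {c : Fin (m + 1) → ℕ}
    {B : Proc .async}, handshake P = resN k (join m c B) → m < k
  | .sout n a P, k, m, c, B, h => by
    rw [handshake] at h
    rcases k with _ | _ | k <;> simp [resN] at h
  | .join m' c' Q, k, m, c, B, h => by
    rw [handshake] at h
    obtain ⟨rfl, h'⟩ := resN_join_inj h
    obtain ⟨rfl, _⟩ := (Proc.join.injEq _ _ _ _ _ _).mp h'
    exact Nat.lt_succ_self _
  | .res P, k, m, c, B, h => by
    rw [handshake] at h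
    cases k with
    | zero => cases h
    | succ k =>
      exact Nat.lt_succ_of_lt (lt_of_handshake_eq_resN_join P ((Proc.res.injEq _ _).mp h))
  | .nil, k, m, c, B, h => by rw [handshake] at h; cases k <;> cases h
  | .ok, k, m, c, B, h => by rw [handshake] at h; cases k <;> cases h
  | .par P Q, k, m, c, B, h => by rw [handshake] at h; cases k <;> cases h
  | .ite s t P Q, k, m, c, B, h => by rw [handshake] at h; cases k <;> cases h
  | .rep P, k, m, c, B, h => by rw [handshake] at h; cases k <;> cases h

theorem handshake_ne_join (P : Proc .sync) (m : ℕ) (c : Fin (m + 1) → ℕ) (B : Proc .async) :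
    handshake P ≠ join m c B := fun h =>
  Nat.not_lt_zero _ (lt_of_handshake_eq_resN_join (k := 0) P h)

/-- Below its restriction, a translated output has a bare asynchronous output as left factor, and no
source process is translated to one. -/
theorem handshake_sout_ne_res (n a : ℕ) (P Q : Proc .sync) :
    handshake (sout n a P) ≠ handshake (res Q) := by
  intro h
  simp only [handshake, res.injEq] at h
  cases Q with
  | par Q R =>
    simp only [handshake, par.injEq] at h
    exact handshake_ne_aout _ _ _ h.1.symm
  | _ => simp [handshake, resN] at h

theorem handshake_join_ne_res (m : ℕ) (c : Fin (m + 1) → ℕ) (P Q : Proc .sync) :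
    handshake (join m c P) ≠ handshake (res Q) := by
  intro h
  simp only [handshake, resN, res.injEq] at h
  exact Nat.lt_irrefl _ (lt_of_handshake_eq_resN_join Q h.symm)

theorem handshake_sout_ne_join (n a m : ℕ) (c : Fin (m + 1) → ℕ) (P Q : Proc .sync) :
    handshake (sout n a P) ≠ handshake (join m c Q) := by
  intro h
  simp only [handshake, resN, res.injEq] at h
  cases m <;> simp [resN] at h

/-- The only source forms whose translations can start alike are outputs, joins and restrictions,
which the preceding lemmas separate. Injectivity is what recovers the bodies of source components
from target components. -/
theorem handshake_injective : Function.Injective handshake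
  | .nil, Q, h => by cases Q <;> simp [handshake, resN] at h ⊢
  | .ok, Q, h => by cases Q <;> simp [handshake, resN] at h ⊢
  | .sout n a P, Q, h => by
    cases Q with
    | sout n' a' P' =>
      simp only [handshake, res.injEq, par.injEq, aout.injEq, join.injEq, heq_eq_eq, true_and,
        and_true, Nat.add_right_cancel_iff] at h
      obtain ⟨rfl, rfl, h⟩ := h
      rw [handshake_injective (rename_injective (add_left_injective 2) h)]
    | res Q => exact (handshake_sout_ne_res _ _ _ _ h).elim
    | join m c Q => exact (handshake_sout_ne_join _ _ _ _ _ _ h).elim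
    | _ => simp [handshake] at h
  | .join m c P, Q, h => by
    cases Q with
    | sout n' a' P' => exact (handshake_sout_ne_join _ _ _ _ _ _ h.symm).elim
    | res Q => exact (handshake_join_ne_res _ _ _ _ h).elim
    | join m' c' Q =>
      simp only [handshake] at h
      have h := (resN_join_inj h).2
      obtain ⟨rfl, h₁, h₂⟩ := (Proc.join.injEq _ _ _ _ _ _).mp h
      have h₁ : c = c' := by
        funext j
        exact Nat.add_right_cancel (congrFun (eq_of_heq h₁) j)
      simp only [par.injEq, join.injEq, heq_eq_eq, true_and] at h₂
      rw [h₁, handshake_injective (rename_injective (liftBy_injective _ (add_left_injective _)) h₂)]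
    | _ => simp [handshake, resN] at h
  | .res P, Q, h => by
    cases Q with
    | sout n' a' P' => exact (handshake_sout_ne_res _ _ _ _ h.symm).elim
    | join m' c' Q => exact (handshake_join_ne_res _ _ _ _ h.symm).elim
    | res Q =>
      simp only [handshake, res.injEq] at h
      rw [handshake_injective h]
    | _ => simp [handshake] at h
  | .par P P', Q, h => by
    cases Q with
    | par Q Q' =>
      simp only [handshake, par.injEq] at h
      rw [handshake_injective h.1, handshake_injective h.2]
    | _ => simp [handshake, resN] at h
  | .ite s t P P', Q, h => by
    cases Q with
    | ite s' t' Q Q' =>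
      simp only [handshake, ite.injEq] at h
      obtain ⟨rfl, rfl, h, h'⟩ := h
      rw [handshake_injective h, handshake_injective h']
    | _ => simp [handshake, resN] at h
  | .rep P, Q, h => by
    cases Q with
    | rep Q =>
      simp only [handshake, rep.injEq] at h
      rw [handshake_injective h]
    | _ => simp [handshake, resN] at h

/-- The axioms mention no output or join, so a homomorphic translation that commutes with renaming
sends each axiom to an instance of itself. -/
theorem StructEq.handshake {P Q : Proc .sync} (h : StructEq P Q) :
    StructEq (handshake P) (handshake Q) := by
  induction h <;> try simp only [Joining.handshake, handshake_rename]
  case refl P => exact .refl _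
  case symm h => exact h.symm
  case trans h h' => exact h.trans h'
  case par_congr h => exact .par_congr _ h
  case res_congr h => exact .res_congr h
  case par_nil => exact .par_nil _
  case par_comm => exact .par_comm _ _
  case par_assoc => exact .par_assoc _ _ _
  case ite_eq => exact .ite_eq _ _ _
  case ite_ne h _ _ => exact .ite_ne h _ _
  case res_nil => exact .res_nil
  case res_swap => exact .res_swap _
  case extrude => exact .extrude _ _
  case rep_unfold => exact .rep_unfold _

/-- A translated output falls into two components, the announcement and the input releasing the
continuation, which share the private name `z`. -/
theorem Opens.handshake_sout {A : Set ℕ} {n a : ℕ} {P : Proc .sync} {Y : Multiset (Proc .async)}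
    (h : Opens A (handshake (sout n a P)) Y) :
    ∃ z, z ∉ A ∧ Y = aout n z ::ₘ {answer z a P} := by
  rw [handshake] at h
  obtain ⟨z, hz, h⟩ := res_iff.1 h
  obtain ⟨X, Y, rfl, hX, hY⟩ := par_inv h
  refine ⟨z, hz, ?_⟩
  rw [← Multiset.singleton_add]
  congr 1
  · exact (guarded_iff (.aout _ _)).1 hX
  · refine ((guarded_iff (.join _ _ _)).1 hY).trans ?_
    simp only [Proc.rename, rename_rename, answer]
    congr 3

theorem Opens.handshake_join {A : Set ℕ} {m : ℕ} {c : Fin (m + 1) → ℕ} {Q : Proc .sync}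
    {Y : Multiset (Proc .async)} (h : Opens A (handshake (join m c Q)) Y) :
    ∃ x : Fin (m + 1) → ℕ, Function.Injective x ∧ (∀ i, x i ∉ A) ∧
      Y = {join m c (joinBody x Q)} := by
  rw [handshake] at h
  obtain ⟨x, hx, hx', rfl⟩ := Opens.resN_inv (.join _ _ _) h
  refine ⟨x, hx, hx', ?_⟩
  simp only [Proc.rename, rename_rename, joinBody, parAll_rename]
  congr 1
  simp only [Proc.join.injEq, Proc.par.injEq, heq_eq_eq, true_and]
  refine ⟨?_, ?_, ?_, ?_⟩
  · funext j; exact instBelow_add x _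
  · congr 1; funext j
    rw [add_comm (m + 1), liftBy_coe, liftBy_add, instBelow_coe]
  · funext j
    rw [add_comm (m + 1), liftBy_add, instBelow_coe]
  · congr 1
    funext k
    simp only [Function.comp, liftBy, instBelow]
    grind

theorem Opens.handshake_ok {A : Set ℕ} {Y : Multiset (Proc .async)}
    (h : Opens A (handshake ok) Y) : Y = {ok} := by
  rw [handshake] at h; exact (guarded_iff .ok).1 h

theorem Opens.handshake_rep {A : Set ℕ} {P : Proc .sync} {Y : Multiset (Proc .async)}
    (h : Opens A (handshake (rep P)) Y) : Y = {rep (handshake P)} := by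
  rw [handshake] at h; exact (guarded_iff (.rep _)).1 h

/-! ### Opening does not depend on the order of parallel components. -/

namespace Opens
variable {α : Synchronism} {A : Set ℕ} {P Q R : Proc α} {X : Multiset (Proc α)}

theorem nil_par_iff : Opens A (Proc.par Proc.nil Q) X ↔ Opens A Q X := by
  constructor
  · intro h
    obtain ⟨Y, Z, rfl, h, h'⟩ := par_inv h
    obtain rfl := nil_iff.1 h
    simpa using h'
  · intro h
    rw [← zero_add X]
    exact .par (.nil A) (by simpa using h)

theorem par_assoc_iff :
    Opens A (Proc.par P (Proc.par Q R)) X ↔ Opens A (Proc.par (Proc.par P Q) R) X := by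
  constructor
  · intro h
    obtain ⟨X, W, rfl, hX, hW⟩ := par_inv h
    obtain ⟨Y, Z, rfl, hY, hZ⟩ := par_inv hW
    rw [← add_assoc]
    rw [Set.union_assoc, ← names_add] at hZ
    exact .par (.par hX hY) hZ
  · intro h
    obtain ⟨W, Z, rfl, hW, hZ⟩ := par_inv h
    obtain ⟨X, Y, rfl, hX, hY⟩ := par_inv hW
    rw [add_assoc]
    rw [names_add, ← Set.union_assoc] at hZ
    exact .par hX (.par hY hZ)

theorem par_congr {Q' : Proc α} (h : Opens A (Proc.par P Q) X)
    (hQ : ∀ B Y, A ⊆ B → Bᶜ.Infinite → Opens B Q Y → Opens B Q' Y) (hA : Aᶜ.Infinite) :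
    Opens A (Proc.par P Q') X := by
  obtain ⟨X, Y, rfl, hX, hY⟩ := par_inv h
  exact .par hX (hQ _ _ Set.subset_union_left (infinite_compl_union hA (names_finite X)) hY)

theorem par_comm (hA : Aᶜ.Infinite) (hP : P.fn ⊆ A) (hQ : Q.fn ⊆ A)
    (h : Opens A (Proc.par P Q) X) : Opens A (Proc.par Q P) X := by
  obtain ⟨X, Y, rfl, hX, hY, h⟩ := (par_iff hA hQ).1 h
  exact (par_iff hA hP).2 ⟨Y, X, add_comm .., hY, hX, by rwa [Set.inter_comm]⟩

theorem par_left (h : Opens A (Proc.par P Q) X) {P' : Proc α}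
    (hP : ∀ Y, Opens A P Y → Opens A P' Y) : Opens A (Proc.par P' Q) X := by
  obtain ⟨X, Y, rfl, hX, hY⟩ := par_inv h
  exact .par (hP _ hX) hY

/-- `parM` lists a multiset in an arbitrary order. The same multiset is obtained exactly, and not
just up to private names, which makes `Enc` additive in `S`. -/
theorem parL_perm {l l' : List (Proc α)} (h : l.Perm l') (hA : Aᶜ.Infinite)
    (hl : names (l : Multiset (Proc α)) ⊆ A) (hX : Opens A (parL l) X) :
    Opens A (parL l') X := by
  induction h generalizing A X with
  | nil => exact hX
  | cons p _ ih =>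
    rw [← Multiset.cons_coe, names_cons, Set.union_subset_iff] at hl
    exact hX.par_congr (fun B Y hB hi hY => ih hi (hl.2.trans hB) hY) hA
  | swap p q l =>
    rw [← Multiset.cons_coe, ← Multiset.cons_coe, names_cons, names_cons, Set.union_subset_iff,
      Set.union_subset_iff] at hl
    exact par_assoc_iff.2 ((par_assoc_iff.1 hX).par_left fun Y hY => hY.par_comm hA hl.1 hl.2.1)
  | trans h₁ _ ih ih' =>
    refine ih' hA ?_ (ih hA hl hX)
    rwa [← Multiset.coe_eq_coe.2 h₁]

theorem parL_append_iff {l l' : List (Proc α)} :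
    Opens A (parL (l ++ l')) X ↔ Opens A (Proc.par (parL l) (parL l')) X := by
  induction l generalizing A X with
  | nil => exact nil_par_iff.symm
  | cons p l ih =>
    rw [parL_cons, ← par_assoc_iff, List.cons_append, parL_cons]
    constructor <;> intro h <;> obtain ⟨X, Y, rfl, hX, hY⟩ := par_inv h
    · exact .par hX (ih.1 hY)
    · exact .par hX (ih.2 hY)

end Opens

theorem handshake_parL (l : List (Proc .sync)) :
    handshake (parL l) = parL (l.map handshake) := by
  induction l with
  | nil => simp [handshake]
  | cons p l ih => simp [handshake, ih]

/-! ### Translation of multisets of components, and its inversion. -/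

/-- `Enc A S T`: the components `T` are obtained from the translations of the components `S` by
opening them, with names outside `A`. -/
def Enc (A : Set ℕ) (S : Multiset (Proc .sync)) (T : Multiset (Proc .async)) : Prop :=
  Opens A (handshake (parM S)) T

section
variable {A B : Set ℕ} {S S' : Multiset (Proc .sync)} {T T' Y : Multiset (Proc .async)}
  {p P : Proc .sync}

theorem fn_handshake_parM (S : Multiset (Proc .sync)) : (handshake (parM S)).fn = names S := by
  rw [fn_handshake, fn_parM]

theorem Enc.zero_iff : Enc A 0 T ↔ T = 0 := by
  simp only [Enc, parM, Multiset.toList_zero, parL_nil, handshake]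
  exact Opens.nil_iff

theorem Enc.singleton_iff : Enc A {p} T ↔ Opens A (handshake p) T := by
  simp only [Enc, parM, Multiset.toList_singleton, parL_cons, parL_nil, handshake]
  constructor
  · intro h
    obtain ⟨X, Y, rfl, hX, hY⟩ := Opens.par_inv h
    obtain rfl := Opens.nil_iff.1 hY
    simpa using hX
  · intro h
    rw [← add_zero T]
    exact .par h (.nil _)

theorem names_map_handshake (l : List (Proc .sync)) :
    names (l.map handshake : Multiset (Proc .async)) = names (l : Multiset (Proc .sync)) := by
  rw [← fn_parL, ← handshake_parL, fn_handshake, fn_parL]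

theorem Enc.coe_iff {l : List (Proc .sync)} (hA : Aᶜ.Infinite)
    (hl : names (l : Multiset (Proc .sync)) ⊆ A) : Enc A l T ↔ Opens A (handshake (parL l)) T := by
  have h := (Multiset.coe_eq_coe.1 (Multiset.coe_toList (l : Multiset (Proc .sync)))).map handshake
  rw [Enc, parM, handshake_parL, handshake_parL]
  refine ⟨Opens.parL_perm h hA ?_, Opens.parL_perm h.symm hA ?_⟩
  · rwa [names_map_handshake, Multiset.coe_toList]
  · rwa [names_map_handshake]

theorem Enc.add_iff (hA : Aᶜ.Infinite) (hS : names S ⊆ A) (hS' : names S' ⊆ A) :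
    Enc A (S + S') T ↔
      ∃ T₁ T₂, T = T₁ + T₂ ∧ Enc A S T₁ ∧ Enc A S' T₂ ∧ names T₁ ∩ names T₂ ⊆ A := by
  have e : S + S' = ((S.toList ++ S'.toList : List _) : Multiset (Proc .sync)) := by
    rw [← Multiset.coe_add, Multiset.coe_toList, Multiset.coe_toList]
  rw [e, Enc.coe_iff hA (by rw [← e, names_add]; exact Set.union_subset hS hS'), handshake_parL,
    List.map_append, Opens.parL_append_iff, ← handshake_parL, ← handshake_parL]
  exact Opens.par_iff hA (by rwa [← parM, fn_handshake_parM])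

theorem Enc.cons_iff (hA : Aᶜ.Infinite) (hS : names (p ::ₘ S) ⊆ A) :
    Enc A (p ::ₘ S) T ↔
      ∃ Y T', T = Y + T' ∧ Opens A (handshake p) Y ∧ Enc A S T' ∧ names Y ∩ names T' ⊆ A := by
  rw [names_cons, Set.union_subset_iff] at hS
  rw [← Multiset.singleton_add, Enc.add_iff hA (by simpa using hS.1) hS.2]
  simp only [Enc.singleton_iff]

theorem Enc.anti (h : Enc A S T) (hB : B ⊆ A) : Enc B S T := Opens.anti h hB

theorem Enc.enlarge (h : Enc A S T) (hB : B ∩ names T ⊆ A) (hS : names S ⊆ A)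
    (hi : (A ∪ B)ᶜ.Infinite) : Enc (A ∪ B) S T :=
  Opens.enlarge h hB (by rwa [fn_handshake_parM]) hi

theorem Enc.names_subset (h : Enc A S T) : names T ⊆ names S ∪ Aᶜ := by
  rw [← fn_handshake_parM]; exact Opens.names_subset h

theorem Enc.exists (S : Multiset (Proc .sync)) (hA : Aᶜ.Infinite) : ∃ T, Enc A S T :=
  Opens.exists_of_infinite _ hA

theorem Enc.map (h : Enc A S T) (hA : Aᶜ.Infinite) (hS : names S ⊆ A) (π : Equiv.Perm ℕ) :
    Enc (π '' A) (ren π S) (ren π T) := by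
  have h := Opens.map_perm h π
  rw [← handshake_rename, parM, parL_rename] at h
  have e : ren π S = ((S.toList.map (Proc.rename π) : List _) : Multiset (Proc .sync)) := by
    rw [← Multiset.map_coe, Multiset.coe_toList, ren]
  rw [e]
  refine (Enc.coe_iff ?_ ?_).2 h
  · rw [← Set.image_compl_eq π.bijective]
    exact hA.image π.injective.injOn
  · rw [← e, names_ren]; exact Set.image_mono hS

theorem Opens.handshake_mem_ok (hp : Guarded p) (h : Opens A (handshake p) Y) (hm : ok ∈ Y) :
    p = ok ∧ Y = {ok} := by
  cases hp with
  | ok => exact ⟨rfl, h.handshake_ok⟩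
  | sout n a P => obtain ⟨z, _, rfl⟩ := h.handshake_sout; simp [answer] at hm
  | join m c Q => obtain ⟨x, _, _, rfl⟩ := h.handshake_join; simp at hm
  | rep P => rw [h.handshake_rep] at hm; simp at hm

theorem Opens.handshake_mem_rep {R : Proc .async} (hp : Guarded p) (h : Opens A (handshake p) Y)
    (hm : rep R ∈ Y) : ∃ P, p = rep P ∧ R = handshake P ∧ Y = {rep R} := by
  cases hp with
  | ok => rw [h.handshake_ok] at hm; simp at hm
  | sout n a P => obtain ⟨z, _, rfl⟩ := h.handshake_sout; simp [answer] at hm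
  | join m c Q => obtain ⟨x, _, _, rfl⟩ := h.handshake_join; simp at hm
  | rep P =>
    obtain rfl := h.handshake_rep
    obtain rfl : R = handshake P := by simpa using hm
    exact ⟨P, rfl, rfl, rfl⟩

theorem Opens.handshake_mem_aout {n z : ℕ} (hp : Guarded p) (h : Opens A (handshake p) Y)
    (hm : aout n z ∈ Y) :
    ∃ a P, p = sout n a P ∧ z ∉ A ∧ Y = aout n z ::ₘ {answer z a P} := by
  cases hp with
  | ok => rw [h.handshake_ok] at hm; simp at hm
  | sout n' a P =>
    obtain ⟨z', hz', rfl⟩ := h.handshake_sout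
    obtain ⟨rfl, rfl⟩ : n = n' ∧ z = z' := by simpa [answer] using hm
    exact ⟨a, P, rfl, hz', rfl⟩
  | join m c Q => obtain ⟨x, _, _, rfl⟩ := h.handshake_join; simp at hm
  | rep P => rw [h.handshake_rep] at hm; simp at hm

theorem Opens.handshake_mem_join {m : ℕ} {c : Fin (m + 1) → ℕ} {R : Proc .async} (hp : Guarded p)
    (h : Opens A (handshake p) Y) (hm : join m c R ∈ Y) :
    (∃ (Q : Proc .sync) (x : Fin (m + 1) → ℕ), p = join m c Q ∧ R = joinBody x Q ∧
      Function.Injective x ∧ (∀ i, x i ∉ A) ∧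
      Y = {join m c R}) ∨
    ∃ n a P z, p = sout n a P ∧ z ∉ A ∧ join m c R = answer z a P ∧
      Y = aout n z ::ₘ {answer z a P} := by
  cases hp with
  | ok => rw [h.handshake_ok] at hm; simp at hm
  | sout n a P =>
    obtain ⟨z, hz, rfl⟩ := h.handshake_sout
    exact Or.inr ⟨n, a, P, z, rfl, hz, by simpa using hm, rfl⟩
  | join m' c' Q =>
    obtain ⟨x, hx, hx', rfl⟩ := h.handshake_join
    rw [Multiset.mem_singleton] at hm
    cases hm
    exact Or.inl ⟨Q, x, rfl, rfl, hx, hx', rfl⟩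
  | rep P => rw [h.handshake_rep] at hm; simp at hm

theorem answer_injective {z z' a a' : ℕ} {P P' : Proc .sync} (h : answer z a P = answer z' a' P') :
    z = z' ∧ a = a' ∧ P = P' := by
  simp only [answer, join.injEq, heq_eq_eq, par.injEq, aout.injEq, true_and,
    Nat.add_right_cancel_iff] at h
  exact ⟨congrFun h.1 0, h.2.1, handshake_injective (rename_injective Nat.succ_injective h.2.2)⟩

theorem joinBody_injective {m : ℕ} {x x' : Fin (m + 1) → ℕ} {Q Q' : Proc .sync}
    (h : joinBody x Q = joinBody x' Q') : Q = Q' := by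
  simp only [joinBody, join.injEq, heq_eq_eq, par.injEq, true_and] at h
  exact handshake_injective
    (rename_injective (liftBy_injective _ (add_left_injective (m + 1))) h.2.2)

theorem join_joinBody_ne_answer {m : ℕ} {c x : Fin (m + 1) → ℕ} {Q : Proc .sync} (z a : ℕ)
    (P : Proc .sync) : join m c (joinBody x Q) ≠ answer z a P := by
  intro h
  have h := ((Proc.join.injEq _ _ _ _ _ _).mp h).2.2
  simp only [joinBody, par.injEq, ← handshake_rename] at h
  exact handshake_ne_join _ _ _ _ h.2.symm

theorem Opens.fn_subset_of_handshake (hp : Guarded p) (h : Opens A (handshake p) Y) :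
    p.fn ⊆ names Y := by
  cases hp with
  | ok => simp [fn]
  | sout n a P =>
    obtain ⟨z, _, rfl⟩ := h.handshake_sout
    intro k hk
    simp only [names_cons, names_singleton, answer, fn, fn_rename, fn_handshake] at hk ⊢
    rcases hk with (rfl | rfl) | hk
    · simp
    · simp
    · exact Or.inr (Or.inr (Or.inr ⟨k, hk, rfl⟩))
  | join m c Q =>
    obtain ⟨x, _, _, rfl⟩ := h.handshake_join
    intro k hk
    simp only [names_singleton, joinBody, fn, fn_rename, fn_handshake] at hk ⊢
    rcases hk with hk | hk
    · exact Or.inl hk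
    · refine Or.inr (Or.inr (Or.inr ⟨k + (m + 1), hk, ?_⟩))
      rw [liftBy_add]
  | rep P =>
    rw [h.handshake_rep, names_singleton]
    simp only [fn, fn_handshake]; exact subset_rfl

/-- No free name of a source component is lost. Hence whatever is fresh for the target components is
fresh for the source as well. -/
theorem Enc.names_subset_names (h : Enc A S T) (hS : ∀ p ∈ S, Guarded p) (hA : Aᶜ.Infinite)
    (hSA : names S ⊆ A) : names S ⊆ names T := by
  induction S using Multiset.induction generalizing T with
  | empty => simp
  | cons p S ih =>
    obtain ⟨Y, T, rfl, hY, hT, _⟩ := (Enc.cons_iff hA hSA).1 h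
    rw [names_cons, names_add]
    rw [names_cons, Set.union_subset_iff] at hSA
    exact Set.union_subset_union (hY.fn_subset_of_handshake (hS p (by simp)))
      (ih hT (fun q hq => hS q (by simp [hq])) hSA.2)

/-- Every component of the translation belongs to the translation of a component. -/
theorem Enc.of_mem (h : Enc A S T) (hA : Aᶜ.Infinite) (hSA : names S ⊆ A) {q : Proc .async}
    (hq : q ∈ T) : ∃ p S₀ Y T₀, S = p ::ₘ S₀ ∧ T = Y + T₀ ∧ q ∈ Y ∧ Opens A (handshake p) Y ∧
      Enc A S₀ T₀ ∧ names Y ∩ names T₀ ⊆ A := by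
  induction S using Multiset.induction generalizing T with
  | empty => rw [Enc.zero_iff.1 h] at hq; simp at hq
  | cons p S ih =>
    obtain ⟨Y, T, rfl, hY, hT, hn⟩ := (Enc.cons_iff hA hSA).1 h
    rcases Multiset.mem_add.1 hq with hq | hq
    · exact ⟨p, S, Y, T, rfl, rfl, hq, hY, hT, hn⟩
    · have hSA' := hSA
      rw [names_cons, Set.union_subset_iff] at hSA'
      obtain ⟨p', S₀, Y', T₀, rfl, rfl, hq, hY', hT', hn'⟩ := ih hT hSA'.2 hq
      rw [names_cons, Set.union_subset_iff] at hSA'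
      have hn₁ : names Y ∩ names Y' ⊆ A := fun n h => hn ⟨h.1, by simp [h.2]⟩
      have hn₂ : names Y ∩ names T₀ ⊆ A := fun n h => hn ⟨h.1, by simp [h.2]⟩
      refine ⟨p', p ::ₘ S₀, Y', Y + T₀, Multiset.cons_swap .., add_left_comm .., hq, hY', ?_, ?_⟩
      · refine (Enc.cons_iff hA ?_).2 ⟨Y, T₀, rfl, hY, hT', hn₂⟩
        rw [names_cons, Set.union_subset_iff]
        exact ⟨hSA'.1, hSA'.2.2⟩
      · rw [names_add, Set.inter_union_distrib_left, Set.union_subset_iff, Set.inter_comm]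
        exact ⟨hn₁, hn'⟩

theorem Enc.mem_ok (h : Enc A S T) (hS : ∀ p ∈ S, Guarded p) (hA : Aᶜ.Infinite)
    (hSA : names S ⊆ A) (hm : ok ∈ T) : ok ∈ S := by
  obtain ⟨p, S₀, Y, T₀, rfl, rfl, hq, hY, -, -⟩ := h.of_mem hA hSA hm
  rw [(hY.handshake_mem_ok (hS p (by simp)) hq).1]
  simp

theorem Enc.mem_rep {R : Proc .async} (h : Enc A S T) (hS : ∀ p ∈ S, Guarded p) (hA : Aᶜ.Infinite)
    (hSA : names S ⊆ A) (hm : rep R ∈ T) : ∃ P, rep P ∈ S ∧ R = handshake P := by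
  obtain ⟨p, S₀, Y, T₀, rfl, rfl, hq, hY, -, -⟩ := h.of_mem hA hSA hm
  obtain ⟨P, rfl, rfl, -⟩ := hY.handshake_mem_rep (hS p (by simp)) hq
  exact ⟨P, by simp, rfl⟩

/-- Among the components of a translation, a top-level output can only be the announcement of a
source output; its payload is a private name that links it to one answering input and occurs in no
other pair. -/
theorem Enc.mem_aout {n z : ℕ} (h : Enc A S T) (hS : ∀ p ∈ S, Guarded p) (hA : Aᶜ.Infinite)
    (hSA : names S ⊆ A) (hm : aout n z ∈ T) :
    ∃ a P S₀ T₀, S = sout n a P ::ₘ S₀ ∧ T = aout n z ::ₘ answer z a P ::ₘ T₀ ∧ Enc A S₀ T₀ ∧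
      z ∉ A ∧ z ∉ names T₀ := by
  obtain ⟨p, S₀, Y, T₀, rfl, rfl, hq, hY, hT, hn⟩ := h.of_mem hA hSA hm
  obtain ⟨a, P, rfl, hz, rfl⟩ := hY.handshake_mem_aout (hS p (by simp)) hq
  refine ⟨a, P, S₀, T₀, rfl, by simp, hT, hz, fun h => hz (hn ⟨?_, h⟩)⟩
  simp [fn]

/-- The translation of components can be undone. -/
theorem Enc.injective (h : Enc A S T) (h' : Enc B S' T) (hS : ∀ p ∈ S, Guarded p)
    (hS' : ∀ p ∈ S', Guarded p) (hA : Aᶜ.Infinite) (hB : Bᶜ.Infinite) (hSA : names S ⊆ A)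
    (hSB : names S' ⊆ B) : S = S' := by
  induction S using Multiset.induction generalizing T S' with
  | empty =>
    obtain rfl := Enc.zero_iff.1 h
    induction S' using Multiset.induction with
    | empty => rfl
    | cons p S' _ =>
      obtain ⟨Y, T, e, hY, -, -⟩ := (Enc.cons_iff hB hSB).1 h'
      obtain ⟨rfl, -⟩ := add_eq_zero.1 e.symm
      cases hS' p (by simp) with
      | ok => simpa using hY.handshake_ok
      | sout n a P => obtain ⟨z, _, e⟩ := hY.handshake_sout; simp at e
      | join m c Q => obtain ⟨x, _, _, e⟩ := hY.handshake_join; simp at e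
      | rep P => simpa using hY.handshake_rep
  | cons p S ih =>
    obtain ⟨Y, T, rfl, hY, hT, -⟩ := (Enc.cons_iff hA hSA).1 h
    suffices ∃ S₀, S' = p ::ₘ S₀ ∧ Enc B S₀ T by
      obtain ⟨S₀, rfl, hT'⟩ := this
      rw [names_cons, Set.union_subset_iff] at hSA hSB
      rw [ih hT hT' (fun q hq => hS q (by simp [hq])) (fun q hq => hS' q (by simp [hq])) hSA.2
        hSB.2]
    -- It suffices to exhibit one component `q` of the translation of `p` that identifies both its
    -- origin and the other components with the same origin.
    have key : ∀ q ∈ Y, (∀ p' Y' T₀, Guarded p' → q ∈ Y' → Y + T = Y' + T₀ →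
        Opens B (handshake p') Y' → names Y' ∩ names T₀ ⊆ B → p' = p ∧ Y' = Y) →
        ∃ S₀, S' = p ::ₘ S₀ ∧ Enc B S₀ T := by
      intro q hq hp
      obtain ⟨p', S₀, Y', T₀, rfl, e, hq', hY', hT', hn⟩ :=
        h'.of_mem hB hSB (q := q) (by simp [hq])
      obtain ⟨rfl, rfl⟩ := hp p' Y' T₀ (hS' p' (by simp)) hq' e hY' hn
      exact ⟨S₀, rfl, by rwa [add_left_cancel e]⟩
    cases hS p (by simp) with
    | ok =>
      obtain rfl := hY.handshake_ok
      exact key ok (by simp) fun p' Y' T₀ hp' hq _ hY' _ => hY'.handshake_mem_ok hp' hq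
    | rep P =>
      obtain rfl := hY.handshake_rep
      refine key _ (Multiset.mem_singleton_self _) fun p' Y' T₀ hp' hq _ hY' _ => ?_
      obtain ⟨P', rfl, e, rfl⟩ := hY'.handshake_mem_rep hp' hq
      exact ⟨by rw [handshake_injective e], rfl⟩
    | join m c Q =>
      obtain ⟨x, _, _, rfl⟩ := hY.handshake_join
      refine key _ (Multiset.mem_singleton_self _) fun p' Y' T₀ hp' hq _ hY' _ => ?_
      rcases hY'.handshake_mem_join hp' hq with
        ⟨Q', x', rfl, e, -, -, rfl⟩ | ⟨_, _, _, _, -, -, e, -⟩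
      · exact ⟨by rw [joinBody_injective e], rfl⟩
      · exact (join_joinBody_ne_answer _ _ _ e).elim
    | sout n a P =>
      obtain ⟨z, _, rfl⟩ := hY.handshake_sout
      refine key (aout n z) (by simp) fun p' Y' T₀ hp' hq e hY' hn => ?_
      obtain ⟨a', P', rfl, hz, rfl⟩ := hY'.handshake_mem_aout hp' hq
      -- The announcement alone reveals neither the payload nor the continuation. They are read off
      -- from the answering input on `z`, which must be its partner because `z` does not occur in
      -- the rest.
      have hm : answer z a P ∈ (aout n z ::ₘ {answer z a' P'}) + T₀ := by rw [← e]; simp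
      have hz' : z ∉ names T₀ := fun h => hz (hn ⟨by simp [fn], h⟩)
      simp only [Multiset.cons_add, Multiset.singleton_add, Multiset.mem_cons] at hm
      rcases hm with hm | hm | hm
      · cases hm
      · obtain ⟨-, rfl, rfl⟩ := answer_injective hm
        exact ⟨rfl, rfl⟩
      · exact (hz' ⟨_, hm, by simp [answer, fn]⟩).elim

theorem Opens.of_handshake_guarded (hp : Guarded p) (hP : p.fn ⊆ A)
    (h : Opens A (handshake p) T) : ∃ S, Opens A p S ∧ Enc (A ∪ names S) S T := by
  refine ⟨_, .guarded _ hp, ?_⟩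
  rw [names_singleton, Set.union_eq_self_of_subset_right hP]
  exact Enc.singleton_iff.2 h

theorem Enc.names_subset_names_of_opens (h : Opens A P S) (h' : Enc (A ∪ names S) S T)
    (hA : Aᶜ.Infinite) : names S ⊆ names T :=
  h'.names_subset_names h.of_mem (infinite_compl_union hA (names_finite S)) Set.subset_union_right

/-- The renaming `g` keeps the recursion structural below instantiated restrictions. For parallel
compositions, the names of the source components occur in the target components, so separation of
the latter gives separation of the former. -/
theorem Opens.of_handshake_rename : ∀ (P : Proc .sync) (g : ℕ → ℕ) {A : Set ℕ}
    {T : Multiset (Proc .async)}, Aᶜ.Infinite → (P.rename g).fn ⊆ A →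
    Opens A (handshake (P.rename g)) T →
    ∃ S, Opens A (P.rename g) S ∧ Enc (A ∪ names S) S T
  | .ok, g, A, T, hA, hP, h => h.of_handshake_guarded .ok hP
  | .sout _ _ _, g, A, T, hA, hP, h => h.of_handshake_guarded (.sout ..) hP
  | .join _ _ _, g, A, T, hA, hP, h => h.of_handshake_guarded (.join ..) hP
  | .rep _, g, A, T, hA, hP, h => h.of_handshake_guarded (.rep ..) hP
  | .nil, g, A, T, hA, hP, h => by
    simp only [Proc.rename, handshake] at h
    obtain rfl := nil_iff.1 h
    exact ⟨0, .nil _, Enc.zero_iff.2 rfl⟩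
  | .res P, g, A, T, hA, hP, h => by
    simp only [Proc.rename, handshake] at h
    obtain ⟨z, hz, h⟩ := res_iff.1 h
    rw [← handshake_rename, rename_rename] at h
    have hA' : (insert z A)ᶜ.Infinite := by
      rw [← Set.union_singleton]
      exact infinite_compl_union hA (Set.finite_singleton z)
    obtain ⟨S, hS, hT⟩ := Opens.of_handshake_rename P _ hA' (by
      rw [← rename_rename]
      exact (fn_sub _ z).trans (Set.insert_subset_insert hP)) h
    refine ⟨S, .res hz (by rwa [rename_rename]), hT.anti ?_⟩
    exact Set.union_subset_union_left _ (Set.subset_insert _ _)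
  | .ite s t P Q, g, A, T, hA, hP, h => by
    simp only [Proc.rename, handshake] at h ⊢
    simp only [Proc.rename, fn, Set.union_subset_iff] at hP
    by_cases hst : s.rename g = t.rename g
    · rw [hst] at h ⊢
      simp only [ite_eq_iff] at h ⊢
      exact Opens.of_handshake_rename P g hA hP.1.2 h
    · simp only [ite_ne_iff hst] at h ⊢
      exact Opens.of_handshake_rename Q g hA hP.2 h
  | .par P Q, g, A, T, hA, hP, h => by
    simp only [Proc.rename, handshake] at h
    simp only [Proc.rename, fn, Set.union_subset_iff] at hP
    obtain ⟨T₁, T₂, rfl, h₁, h₂, hn⟩ := (par_iff hA (by rw [fn_handshake]; exact hP.2)).1 h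
    obtain ⟨S₁, hS₁, hT₁⟩ := Opens.of_handshake_rename P g hA hP.1 h₁
    obtain ⟨S₂, hS₂, hT₂⟩ := Opens.of_handshake_rename Q g hA hP.2 h₂
    have hn₁ := Enc.names_subset_names_of_opens hS₁ hT₁ hA
    have hn₂ := Enc.names_subset_names_of_opens hS₂ hT₂ hA
    have hi := infinite_compl_union (infinite_compl_union hA (names_finite S₁)) (names_finite S₂)
    refine ⟨S₁ + S₂, (par_iff hA hP.2).2 ⟨S₁, S₂, rfl, hS₁, hS₂, by grind⟩, ?_⟩
    rw [names_add, ← Set.union_assoc]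
    refine (Enc.add_iff hi (by grind) (by grind)).2 ⟨T₁, T₂, rfl, ?_, ?_, by grind⟩
    · exact hT₁.enlarge (by grind) (by grind) hi
    · rw [Set.union_right_comm] at hi ⊢
      exact hT₂.enlarge (by grind) (by grind) hi

/-- Opening commutes with the translation. -/
theorem Opens.of_handshake (hA : Aᶜ.Infinite) (hP : P.fn ⊆ A) (h : Opens A (handshake P) T) :
    ∃ S, Opens A P S ∧ Enc (A ∪ names S) S T := by
  have := Opens.of_handshake_rename P id (T := T) hA
  rw [Proc.rename_id] at this
  exact this hP h

end

/-! ### Lifting structural rewriting from target to source. -/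

/-- The components `T` are the translations of the components `S`, opened with fresh names. -/
def Encodes (S : Multiset (Proc .sync)) (T : Multiset (Proc .async)) : Prop :=
  (∀ p ∈ S, Guarded p) ∧ Enc (Pub ∪ names S) S T

theorem Encodes.exists {S : Multiset (Proc .sync)} (hS : ∀ p ∈ S, Guarded p) :
    ∃ T, Encodes S T := by
  obtain ⟨T, hT⟩ := Enc.exists S (infinite_compl_pub_union S)
  exact ⟨T, hS, hT⟩

theorem Top.exists_encodes {P : Proc .sync} {T : Multiset (Proc .async)}
    (h : Top (handshake P) T) : ∃ S, Top P S ∧ Encodes S T := by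
  rw [Top, ← handshake_rename] at h
  obtain ⟨S, hS, hT⟩ := h.of_handshake infinite_compl_pub (fn_rename_dbl P)
  exact ⟨S, hS, hS.of_mem, hT⟩

theorem handshake_nuL (l : List ℕ) (P : Proc .sync) :
    handshake (nuL l P) = nuL l (handshake P) := by
  induction l with
  | nil => rfl
  | cons a l ih => simp [nu, handshake, handshake_rename, ih]

section
variable {S S' : Multiset (Proc .sync)} {T T' : Multiset (Proc .async)}

theorem Encodes.iso (h : Encodes S T) (h' : Iso T T') : ∃ S', Iso S S' ∧ Encodes S' T' := by
  obtain ⟨π, hπ, rfl⟩ := h'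
  refine ⟨ren π S, ⟨π, hπ, rfl⟩, fun p hp => ?_, ?_⟩
  · obtain ⟨q, hq, rfl⟩ := Multiset.mem_map.1 hp
    exact (h.1 q hq).rename π
  · rw [← image_pub_union hπ]
    exact h.2.map (infinite_compl_pub_union S) Set.subset_union_right π

theorem Encodes.names_subset (h : Encodes S T) : names S ⊆ names T :=
  h.2.names_subset_names h.1 (infinite_compl_pub_union S) Set.subset_union_right

/-- A replication in `T` is the translation of one in `S`, and opening its body in the target comes
from an opening in the source; the rest is separation of the fresh names. -/
theorem Encodes.unf (h : Encodes S T) (h' : Unf T T') : ∃ S', Unf S S' ∧ Encodes S' T' := by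
  obtain ⟨R, U, hR, hU, rfl⟩ := h'
  have hi := infinite_compl_pub_union S
  have hST := h.names_subset
  obtain ⟨P, hP, rfl⟩ := h.2.mem_rep h.1 hi Set.subset_union_right hR
  have hPS : P.fn ⊆ names S := fun n hn => fn_subset_names hP hn
  have hUn := hU.names_subset
  rw [fn_handshake] at hUn
  obtain ⟨V, hV, hVU⟩ := hU.of_handshake (infinite_compl_pub_union T) (by grind)
  have hVn := hV.names_subset
  have hTn := h.2.names_subset
  have hi' := infinite_compl_pub_union (S + V)
  rw [names_add, ← Set.union_assoc] at hi'
  refine ⟨S + V, ⟨P, V, hP, hV.anti (by grind), rfl⟩, fun p hp => ?_, ?_⟩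
  · exact (Multiset.mem_add.1 hp).elim (h.1 p) (hV.of_mem p)
  · rw [names_add, ← Set.union_assoc]
    refine (Enc.add_iff hi' (by grind) (by grind)).2 ⟨T, U, rfl, ?_, hVU.anti (by grind),
      by grind (ematch := 10)⟩
    exact h.2.enlarge (by grind (ematch := 10)) (by grind) hi'

theorem Encodes.step (h : Encodes S T) (h' : Step T T') : ∃ S', Step S S' ∧ Encodes S' T' := by
  rcases h' with h' | h'
  · obtain ⟨S', hS, h⟩ := h.iso h'
    exact ⟨S', .inl hS, h⟩
  · obtain ⟨S', hS, h⟩ := h.unf h'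
    exact ⟨S', .inr hS, h⟩

theorem Encodes.steps (h : Encodes S T) (h' : Relation.ReflTransGen Step T T') :
    ∃ S', Relation.ReflTransGen Step S S' ∧ Encodes S' T' := by
  induction h' with
  | refl => exact ⟨S, .refl, h⟩
  | tail _ h' ih =>
    obtain ⟨S', hS, h⟩ := ih
    obtain ⟨S'', hS', h⟩ := h.step h'
    exact ⟨S'', hS.tail hS', h⟩

theorem Encodes.injective (h : Encodes S T) (h' : Encodes S' T) : S = S' :=
  h.2.injective h'.2 h.1 h'.1 (infinite_compl_pub_union S) (infinite_compl_pub_union S')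
    Set.subset_union_right Set.subset_union_right

theorem Encodes.readback (h : Encodes S T) :
    StructEq (handshake (readback S)) (readback T) := by
  rw [Joining.readback, handshake_nuL]
  refine (StructEq.nuL_congr _ (Opens.structEq h.2 ?_)).trans ?_
  · rw [fn_handshake_parM]; exact Set.subset_union_right
  rw [← nuL_append]
  refine .nuL_readback (List.nodup_append.2 ⟨nodup_priv _ _, nodup_priv _ _, ?_⟩) ?_ ?_
  · intro a ha b hb e
    rw [mem_priv] at ha hb
    exact hb.2 (Or.inr (e ▸ ha.1))
  · intro n hn
    simp only [List.mem_append, mem_priv, Set.mem_union] at hn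
    tauto
  · intro n hn hn'
    simp only [List.mem_append, mem_priv, Set.mem_union]
    tauto

end

/-- The translation reflects structural equivalence. -/
theorem StructEq.of_handshake {P Q : Proc .sync}
    (h : StructEq (Joining.handshake P) (Joining.handshake Q)) : StructEq P Q := by
  obtain ⟨X, hX⟩ := Top.exists (Joining.handshake P)
  obtain ⟨Y, hY⟩ := Top.exists (Joining.handshake Q)
  -- Confluence provides a common reduct of the two translations. Both rewriting sequences lift to
  -- the sources, and end in the same multiset because the encoding can be undone.
  obtain ⟨Z, hXZ, hYZ⟩ := h.eqv X Y hX hY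
  obtain ⟨S, hPS, hS⟩ := hX.exists_encodes
  obtain ⟨S', hQS, hS'⟩ := hY.exists_encodes
  obtain ⟨S₁, hS₁, h₁⟩ := hS.steps hXZ
  obtain ⟨S₂, hS₂, h₂⟩ := hS'.steps hYZ
  obtain rfl := h₁.injective h₂
  exact (structEq_iff_eqv hPS hQS).2 ⟨S₁, hS₁, hS₂⟩

/-! ### Completing a handshake by private interactions. -/

theorem coe_ofFn_succ {β : Type*} {n : ℕ} (f : Fin (n + 1) → β) :
    (List.ofFn f : Multiset β) = f 0 ::ₘ (List.ofFn fun i => f i.succ : Multiset β) := by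
  rw [List.ofFn_succ, Multiset.cons_coe]

theorem Opens.parAll_iff {α : Synchronism} {A : Set ℕ} (m : ℕ) (P : Fin (m + 1) → Proc α)
    {X : Multiset (Proc α)} :
    Opens A (Proc.parAll m P) X ↔ Opens A (parL (List.ofFn P)) X := by
  induction m generalizing A X with
  | zero =>
    simp only [Proc.parAll, List.ofFn_succ, List.ofFn_zero, parL_cons, parL_nil]
    constructor
    · intro h
      rw [← add_zero X]
      exact .par h (.nil _)
    · intro h
      obtain ⟨X, Y, rfl, hX, hY⟩ := par_inv h
      obtain rfl := nil_iff.1 hY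
      simpa using hX
  | succ m ih =>
    rw [List.ofFn_succ, parL_cons, Proc.parAll]
    constructor <;> intro h <;> obtain ⟨X, Y, rfl, hX, hY⟩ := par_inv h
    · exact .par hX ((ih _).1 hY)
    · exact .par hX ((ih _).2 hY)

theorem Opens.parL_guarded {α : Synchronism} {A : Set ℕ} {l : List (Proc α)}
    (hl : ∀ p ∈ l, Guarded p) {X : Multiset (Proc α)} (h : Opens A (parL l) X) : X = l := by
  induction l generalizing A X with
  | nil => exact nil_iff.1 h
  | cons p l ih =>
    obtain ⟨X, Y, rfl, hX, hY⟩ := par_inv h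
    rw [(guarded_iff (hl p (by simp))).1 hX, ih (fun q hq => hl q (by simp [hq])) hY,
      Multiset.singleton_add, Multiset.cons_coe]

theorem handshake_parAll (m : ℕ) (P : Fin (m + 1) → Proc .sync) :
    handshake (parAll m P) = parAll m fun i => handshake (P i) := by
  induction m with
  | zero => rfl
  | succ m ih => simp [parAll, handshake, ih]

theorem joinBody_rename_inst {m : ℕ} (x b : Fin (m + 1) → ℕ) (Q : Proc .sync) :
    (joinBody x Q).rename (inst b) =
      par (parAll m fun j => aout (b j) (x j)) (join m x (handshake Q)) := by
  simp only [joinBody, Proc.rename, parAll_rename, inst_eq_instBelow, instBelow_add,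
    instBelow_coe, rename_rename, liftBy_comp]
  congr 2
  refine rename_eq_self _ fun n _ => ?_
  have : instBelow b ∘ (· + (m + 1)) = id := funext fun n => instBelow_add b n
  rw [this, liftBy_id]; rfl

theorem answer_body_rename_inst (a : ℕ) (P : Proc .sync) (x : Fin 1 → ℕ) :
    (par (aout 0 (a + 1)) ((handshake P).rename Nat.succ)).rename (inst (m := 0) x) =
      par (aout (x 0) a) (handshake P) := by
  simp only [Proc.rename, rename_rename, par.injEq, aout.injEq]
  refine ⟨⟨rfl, rfl⟩, rename_eq_self _ fun n _ => ?_⟩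
  simp [inst]

/-- An interaction on channels that do not occur elsewhere. -/
def Admin (M N : Multiset (Proc .async)) : Prop :=
  ∃ (m : ℕ) (c b : Fin (m + 1) → ℕ) (Q : Proc .async) (L X : Multiset (Proc .async)),
    Function.Injective c ∧ (∀ i, c i ∉ names L) ∧
    M = (join m c Q ::ₘ (List.ofFn fun i => aout (c i) (b i))) + L ∧
    Opens (Pub ∪ names M) (Q.rename (inst b)) X ∧ N = L + X

theorem Admin.comm {M N : Multiset (Proc .async)} (h : Admin M N) : Comm M N := by
  obtain ⟨m, c, b, Q, L, X, -, -, rfl, hX, rfl⟩ := h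
  exact ⟨_, L, _, X, .async m c b Q, rfl, hX, rfl⟩

theorem names_answer (z a : ℕ) (P : Proc .sync) : (answer z a P).fn = {z, a} ∪ P.fn := by
  ext n
  simp only [answer, fn, fn_rename, fn_handshake, Set.mem_union, Set.mem_range,
    Set.mem_ofPred_eq, Set.mem_insert_iff, Set.mem_singleton_iff, Set.mem_image]
  constructor
  · rintro (⟨_, rfl⟩ | (h | h) | ⟨k, hk, h⟩)
    · simp
    · omega
    · left; right; omega
    · obtain rfl : k = n := by omega
      exact Or.inr hk
  · rintro ((rfl | rfl) | h)
    · simp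
    · simp
    · exact Or.inr (Or.inr ⟨n, h, rfl⟩)

/-- All acknowledged outputs release their continuations. -/
theorem admin_answers {n : ℕ} (b x a : Fin n → ℕ) (P : Fin n → Proc .sync)
    (N : Multiset (Proc .async)) (B : Set ℕ) (hb : Function.Injective b)
    (hbN : ∀ i, b i ∉ names N) (hbx : ∀ i j, b i ≠ x j) (hba : ∀ i j, b i ≠ a j)
    (hbP : ∀ i j, b i ∉ (P j).fn) (hB : Bᶜ.Infinite) (hPub : Pub ⊆ B) (hN : names N ⊆ B)
    (hbB : ∀ i, b i ∈ B) (hxB : ∀ i, x i ∈ B) (haB : ∀ i, a i ∈ B) (hPB : ∀ i, (P i).fn ⊆ B) :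
    ∃ Y, Opens B (parL (List.ofFn fun i => handshake (P i))) Y ∧
      Relation.ReflTransGen Admin
        ((List.ofFn fun i => aout (b i) (x i) : Multiset _) +
          (List.ofFn fun i => answer (b i) (a i) (P i) : Multiset _) + N)
        ((List.ofFn fun i => aout (x i) (a i) : Multiset _) + Y + N) := by
  induction n generalizing N B with
  | zero =>
    refine ⟨0, .nil _, ?_⟩
    simp only [List.ofFn_zero, Multiset.coe_nil, add_zero]
    exact .refl
  | succ n ih =>
    -- The first continuation is opened away from `B`. It then counts as part of the surroundings,
    -- and its names are forbidden for the remaining ones.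
    obtain ⟨Y₀, hY₀⟩ := Opens.exists_of_infinite (handshake (P 0)) hB
    have hY₀n := hY₀.names_subset
    rw [fn_handshake] at hY₀n
    have hbN' : ∀ i : Fin n, b i.succ ∉ names ({aout (x 0) (a 0)} + Y₀ + N) := fun i h => by
      rw [names_add, names_add, names_singleton] at h
      rcases h with (h | h) | h
      · rcases h with h | h
        · exact hbx _ _ h
        · exact hba _ _ h
      · rcases hY₀n h with h | h
        · exact hbP _ _ h
        · exact h (hbB _)
      · exact hbN _ h
    have hN' : names ({aout (x 0) (a 0)} + Y₀ + N) ⊆ B ∪ names Y₀ := by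
      rw [names_add, names_add, names_singleton]
      rintro n ((h | h) | h)
      · rcases h with rfl | rfl
        · exact Or.inl (hxB 0)
        · exact Or.inl (haB 0)
      · exact Or.inr h
      · exact Or.inl (hN h)
    obtain ⟨Y, hY, hs⟩ := ih (fun i => b i.succ) (fun i => x i.succ) (fun i => a i.succ)
      (fun i => P i.succ) ({aout (x 0) (a 0)} + Y₀ + N) (B ∪ names Y₀)
      (hb.comp (Fin.succ_injective n)) hbN' (fun _ _ => hbx _ _) (fun _ _ => hba _ _)
      (fun _ _ => hbP _ _) (infinite_compl_union hB (names_finite Y₀))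
      (hPub.trans Set.subset_union_left) hN' (fun i => Or.inl (hbB _)) (fun i => Or.inl (hxB _))
      (fun i => Or.inl (haB _)) (fun i n hn => Or.inl (hPB _ hn))
    refine ⟨Y₀ + Y, ?_, ?_⟩
    · rw [List.ofFn_succ]
      exact .par hY₀ hY
    · simp only [coe_ofFn_succ]
      refine .head ⟨0, fun _ => b 0, fun _ => x 0,
        par (aout 0 (a 0 + 1)) ((handshake (P 0)).rename Nat.succ),
        (List.ofFn fun i : Fin n => aout (b i.succ) (x i.succ) : Multiset _) +
          (List.ofFn fun i : Fin n => answer (b i.succ) (a i.succ) (P i.succ) : Multiset _) + N,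
        {aout (x 0) (a 0)} + Y₀,
        fun i j _ => (Fin.fin_one_eq_zero i).trans (Fin.fin_one_eq_zero j).symm, fun _ h => ?_, ?_, ?_, rfl⟩ ?_
      · simp only [names_add, names_ofFn] at h
        rcases h with (h | h) | h
        · obtain ⟨i, h | h⟩ := Set.mem_iUnion.1 h
          · exact absurd (hb h) (Fin.succ_ne_zero i).symm
          · exact hbx _ _ h
        · obtain ⟨i, h⟩ := Set.mem_iUnion.1 h
          rw [names_answer] at h
          rcases h with (h | h) | h
          · exact absurd (hb h) (Fin.succ_ne_zero i).symm
          · exact hba _ _ h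
          · exact hbP _ _ h
        · exact hbN _ h
      · simp only [List.ofFn_succ, List.ofFn_zero, Multiset.coe_singleton,
          ← Multiset.singleton_add, answer]
        abel
      · rw [answer_body_rename_inst]
        refine Opens.anti (A := B) (.par (.guarded _ (.aout _ _)) (hY₀.anti ?_)) ?_
        · rw [names_singleton]
          rintro n (h | rfl | rfl)
          · exact h
          · exact hxB 0
          · exact haB 0
        · simp only [names_add, names_cons, names_ofFn, names_answer]
          simp only [Set.union_subset_iff, Set.iUnion_subset_iff, fn, Set.insert_subset_iff,
            Set.singleton_subset_iff]
          exact ⟨hPub, ⟨⟨⟨hbB 0, hxB 0⟩, fun i => ⟨hbB _, hxB _⟩⟩,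
            ⟨⟨hbB 0, haB 0⟩, hPB 0⟩, fun i => ⟨⟨hbB _, haB _⟩, hPB _⟩⟩, hN⟩
      · convert hs using 1
        · abel
        · simp only [← Multiset.singleton_add]; abel

/-- After the interaction on the public channels, the handshakes can be completed. -/
theorem Enc.complete {m : ℕ} (c a b x : Fin (m + 1) → ℕ) (P : Fin (m + 1) → Proc .sync)
    (Q : Proc .sync) {S S₁ : Multiset (Proc .sync)} {T₁ : Multiset (Proc .async)}
    (hS : S = (join m c Q ::ₘ (List.ofFn fun i => sout (c i) (a i) (P i))) + S₁)
    (hg : ∀ p ∈ S₁, Guarded p) (hT : Enc (Pub ∪ names S) S₁ T₁) (hb : Function.Injective b)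
    (hx : Function.Injective x) (hbS : ∀ i, b i ∉ Pub ∪ names S) (hxS : ∀ i, x i ∉ Pub ∪ names S)
    (hbT : ∀ i, b i ∉ names T₁) (hxT : ∀ i, x i ∉ names T₁) (hbx : ∀ i j, b i ≠ x j) :
    ∃ X T', Opens (Pub ∪ names S) (par (parAll m P) (Q.rename (inst a))) X ∧
      Relation.ReflTransGen Admin
        ((List.ofFn fun i => answer (b i) (a i) (P i) : Multiset _) + T₁ +
          ((List.ofFn fun i => aout (b i) (x i) : Multiset _) + {join m x (handshake Q)})) T' ∧
      Encodes (S₁ + X) T' := by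
  have haS : ∀ i, a i ∈ names S := fun i => by
    rw [hS, names_add, names_cons, names_ofFn]
    exact Or.inl (Or.inr (Set.mem_iUnion.2 ⟨i, by simp [fn]⟩))
  have hPS : ∀ i, (P i).fn ⊆ names S := fun i n hn => by
    rw [hS, names_add, names_cons, names_ofFn]
    exact Or.inl (Or.inr (Set.mem_iUnion.2 ⟨i, by simp [fn, hn]⟩))
  have hQS : {n | n + (m + 1) ∈ Q.fn} ⊆ names S := fun n hn => by
    rw [hS, names_add, names_cons]
    exact Or.inl (Or.inl (Or.inr hn))
  have hS₁S : names S₁ ⊆ names S := by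
    rw [hS, names_add]; exact Set.subset_union_right
  have hR : (par (parAll m P) (Q.rename (inst a))).fn ⊆ names S := by
    rw [hS]
    exact (Redex.fn_subset (.sync m c a P Q)).trans (by rw [names_add]; exact Set.subset_union_left)
  -- `B` includes the handshake names as well, so the released continuations cannot accidentally use
  -- the channels of interactions still pending.
  obtain ⟨B, hB⟩ : ∃ B, B = Pub ∪ names S ∪ names T₁ ∪ (Set.range b ∪ Set.range x) := ⟨_, rfl⟩
  have hBi : Bᶜ.Infinite := by
    rw [hB]
    exact infinite_compl_union (infinite_compl_union (infinite_compl_pub_union S) (names_finite T₁))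
      ((Set.finite_range b).union (Set.finite_range x))
  have hSB : Pub ∪ names S ⊆ B := by rw [hB]; grind
  have hTB : names T₁ ⊆ B := by rw [hB]; grind
  have hbB : ∀ i, b i ∈ B := fun i => by rw [hB]; exact Or.inr (Or.inl ⟨i, rfl⟩)
  have hxB : ∀ i, x i ∈ B := fun i => by rw [hB]; exact Or.inr (Or.inr ⟨i, rfl⟩)
  clear hB
  have hPubB : Pub ⊆ B := Set.subset_union_left.trans hSB
  have hNB : names S ⊆ B := Set.subset_union_right.trans hSB
  have hjoin : (join m x (handshake Q)).fn = Set.range x ∪ {n | n + (m + 1) ∈ Q.fn} := by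
    simp only [fn, fn_handshake]
  have hbN : ∀ i, b i ∉ names (T₁ + {join m x (handshake Q)}) := fun i h => by
    rw [names_add, names_singleton, hjoin] at h
    rcases h with h | ⟨j, h⟩ | h
    · exact hbT i h
    · exact hbx i j h.symm
    · exact hbS i (Or.inr (hQS h))
  obtain ⟨Y, hY, hs⟩ := admin_answers b x a P (T₁ + {join m x (handshake Q)}) B hb hbN
    hbx (fun i j e => hbS i (Or.inr (e ▸ haS j))) (fun i j h => hbS i (Or.inr (hPS j h))) hBi hPubB
    (by
      rw [names_add, names_singleton, hjoin]
      refine Set.union_subset hTB (Set.union_subset ?_ (hQS.trans hNB))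
      rintro _ ⟨i, rfl⟩; exact hxB i)
    hbB hxB (fun i => hNB (haS i)) (fun i => (hPS i).trans hNB)
  have hYn : names Y ⊆ names S ∪ Bᶜ := by
    refine hY.names_subset.trans (Set.union_subset_union_left _ ?_)
    rw [fn_parL, names_ofFn]
    exact Set.iUnion_subset fun i => by rw [fn_handshake]; exact hPS i
  obtain ⟨Z, hZ⟩ := Opens.exists_of_infinite (handshake (Q.rename (inst a)))
    (infinite_compl_union hBi (names_finite Y))
  have hYZ : Opens B (handshake (par (parAll m P) (Q.rename (inst a)))) (Y + Z) := by
    rw [handshake, handshake_parAll]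
    exact .par ((Opens.parAll_iff m _).2 hY) hZ
  -- The released continuations and the instantiated body together open the translation of the
  -- source residue, so they come from an opening `X` of that residue.
  obtain ⟨X, hX, hXYZ⟩ := hYZ.of_handshake hBi (hR.trans hNB)
  have hYZn := hYZ.names_subset
  have hXn := hX.names_subset
  have hTn := hT.names_subset
  rw [fn_handshake] at hYZn
  refine ⟨X, T₁ + (Y + Z), hX.anti hSB, ?_, fun p hp => ?_, ?_⟩
  · have e : (List.ofFn fun i => answer (b i) (a i) (P i) : Multiset _) + T₁ +
          ((List.ofFn fun i => aout (b i) (x i) : Multiset _) + {join m x (handshake Q)}) =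
        (List.ofFn fun i => aout (b i) (x i) : Multiset _) +
          (List.ofFn fun i => answer (b i) (a i) (P i) : Multiset _) +
          (T₁ + {join m x (handshake Q)}) := by abel
    rw [e]
    -- The last interaction, on the channels `x`, delivers the payloads `a` to the body of the join.
    refine hs.tail ⟨m, x, a, handshake Q, Y + T₁, Z, hx, fun i h => ?_, ?_, ?_, by abel⟩
    · rw [names_add] at h
      rcases h with h | h
      · rcases hYn h with h | h
        · exact hxS i (Or.inr h)
        · exact h (hxB i)
      · exact hxT i h
    · simp only [← Multiset.singleton_add]; abel
    · rw [handshake_rename] at hZ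
      refine hZ.anti ?_
      simp only [names_add, names_ofFn, names_singleton, hjoin]
      simp only [Set.union_subset_iff, Set.iUnion_subset_iff, fn, Set.insert_subset_iff,
        Set.singleton_subset_iff]
      refine ⟨hPubB.trans Set.subset_union_left,
        ⟨fun i => ⟨Or.inl (hxB i), Or.inl (hNB (haS i))⟩, Set.subset_union_right⟩,
        hTB.trans Set.subset_union_left, ?_, (hQS.trans hNB).trans Set.subset_union_left⟩
      rintro _ ⟨i, rfl⟩; exact Or.inl (hxB i)
  · exact (Multiset.mem_add.1 hp).elim (hg p) (hX.of_mem p)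
  · have hi := infinite_compl_pub_union (S₁ + X)
    rw [names_add, ← Set.union_assoc] at hi ⊢
    refine (Enc.add_iff hi (by grind) (by grind)).2 ⟨T₁, Y + Z, rfl, ?_, hXYZ.anti (by grind),
      by grind (ematch := 10)⟩
    exact (hT.anti (B := Pub ∪ names S₁) (by grind)).enlarge (by grind (ematch := 10)) (by grind) hi

/-! ### Source and target interactions correspond. -/

section
variable {A : Set ℕ} {S S' S₁ : Multiset (Proc .sync)} {L T T₁ : Multiset (Proc .async)}

/-- Target outputs are traced back one at a time, each removed with its answering input. The
payloads are distinct because each occurs in no other pair. -/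
theorem Enc.aouts_inv {n : ℕ} {c b : Fin n → ℕ}
    (h : Enc A S ((List.ofFn fun i => aout (c i) (b i) : Multiset _) + L))
    (hS : ∀ p ∈ S, Guarded p) (hA : Aᶜ.Infinite) (hSA : names S ⊆ A) :
    ∃ (a : Fin n → ℕ) (P : Fin n → Proc .sync) (S₁ : Multiset (Proc .sync))
      (T₁ : Multiset (Proc .async)),
      S = (List.ofFn fun i => sout (c i) (a i) (P i) : Multiset _) + S₁ ∧
      L = (List.ofFn fun i => answer (b i) (a i) (P i) : Multiset _) + T₁ ∧ Enc A S₁ T₁ ∧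
      Function.Injective b ∧ (∀ i, b i ∉ A) ∧ ∀ i, b i ∉ names T₁ := by
  induction n generalizing S L with
  | zero =>
    simp only [List.ofFn_zero, Multiset.coe_nil, zero_add] at h ⊢
    exact ⟨Fin.elim0, Fin.elim0, S, L, rfl, rfl, h, fun i => i.elim0, fun i => i.elim0,
      fun i => i.elim0⟩
  | succ n ih =>
    rw [coe_ofFn_succ, Multiset.cons_add] at h
    obtain ⟨a₀, P₀, S₀, T₀, rfl, e, h₀, hb, hbT⟩ := h.mem_aout hS hA hSA (Multiset.mem_cons_self ..)
    rw [Multiset.cons_inj_right] at e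
    have hm : answer (b 0) a₀ P₀ ∈ L := by
      have : answer (b 0) a₀ P₀ ∈
          (List.ofFn fun i : Fin n => aout (c i.succ) (b i.succ) : Multiset _) + L := by
        rw [e]; exact Multiset.mem_cons_self ..
      refine (Multiset.mem_add.1 this).resolve_left fun h => ?_
      simp [answer, List.mem_ofFn] at h
    obtain ⟨L, rfl⟩ := Multiset.exists_cons_of_mem hm
    rw [Multiset.add_cons, Multiset.cons_inj_right] at e
    subst e
    rw [names_cons, Set.union_subset_iff] at hSA
    obtain ⟨a, P, S₁, T₁, rfl, rfl, h₁, hb', hbA, hbT'⟩ := ih h₀ (fun p hp => hS p (by simp [hp]))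
      hSA.2
    rw [names_add, names_add, names_ofFn] at hbT
    refine ⟨Fin.cons a₀ a, Fin.cons P₀ P, S₁, T₁, ?_, ?_, h₁, ?_, ?_, ?_⟩
    · rw [coe_ofFn_succ, Multiset.cons_add]; rfl
    · rw [coe_ofFn_succ, Multiset.cons_add]; rfl
    · rw [← Fin.cons_self_tail b]
      refine Fin.cons_injective_iff.2 ⟨?_, hb'⟩
      rintro ⟨i, hi⟩
      exact hbT (Or.inl (Set.mem_iUnion.2 ⟨i, Or.inr hi.symm⟩))
    · exact Fin.cases hb hbA
    · exact Fin.cases (fun h => hbT (Or.inr (Or.inr h))) hbT'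

theorem Enc.souts {n : ℕ} {c a : Fin n → ℕ} {P : Fin n → Proc .sync}
    (h : Enc A ((List.ofFn fun i => sout (c i) (a i) (P i) : Multiset _) + S₁) T)
    (hA : Aᶜ.Infinite)
    (hSA : names ((List.ofFn fun i => sout (c i) (a i) (P i) : Multiset _) + S₁) ⊆ A) :
    ∃ (b : Fin n → ℕ) (T₁ : Multiset (Proc .async)),
      T = (List.ofFn fun i => aout (c i) (b i) : Multiset _) +
        ((List.ofFn fun i => answer (b i) (a i) (P i) : Multiset _) + T₁) ∧ Enc A S₁ T₁ ∧
      Function.Injective b ∧ (∀ i, b i ∉ A) ∧ ∀ i, b i ∉ names T₁ := by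
  induction n generalizing T with
  | zero =>
    simp only [List.ofFn_zero, Multiset.coe_nil, zero_add] at h ⊢
    exact ⟨Fin.elim0, T, rfl, h, fun i => i.elim0, fun i => i.elim0, fun i => i.elim0⟩
  | succ n ih =>
    rw [coe_ofFn_succ, Multiset.cons_add] at h hSA
    obtain ⟨Y, T, rfl, hY, h, hn⟩ := (Enc.cons_iff hA hSA).1 h
    rw [names_cons, Set.union_subset_iff] at hSA
    obtain ⟨b, T, rfl, h', hb, hbA, hbT⟩ := ih h hSA.2
    obtain ⟨z, hz, rfl⟩ := hY.handshake_sout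
    have hzT : z ∉ names ((List.ofFn fun i => aout (c i.succ) (b i) : Multiset _) +
        ((List.ofFn fun i => answer (b i) (a i.succ) (P i.succ) : Multiset _) + T)) :=
      fun h => hz (hn ⟨by simp [fn], h⟩)
    rw [names_add, names_add, names_ofFn] at hzT
    refine ⟨Fin.cons z b, T, ?_, h', ?_, ?_, ?_⟩
    · simp only [coe_ofFn_succ, Fin.cons_zero, Fin.cons_succ, ← Multiset.singleton_add]
      abel
    · refine Fin.cons_injective_iff.2 ⟨?_, hb⟩
      rintro ⟨i, hi⟩
      exact hzT (Or.inl (Set.mem_iUnion.2 ⟨i, Or.inr hi.symm⟩))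
    · exact Fin.cases hz hbA
    · exact Fin.cases (fun h => hzT (Or.inr (Or.inr h))) hbT

theorem Opens.joinBody_iff {m : ℕ} {x b : Fin (m + 1) → ℕ} {Q : Proc .sync} :
    Opens A ((joinBody x Q).rename (inst b)) T ↔
      T = (List.ofFn fun i => aout (b i) (x i) : Multiset _) + {join m x (handshake Q)} := by
  rw [joinBody_rename_inst]
  constructor
  · intro h
    obtain ⟨X, Y, rfl, hX, hY⟩ := par_inv h
    rw [(guarded_iff (.join ..)).1 hY,
      Opens.parL_guarded (fun p hp => ?_) ((Opens.parAll_iff m _).1 hX)]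
    obtain ⟨i, rfl⟩ := List.mem_ofFn.1 hp
    exact .aout ..
  · rintro rfl
    exact .par (.parAll m fun i => .aout ..) (.guarded _ (.join ..))

/-- Every interaction of the translation of components begins the translation of an interaction. -/
theorem Encodes.comm (h : Encodes S T) (h' : Comm T T₁) :
    ∃ S' T', Comm S S' ∧ Relation.ReflTransGen Admin T₁ T' ∧ Encodes S' T' := by
  obtain ⟨hS, h⟩ := h
  have hA := infinite_compl_pub_union S
  have hSA : names S ⊆ Pub ∪ names S := Set.subset_union_right
  obtain ⟨K, L, R, X, hK, rfl, hX, rfl⟩ := h'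
  cases hK with
  | async m c b Q =>
  obtain ⟨p, S₀, Y, T₀, e, e', hq, hY, h₀, hn⟩ := h.of_mem hA hSA (q := join m c Q) (by simp)
  rcases hY.handshake_mem_join (hS p (by simp [e])) hq with
    ⟨Q, x, rfl, rfl, hx, hxA, rfl⟩ | ⟨n, a, P, z, rfl, hz, e'', -⟩
  · rw [Multiset.cons_add, Multiset.singleton_add, Multiset.cons_inj_right] at e'
    subst e'
    have hS₀A : names S₀ ⊆ Pub ∪ names S := by rw [e, names_cons]; grind
    obtain ⟨a, P, S₁, T₁, rfl, rfl, h₁, hb, hbA, hbT⟩ :=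
      h₀.aouts_inv (fun p hp => hS p (by simp [e, hp])) hA hS₀A
    have hxT : ∀ i, x i ∉ names ((List.ofFn fun i => aout (c i) (b i) : Multiset _) +
        ((List.ofFn fun i => answer (b i) (a i) (P i) : Multiset _) + T₁)) := fun i h =>
      hxA i (hn ⟨by
        rw [names_singleton]
        simp only [joinBody, fn, fn_parAll, Set.mem_union]
        exact Or.inr (Or.inl (Set.mem_iUnion.2 ⟨i, Or.inr rfl⟩)), h⟩)
    rw [Opens.joinBody_iff] at hX
    subst hX
    rw [← Multiset.cons_add] at e
    obtain ⟨X, T', hX, hs, hE⟩ := Enc.complete c a b x P Q e (fun p hp => hS p (by simp [e, hp]))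
      h₁ hb hx hbA hxA hbT
      (fun i h => hxT i (by rw [names_add, names_add]; exact Or.inr (Or.inr h)))
      (fun i j hij => hxT j (by
        rw [names_add, names_ofFn]
        exact Or.inl (Set.mem_iUnion.2 ⟨i, Or.inr hij.symm⟩)))
    exact ⟨S₁ + X, T', ⟨_, _, _, _, .sync m c a P Q, e, hX, rfl⟩, hs, hE⟩
  · obtain ⟨rfl, hc, -⟩ := (Proc.join.injEq _ _ _ _ _ _).mp e''
    -- An answering input cannot interact yet: an output on its private channel would be the
    -- announcement of a source output on that channel, but the channel is fresh for `S`.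
    obtain ⟨a', P', S', -, e, -⟩ := h.mem_aout (n := c 0) (z := b 0) hS hA hSA (by simp)
    rw [eq_of_heq hc] at e
    exact (hz (Or.inr (by rw [e]; simp [fn]))).elim

/-- Every interaction of components is translated. -/
theorem Encodes.exists_comm (h : Encodes S T) (h' : Comm S S') :
    ∃ T₁ T' S'', Comm T T₁ ∧ Relation.ReflTransGen Admin T₁ T' ∧ Encodes S'' T' ∧ Iso S'' S' := by
  obtain ⟨hS, h⟩ := h
  have hA := infinite_compl_pub_union S
  have hSA : names S ⊆ Pub ∪ names S := Set.subset_union_right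
  obtain ⟨K, S₁, R, X', hK, e, hX', rfl⟩ := h'
  have hR : R.fn ⊆ Pub ∪ names S := by rw [e]; exact hK.fn_subset_pub_union S₁
  cases hK with
  | sync m c a P Q =>
  have e' := e
  rw [Multiset.cons_add] at e'
  rw [e', Enc.cons_iff (e' ▸ hA) (e' ▸ hSA), ← e'] at h
  obtain ⟨Y, T, rfl, hY, h, hn⟩ := h
  obtain ⟨x, hx, hxA, rfl⟩ := hY.handshake_join
  have hSA' := hSA
  nth_rw 1 [e', names_cons] at hSA'
  obtain ⟨b, T₁, rfl, h₁, hb, hbA, hbT⟩ := h.souts hA (Set.union_subset_iff.1 hSA').2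
  have hxT : ∀ i, x i ∉ names ((List.ofFn fun i => aout (c i) (b i) : Multiset _) +
      ((List.ofFn fun i => answer (b i) (a i) (P i) : Multiset _) + T₁)) := fun i h =>
    hxA i (hn ⟨by
      rw [names_singleton]
      simp only [joinBody, fn, fn_parAll, Set.mem_union]
      exact Or.inr (Or.inl (Set.mem_iUnion.2 ⟨i, Or.inr rfl⟩)), h⟩)
  obtain ⟨X, T', hX, hs, hE⟩ := Enc.complete c a b x P Q e (fun p hp => hS p (by simp [e, hp]))
    h₁ hb hx hbA hxA hbT
    (fun i h => hxT i (by rw [names_add, names_add]; exact Or.inr (Or.inr h)))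
    (fun i j hij => hxT j (by
      rw [names_add, names_ofFn]
      exact Or.inl (Set.mem_iUnion.2 ⟨i, Or.inr hij.symm⟩)))
  refine ⟨_, T', S₁ + X,
    ⟨_, _, _, _, .async m c b (joinBody x Q), ?_, Opens.joinBody_iff.2 rfl, rfl⟩, hs, hE, ?_⟩
  · rw [Multiset.singleton_add, ← Multiset.cons_add]
  -- The handshake is completed with its own opening of the residue, which agrees with the given one
  -- up to private names.
  · obtain ⟨π, hπ, rfl⟩ := hX.unique hX' hR subset_rfl subset_rfl
    refine ⟨π, fun n hn => hπ n (Or.inl hn), ?_⟩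
    rw [ren_add, ren_eq_self (M := S₁) fun n hn =>
      hπ n (Or.inr (by rw [e, names_add]; exact Or.inr hn))]

end

/-! ### Private interactions commute with all others; intermediate states. -/

section
variable {M M' N T T' : Multiset (Proc .async)} {P : Proc .sync}

theorem Admin.map {π : Equiv.Perm ℕ} (hπ : ∀ n ∈ Pub, π n = n) (h : Admin M N) :
    Admin (ren π M) (ren π N) := by
  obtain ⟨m, c, b, Q, L, X, hc, hcL, rfl, hX, rfl⟩ := h
  refine ⟨m, fun i => π (c i), fun i => π (b i), Q.rename (liftBy (m + 1) π), ren π L, ren π X,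
    π.injective.comp hc, fun i h => ?_, ?_, ?_, by simp⟩
  · rw [names_ren] at h
    obtain ⟨n, hn, e⟩ := h
    exact hcL i (π.injective e ▸ hn)
  · simp only [ren_add, ren_cons, ren_ofFn, Proc.rename]
  · rw [inst_rename, ← image_pub_union hπ]
    exact hX.map_perm π

theorem Admin.step (h : Admin M N) (h' : Step M M') :
    ∃ N', Admin M' N' ∧ Relation.ReflTransGen Step N N' := by
  rcases h' with ⟨π, hπ, rfl⟩ | h'
  · exact ⟨ren π N, h.map hπ, .single (.inl ⟨π, hπ, rfl⟩)⟩
  obtain ⟨m, c, b, Q, L, X, hc, hcL, rfl, hX, rfl⟩ := h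
  obtain ⟨U, X', rfl, hU, hX', hs⟩ := (Redex.async m c b Q).unf hX h'
  refine ⟨_, ⟨m, c, b, Q, L + U, X', hc, fun i h => ?_, rfl, hX', rfl⟩, hs⟩
  rw [names_add] at h
  rcases h with h | h
  · exact hcL i h
  rcases hU h with h | h
  · exact hcL i h
  · exact h (by rw [names_add, names_cons]; exact Or.inl (Or.inl (Or.inl ⟨i, rfl⟩)))

theorem Admin.steps (h : Admin M N) (h' : Relation.ReflTransGen Step M M') :
    ∃ N', Admin M' N' ∧ Relation.ReflTransGen Step N N' := by
  induction h' with
  | refl => exact ⟨N, h, .refl⟩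
  | tail _ h' ih =>
    obtain ⟨N', h, hN⟩ := ih
    obtain ⟨N'', h, hN'⟩ := h.step h'
    exact ⟨N'', h, hN.trans hN'⟩

/-- Interactions on private channels commute with all others. -/
theorem Admin.diamond (h : Admin M N) (h' : Comm M M') :
    Iso N M' ∨ ∃ N₁ M₁, Comm N N₁ ∧ Admin M' M₁ ∧ Iso N₁ M₁ := by
  classical
  obtain ⟨m, c, b, Q, L, X, hc, hcL, rfl, hX, rfl⟩ := h
  obtain ⟨K', L', R', X', hK', e, hX', rfl⟩ := h'
  have hKR := Redex.async m c b Q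
  cases hK' with
  | async m' c' b' Q' =>
  have hL : ∀ i a, aout (c i) a ∉ L := fun i a h => hcL i ⟨_, h, by simp [fn]⟩
  -- If the other join lies in `L`, its channels differ from all `c i`, so the two redexes are
  -- disjoint and commute. Otherwise it is the same join, and the two interactions turn out to be
  -- the same.
  by_cases hj : join m' c' Q' ∈ L
  · have hcc : ∀ i j, c i ≠ c' j := fun i j h => hcL i ⟨_, hj, Or.inl ⟨j, h.symm⟩⟩
    have hle : (join m' c' Q' ::ₘ (List.ofFn fun i => aout (c' i) (b' i) : Multiset _)) ≤ L := by
      rw [Multiset.le_iff_count]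
      intro p
      by_cases hp : p ∈ (join m' c' Q' ::ₘ (List.ofFn fun i => aout (c' i) (b' i) : Multiset _))
      · have hpK : p ∉ (join m c Q ::ₘ (List.ofFn fun i => aout (c i) (b i) : Multiset _)) := by
          rw [Multiset.mem_cons, Multiset.mem_coe, List.mem_ofFn] at hp ⊢
          rintro (rfl | ⟨i, rfl⟩)
          · rcases hp with hp | ⟨j, hp⟩
            · obtain ⟨rfl, hp, -⟩ := (Proc.join.injEq _ _ _ _ _ _).mp hp
              exact hcc 0 0 (congrFun (eq_of_heq hp) 0)
            · cases hp
          · rcases hp with hp | ⟨j, hp⟩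
            · cases hp
            · exact hcc i j ((Proc.aout.injEq _ _ _ _).mp hp).1.symm
        have := congrArg (Multiset.count p) e
        rw [Multiset.count_add, Multiset.count_add, Multiset.count_eq_zero_of_notMem hpK] at this
        omega
      · rw [Multiset.count_eq_zero_of_notMem hp]; exact Nat.zero_le _
    obtain ⟨L, rfl⟩ := Multiset.le_iff_exists_add.1 hle
    rw [add_left_comm] at e
    obtain rfl := add_left_cancel e
    have hKR' := Redex.async m' c' b' Q'
    generalize hK' : (join m' c' Q' ::ₘ (List.ofFn fun i => aout (c' i) (b' i) : Multiset _)) = K'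
      at *
    generalize hK : (join m c Q ::ₘ (List.ofFn fun i => aout (c i) (b i) : Multiset _)) = K at *
    have hi := infinite_compl_pub_union (K + (K' + L))
    obtain ⟨Y, hY⟩ := Opens.exists_of_infinite (Q.rename (inst b))
      (infinite_compl_union hi (names_finite X'))
    obtain ⟨Y', hY'⟩ := Opens.exists_of_infinite (Q'.rename (inst b'))
      (infinite_compl_union hi (names_finite X))
    have hR := hKR.fn_subset_pub_union (K' + L)
    have hR' : (Q'.rename (inst b')).fn ⊆ Pub ∪ names (K + (K' + L)) := by
      rw [add_left_comm]; exact hKR'.fn_subset_pub_union _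
    have hX'n := hX'.names_subset
    have hRK' := hKR'.fn_subset
    refine Or.inr ⟨L + X + Y', L + X' + Y, ⟨K', L + X, _, Y', hKR', add_assoc .., ?_, rfl⟩,
      ⟨m, c, b, Q, L + X', Y, hc, fun i h => ?_, ?_, ?_, rfl⟩,
      Opens.swap_iso hi hR hR' ?_ hX hY' hX' hY⟩
    · refine hY'.anti ?_
      simp only [names_add]; grind
    · have hcK : c i ∈ names K := by
        rw [← hK, names_cons]; exact Or.inl (Or.inl ⟨i, rfl⟩)
      have := hcL i
      simp only [names_add] at *
      grind
    · rw [hK, add_assoc]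
    · refine hY.anti ?_
      simp only [names_add]; grind
    · simp only [names_add]; grind
  · have hj' : join m' c' Q' = join m c Q := by
      have : join m' c' Q' ∈
          (join m c Q ::ₘ (List.ofFn fun i => aout (c i) (b i) : Multiset _)) + L := by
        rw [e]; simp
      rw [Multiset.mem_add, or_iff_left hj, Multiset.mem_cons, Multiset.mem_coe,
        List.mem_ofFn] at this
      refine this.resolve_right ?_
      rintro ⟨i, h⟩; cases h
    obtain ⟨rfl, h₁, rfl⟩ := (Proc.join.injEq _ _ _ _ _ _).mp hj'
    obtain rfl := eq_of_heq h₁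
    -- No output on a channel `c' i` lies outside the redex, and distinct inputs use distinct
    -- channels; hence the messages consumed are forced.
    have hb : b' = b := by
      funext i
      have : aout (c' i) (b' i) ∈
          (join m' c' Q' ::ₘ (List.ofFn fun i => aout (c' i) (b i) : Multiset _)) + L := by
        rw [e, Multiset.mem_add, Multiset.mem_cons, Multiset.mem_coe, List.mem_ofFn]
        exact Or.inl (Or.inr ⟨i, rfl⟩)
      rw [Multiset.mem_add, or_iff_left (hL i _), Multiset.mem_cons, Multiset.mem_coe,
        List.mem_ofFn] at this
      rcases this with h | ⟨j, h⟩
      · cases h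
      · obtain ⟨h, h'⟩ := (Proc.aout.injEq _ _ _ _).mp h
        rw [← h', hc h]
    subst hb
    obtain rfl := add_left_cancel e
    obtain ⟨π, hπ, rfl⟩ := hX.unique hX' (hKR.fn_subset_pub_union L) subset_rfl subset_rfl
    refine Or.inl ⟨π, fun n hn => hπ n (Or.inl hn), ?_⟩
    rw [ren_add, ren_eq_self (M := L) fun n hn =>
      hπ n (Or.inr (by rw [names_add]; exact Or.inr hn))]

/-- `Tracks P n T`: the components `T` become the translation of `P` by `n` interactions on private
channels. -/
inductive Tracks (P : Proc .sync) : ℕ → Multiset (Proc .async) → Prop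
  | zero {S : Multiset (Proc .sync)} {T : Multiset (Proc .async)} :
      Encodes S T → StructEq (P.rename dbl) (readback S) → Tracks P 0 T
  | succ {n : ℕ} {T T' : Multiset (Proc .async)} : Admin T T' → Tracks P n T' → Tracks P (n + 1) T

theorem Tracks.steps {n : ℕ} (h : Tracks P n T) (h' : Relation.ReflTransGen Step T T') :
    Tracks P n T' := by
  induction h generalizing T' with
  | zero h hP =>
    obtain ⟨S', hS, h⟩ := h.steps h'
    exact .zero h (hP.trans (Eqv.of_steps hS).readback)
  | succ h _ ih =>
    obtain ⟨N, h, hN⟩ := h.steps h'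
    exact .succ h (ih hN)

/-- With nothing pending, an interaction begins the handshake of a source reduction. Otherwise the
diamond says that it is the next pending interaction or commutes past it. If the source does not
move, fewer interactions remain pending. -/
theorem Tracks.comm {n : ℕ} (h : Tracks P n T) (h' : Comm T T') :
    (∃ n' < n, Tracks P n' T') ∨ ∃ P' n', Red P P' ∧ Tracks P' n' T' := by
  induction h generalizing T' with
  | zero h hP =>
    obtain ⟨S, T, hS, hT, h⟩ := h.comm h'
    obtain ⟨P', hP'⟩ := exists_rename_dbl (fn_readback S)
    suffices ∃ n, Tracks P' n T' by
      obtain ⟨n, hn⟩ := this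
      refine Or.inr ⟨P', n, .of_rename_dbl ?_, hn⟩
      rw [hP']
      exact .struct hP hS.readback (.refl _)
    clear h'
    induction hT using Relation.ReflTransGen.head_induction_on with
    | refl => exact ⟨0, .zero h (.of_eq hP')⟩
    | head h _ ih =>
      obtain ⟨n, hn⟩ := ih
      exact ⟨n + 1, .succ h hn⟩
  | succ h hT ih =>
    rcases h.diamond h' with h | ⟨N, M, hN, hM, hi⟩
    · exact Or.inl ⟨_, Nat.lt_succ_self _, hT.steps (.single (.inl h))⟩
    · have hs : Relation.ReflTransGen Step N M := .single (.inl hi)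
      rcases ih hN with ⟨n', hn, h⟩ | ⟨P', n', hP, h⟩
      · exact Or.inl ⟨n' + 1, Nat.succ_lt_succ hn, .succ hM (h.steps hs)⟩
      · exact Or.inr ⟨P', n' + 1, hP, .succ hM (h.steps hs)⟩

theorem Tracks.exists_encodes {n : ℕ} (h : Tracks P n T) :
    ∃ S T', Relation.ReflTransGen Admin T T' ∧ Encodes S T' ∧
      StructEq (P.rename dbl) (readback S) := by
  induction h with
  | zero h hP => exact ⟨_, _, .refl, h, hP⟩
  | succ h _ ih =>
    obtain ⟨S, T', hT, h'⟩ := ih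
    exact ⟨S, T', hT.head h, h'⟩

theorem Admin.reds (h : Relation.ReflTransGen Admin M N) :
    Reds (Joining.readback M) (Joining.readback N) :=
  h.lift _ fun _ _ h => h.comm.readback

end

/-! ### From components back to processes: operational correspondence, divergence, success. -/

section
variable {α : Synchronism}

/-- Equivalences at the ends are absorbed into the first and the last reduction, which is why at
least one reduction is required. -/
theorem transGen_structEq {P P' Q Q' : Proc α} (h : StructEq P P')
    (hr : Relation.TransGen Red P' Q') (h' : StructEq Q' Q) : Relation.TransGen Red P Q := by
  have hr : Relation.TransGen Red P' Q := by
    cases hr with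
    | single hr => exact .single (.struct (.refl _) hr h')
    | tail hs hr => exact hs.tail (.struct (.refl _) hr h')
  obtain ⟨R, hr, hs⟩ := Relation.TransGen.head'_iff.1 hr
  exact Relation.TransGen.head'_iff.2 ⟨R, .struct h hr (.refl _), hs⟩

theorem transGen_of_rename_dbl {P Q : Proc α}
    (h : Relation.TransGen Red (P.rename dbl) (Q.rename dbl)) : Relation.TransGen Red P Q := by
  obtain ⟨g, hg, hg'⟩ := exists_undo (P.fn_finite.union Q.fn_finite)
  have := h.lift (Proc.rename g) fun _ _ h => h.rename hg
  simp only [Function.onFun] at this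
  rwa [rename_rename, rename_rename,
    rename_eq_self (f := g ∘ dbl) P fun n hn => hg' n (Or.inl hn),
    rename_eq_self (f := g ∘ dbl) Q fun n hn => hg' n (Or.inr hn)] at this

theorem Step.guarded {M N : Multiset (Proc α)} (h : Step M N) (hM : ∀ p ∈ M, Guarded p) :
    ∀ p ∈ N, Guarded p := by
  rcases h with ⟨π, _, rfl⟩ | ⟨P, X, _, hX, rfl⟩
  · intro p hp
    obtain ⟨q, hq, rfl⟩ := Multiset.mem_map.1 hp
    exact (hM q hq).rename π
  · exact fun p hp => (Multiset.mem_add.1 hp).elim (hM p) (hX.of_mem p)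

theorem Step.guarded_of_reflTransGen {M N : Multiset (Proc α)}
    (h : Relation.ReflTransGen Step M N) (hM : ∀ p ∈ M, Guarded p) : ∀ p ∈ N, Guarded p := by
  induction h with
  | refl => exact hM
  | tail _ h ih => exact h.guarded ih

theorem Step.ok_mem {M N : Multiset (Proc α)} (h : Relation.ReflTransGen Step M N)
    (hM : ok ∈ M) : ok ∈ N := by
  induction h with
  | refl => exact hM
  | tail _ h ih =>
    rcases h with ⟨π, _, rfl⟩ | ⟨P, X, _, _, rfl⟩
    · exact Multiset.mem_map.2 ⟨_, ih, rfl⟩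
    · exact Multiset.mem_add.2 (Or.inl ih)

theorem readback_of_ok_mem {M : Multiset (Proc α)} (h : ok ∈ M) :
    ∃ P, StructEq (readback M) (par P ok) := by
  obtain ⟨M', e⟩ := Multiset.exists_cons_of_mem h
  refine ⟨nuL (priv Pub M) (parM M'), StructEq.trans ?_ (.par_comm _ _)⟩
  refine StructEq.trans ?_ (StructEq.nuL_extrude (by simp [fn]) _).symm
  rw [readback]
  refine .nuL_congr _ ?_
  nth_rw 1 [e]
  exact .parM_cons _ _

end

section
variable {P P' Q : Proc .sync} {T T' : Proc .async} {n : ℕ}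

/-- Interactions are preserved by the translation. -/
theorem Red.handshake (h : Red P P') : Relation.TransGen Red (handshake P) (handshake P') := by
  obtain ⟨S, hS⟩ := Top.exists P
  obtain ⟨S', hS'⟩ := Top.exists P'
  obtain ⟨M, N, ⟨Z, hSZ, hMZ⟩, hMN, hN⟩ := h.commEqv S S' hS hS'
  -- The interaction is postponed until after the unfoldings, so that it starts from components
  -- reached from those of `P` by directed steps.
  obtain ⟨N', hZN', hNN'⟩ := hMN.steps hMZ
  obtain ⟨T, hT⟩ := Encodes.exists (Step.guarded_of_reflTransGen hSZ hS.of_mem)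
  obtain ⟨T₁, T', S'', hT₁, hT', hE, hi⟩ := hT.exists_comm hZN'
  apply transGen_of_rename_dbl
  rw [← handshake_rename, ← handshake_rename]
  refine transGen_structEq
    (((hS.readback.trans (Eqv.of_steps hSZ).readback).handshake).trans hT.readback)
    (Relation.TransGen.head' hT₁.readback (Admin.reds hT'))
    (hE.readback.symm.trans (StructEq.handshake ?_))
  exact (hi.readback.trans (Eqv.of_steps hNN').readback.symm).trans
    (hN.readback.trans hS'.readback.symm)

theorem Reds.handshake (h : Reds P P') : Reds (handshake P) (handshake P') := by
  induction h with
  | refl => exact .refl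
  | tail _ h ih => exact ih.trans h.handshake.to_reflTransGen

/-- `Completes P n T`: the process `T` is an intermediate state of the translation of `P`, with `n`
interactions on private channels to go. -/
def Completes (P : Proc .sync) (n : ℕ) (T : Proc .async) : Prop :=
  ∃ Y Y', Top T Y ∧ Eqv Y Y' ∧ Tracks P n Y'

theorem completes_handshake (P : Proc .sync) : Completes P 0 (Joining.handshake P) := by
  obtain ⟨Y, hY⟩ := Top.exists (Joining.handshake P)
  obtain ⟨S, hS, h⟩ := hY.exists_encodes
  exact ⟨Y, Y, hY, .refl Y, .zero h hS.readback⟩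

theorem Completes.red (h : Completes P n T) (h' : Red T T') :
    (∃ n' < n, Completes P n' T') ∨ ∃ P' n', Red P P' ∧ Completes P' n' T' := by
  obtain ⟨Y, Y', hY, hYY', h⟩ := h
  obtain ⟨Y₁, hY₁⟩ := Top.exists T'
  obtain ⟨M, N, hYM, hMN, hN⟩ := h'.commEqv Y Y₁ hY hY₁
  obtain ⟨Z, hMZ, hYZ⟩ := hYM.symm.trans hYY'
  obtain ⟨N', hZN', hNN'⟩ := hMN.steps hMZ
  have hN' : Eqv Y₁ N' := hN.symm.trans (Eqv.of_steps hNN')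
  rcases (h.steps hYZ).comm hZN' with ⟨n', hn, h⟩ | ⟨P', n', hP, h⟩
  · exact Or.inl ⟨n', hn, Y₁, N', hY₁, hN', h⟩
  · exact Or.inr ⟨P', n', hP, Y₁, N', hY₁, hN', h⟩

theorem Completes.exists_reds (h : Completes P n T) :
    ∃ T', Reds T T' ∧ StructEq T' (Joining.handshake P) := by
  obtain ⟨Y, Y', hY, hYY', h⟩ := h
  obtain ⟨S, Z, hYZ, hSZ, hS⟩ := h.exists_encodes
  have h₁ : StructEq (T.rename dbl) (readback Y') := hY.readback.trans hYY'.readback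
  have h₂ : StructEq (readback Z) ((Joining.handshake P).rename dbl) := by
    rw [← handshake_rename]
    exact (hS.handshake.trans hSZ.readback).symm
  -- Without any reduction, `T` itself is equivalent to the translation. Otherwise the equivalences
  -- are absorbed and the translation is reached exactly.
  rcases Relation.reflTransGen_iff_eq_or_transGen.1 (Admin.reds hYZ) with e | hr
  · rw [e] at h₂
    exact ⟨T, .refl, .of_rename_dbl (h₁.trans h₂)⟩
  · exact ⟨_, (transGen_of_rename_dbl (transGen_structEq h₁ hr h₂)).to_reflTransGen, .refl _⟩

theorem Completes.of_reds (h : Reds (Joining.handshake P) T) :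
    ∃ P' n, Reds P P' ∧ Completes P' n T := by
  induction h with
  | refl => exact ⟨P, 0, .refl, completes_handshake P⟩
  | tail _ h ih =>
    obtain ⟨P', n, hP, h'⟩ := ih
    rcases h'.red h with ⟨n', _, h⟩ | ⟨P'', n', hP', h⟩
    · exact ⟨P', n', hP, h⟩
    · exact ⟨P'', n', hP.tail hP', h⟩

/-- Each reduction that does not move the source lowers the number of pending interactions, so an
infinite sequence contains a reduction that moves it. -/
theorem Completes.diverges (h : Completes P n T) (h' : Diverges T) :
    ∃ P' n' T', Red P P' ∧ Completes P' n' T' ∧ Diverges T' := by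
  induction n using Nat.strong_induction_on generalizing T with
  | _ n ih =>
  obtain ⟨f, rfl, hf⟩ := h'
  have hd : Diverges (f 1) := ⟨fun i => f (i + 1), rfl, fun i => hf (i + 1)⟩
  rcases h.red (hf 0) with ⟨n', hn, h⟩ | ⟨P', n', hP, h⟩
  · exact ih n' hn h hd
  · exact ⟨P', n', f 1, hP, h, hd⟩

theorem Diverges.of_handshake (h : Diverges (Joining.handshake P)) : Diverges P := by
  let q : Proc .sync → Prop := fun P => ∃ n T, Completes P n T ∧ Diverges T
  have hq : ∀ P : {P // q P}, ∃ P' : {P // q P}, Red P.1 P'.1 := by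
    rintro ⟨P, n, T, hP, hT⟩
    obtain ⟨P', n', T', hr, hP', hT'⟩ := hP.diverges hT
    exact ⟨⟨P', n', T', hP', hT'⟩, hr⟩
  choose g hg using hq
  refine ⟨fun i => (g^[i] ⟨P, 0, _, completes_handshake P, h⟩).1, rfl, fun i => ?_⟩
  simp only [Function.iterate_succ_apply']
  exact hg _

/-- Private interactions consume only a join and outputs, so a visible success survives until the
handshakes are complete; there it comes from a success among the source components. -/
theorem Tracks.ok_mem {M : Multiset (Proc .async)} (h : Tracks P n M) (hM : ok ∈ M) :
    ∃ S, ok ∈ S ∧ StructEq (P.rename dbl) (readback S) := by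
  induction h with
  | @zero S T h hP =>
    exact ⟨S, h.2.mem_ok h.1 (infinite_compl_pub_union S) Set.subset_union_right hM, hP⟩
  | succ h _ ih =>
    obtain ⟨m, c, b, Q, L, X, -, -, rfl, -, rfl⟩ := h
    refine ih (Multiset.mem_add.2 (Or.inl ((Multiset.mem_add.1 hM).resolve_left ?_)))
    rw [Multiset.mem_cons, Multiset.mem_coe, List.mem_ofFn]
    rintro (h | ⟨i, h⟩) <;> cases h

theorem Completes.structEq_ok (h : Completes P n T) (h' : StructEq T (par T' ok)) :
    ∃ P', StructEq P (par P' ok) := by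
  obtain ⟨Y, Y', hY, hYY', h⟩ := h
  obtain ⟨X, hX⟩ := Top.exists T'
  have hX' : Top (par T' ok) (X + {Proc.ok}) := .par hX (.guarded _ .ok)
  obtain ⟨Z, hXZ, hYZ⟩ := (h'.eqv Y _ hY hX').symm.trans hYY'
  obtain ⟨S, hS, hP⟩ := (h.steps hYZ).ok_mem (Step.ok_mem hXZ (by simp))
  obtain ⟨P', hP'⟩ := readback_of_ok_mem hS
  obtain ⟨g, hg, hg'⟩ := exists_undo P.fn_finite
  have := (hP.trans hP').rename hg
  rw [rename_rename, rename_eq_self (f := g ∘ dbl) P hg'] at this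
  exact ⟨_, this⟩

theorem succeeds_handshake : Succeeds (Joining.handshake P) ↔ Succeeds P := by
  constructor
  · rintro ⟨T, T', hT, h⟩
    obtain ⟨P', n, hP, h'⟩ := Completes.of_reds hT
    obtain ⟨P'', h⟩ := h'.structEq_ok h
    exact ⟨P', P'', hP, h⟩
  · rintro ⟨P', P'', hP, h⟩
    refine ⟨_, Joining.handshake P'', hP.handshake, ?_⟩
    have := h.handshake
    rwa [Joining.handshake, Joining.handshake] at this

/-- In a translation itself nothing is pending, so its first reduction already corresponds to a
source reduction. -/
theorem Red.of_handshake (h : Red (Joining.handshake P) T) :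
    ∃ P', Red P P' ∧ ∃ T', Reds T T' ∧ StructEq T' (Joining.handshake P') := by
  rcases (completes_handshake P).red h with ⟨n, hn, -⟩ | ⟨P', n, hP, h⟩
  · exact absurd hn (Nat.not_lt_zero n)
  · exact ⟨P', hP, h.exists_reds⟩

end

/-! ### Named binders and compositionality. -/

section
variable {α : Synchronism}

theorem bindNames_apply {m : ℕ} (x : Fin (m + 1) ↪ ℕ) (j : Fin (m + 1)) :
    bindNames x (x j) = j := by
  have h := (List.nodup_ofFn.2 x.injective).idxOf_getElem j (by simp; omega)
  rw [bindNames, if_pos ((List.mem_ofFn' x _).2 ⟨j, rfl⟩)]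
  rwa [List.getElem_ofFn] at h

theorem bindNames_of_notMem {m : ℕ} {x : Fin (m + 1) ↪ ℕ} {n : ℕ} (h : ∀ j, x j ≠ n) :
    bindNames x n = n + (m + 1) := by
  rw [bindNames, if_neg fun hn => ?_]
  obtain ⟨j, hj⟩ := (List.mem_ofFn' x n).1 hn
  exact h j hj

/-- The list is reversed because its first name is to receive index `0`, the innermost binder,
whereas `nuL` binds the first name outermost. -/
theorem nuL_reverse (l : List ℕ) (P : Proc α) :
    nuL l.reverse P =
      resN l.length (P.rename fun n => if n ∈ l then l.idxOf n else n + l.length) := by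
  induction l generalizing P with
  | nil => exact (rename_id P).symm
  | cons a l ih =>
    rw [List.reverse_cons, nuL_append, ih, List.length_cons, resN_add]
    simp only [nuL_cons, nuL_nil, nu, Proc.rename, rename_rename, resN]
    congr 3
    funext n
    simp only [Function.comp, bindName, liftBy, List.mem_cons, List.idxOf_cons]
    grind

theorem nuL_reverse_ofFn {m : ℕ} (x : Fin (m + 1) ↪ ℕ) (P : Proc α) :
    nuL (List.ofFn x).reverse P = resN (m + 1) (P.rename (bindNames x)) := by
  rw [nuL_reverse]
  simp only [List.length_ofFn]
  rfl

end

theorem handshake_nu (a : ℕ) (P : Proc .sync) : handshake (nu a P) = nu a (handshake P) := by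
  simp only [nu, handshake, handshake_rename]

/-- The translation of an output, with named binders. -/
theorem handshake_sout_eq {n a : ℕ} {z x : Fin 1 ↪ ℕ} {P : Proc .sync} (hzn : z 0 ≠ n)
    (hza : z 0 ≠ a) (hxa : x 0 ≠ a) (hz : z 0 ∉ P.fn) (hx : x 0 ∉ P.fn) :
    handshake (sout n a P) =
      nu (z 0) (par (aout n (z 0))
        (joinNamed (m := 0) z x (par (aout (x 0) a) (handshake P)))) := by
  have hb : ∀ {k}, x 0 ≠ k → bindNames x k = k + 1 := fun {k} h =>
    bindNames_of_notMem fun j => by rwa [Fin.fin_one_eq_zero j]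
  have hx0 : bindNames x (x 0) = 0 := bindNames_apply x 0
  simp only [handshake, nu, joinNamed, Proc.rename, rename_rename, res.injEq, par.injEq,
    aout.injEq, join.injEq, heq_eq_eq, true_and, hx0, hb hxa]
  refine ⟨?_, ?_, ?_, ?_⟩
  · simp [bindName, hzn.symm]
  · funext j; rw [Fin.fin_one_eq_zero j]; simp [bindName]
  · simp [liftBy, bindName, hza.symm]
  · refine rename_congr _ fun k hk => ?_
    rw [fn_handshake] at hk
    have h₁ : x 0 ≠ k := fun e => hx (e ▸ hk)
    have h₂ : k ≠ z 0 := fun e => hz (e ▸ hk)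
    simp [hb h₁, liftBy, bindName, h₂]

/-- The translation of a join, with named binders. -/
theorem handshake_joinNamed {m : ℕ} {c : Fin (m + 1) → ℕ} {x y z : Fin (m + 1) ↪ ℕ}
    {P : Proc .sync} (hyc : ∀ i j, y i ≠ c j) (hyz : ∀ i j, y i ≠ z j)
    (hy : ∀ i, y i ∉ P.fn) (hz : ∀ i, z i ∉ P.fn) :
    handshake (joinNamed c x P) =
      nuL (List.ofFn y).reverse (joinNamed c z (par (parAll m fun j => aout (z j) (y j))
        (joinNamed y x (handshake P)))) := by
  rw [nuL_reverse_ofFn]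
  simp only [joinNamed, handshake, Proc.rename, rename_rename, parAll_rename, handshake_rename]
  congr 1
  simp only [Proc.join.injEq, Proc.par.injEq, heq_eq_eq, true_and]
  have hzy : ∀ j, bindNames z (y j) = y j + (m + 1) := fun j =>
    bindNames_of_notMem fun i => (hyz j i).symm
  refine ⟨?_, ?_, ?_, ?_⟩
  · funext j; exact (bindNames_of_notMem fun i => hyc i j).symm
  · congr 1; funext j
    rw [bindNames_apply, liftBy_coe, hzy, liftBy_add, bindNames_apply, add_comm (m + 1) (j : ℕ)]
  · funext j
    rw [hzy, liftBy_add, bindNames_apply, add_comm]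
  · refine rename_congr _ fun n hn => ?_
    rw [fn_handshake] at hn
    simp only [Function.comp]
    by_cases h : ∃ j, x j = n
    · obtain ⟨j, rfl⟩ := h
      simp only [bindNames_apply, liftBy_coe]
    · push Not at h
      rw [bindNames_of_notMem h, liftBy_add, liftBy_add, liftBy_add,
        bindNames_of_notMem fun i e => hz i (by rwa [e]), liftBy_add,
        bindNames_of_notMem fun i e => hy i (by rwa [e])]
      omega

namespace Ctx
variable {α : Synchronism} {k : ℕ}

/-- Parallel composition of contexts. -/
def par (C D : Ctx α k) : Ctx α k := node .par ![C, D]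

/-- Parallel composition of the contexts `C 0, …, C m`. -/
def parAll : (m : ℕ) → (Fin (m + 1) → Ctx α k) → Ctx α k
  | 0, C => C 0
  | m + 1, C => par (C 0) (parAll m fun i => C i.succ)

/-- Nested restrictions of a context. -/
def nuL (l : List ℕ) (C : Ctx α k) : Ctx α k := l.foldr (fun a C => node (.nu a) fun _ => C) C

/-- An output, as a context without holes. -/
def aout (a b : ℕ) : Ctx .async k := node (.aout a b) Fin.elim0

variable (P : Fin k → Proc α) (i : Fin k)

@[simp] theorem fill_par (C D : Ctx α k) : (par C D).fill P = .par (C.fill P) (D.fill P) := rfl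

@[simp] theorem fill_parAll (m : ℕ) (C : Fin (m + 1) → Ctx α k) :
    (parAll m C).fill P = Proc.parAll m fun i => (C i).fill P := by
  induction m with
  | zero => rfl
  | succ m ih => simp [parAll, Proc.parAll, ih]

@[simp] theorem fill_nuL (l : List ℕ) (C : Ctx α k) :
    (nuL l C).fill P = Joining.nuL l (C.fill P) := by
  induction l with
  | nil => rfl
  | cons a l ih => exact congrArg (nu a) ih

@[simp] theorem fill_aout (P : Fin k → Proc .async) (a b : ℕ) :
    (aout a b).fill P = .aout a b := rfl

@[simp] theorem occ_par (C D : Ctx α k) : (par C D).occ i = C.occ i + D.occ i := by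
  simp [par, occ]

theorem occ_parAll {m : ℕ} {C : Fin (m + 1) → Ctx α k} (h : ∀ j, (C j).occ i = 0) :
    (parAll m C).occ i = 0 := by
  induction m with
  | zero => exact h 0
  | succ m ih => simp [parAll, h, ih]

@[simp] theorem occ_nuL (l : List ℕ) (C : Ctx α k) : (nuL l C).occ i = C.occ i := by
  induction l with
  | nil => rfl
  | cons a l ih => simpa [nuL, occ] using ih

@[simp] theorem occ_aout (a b : ℕ) : (aout a b : Ctx .async k).occ i = 0 := by
  simp [aout, occ]

end Ctx

/-- The names from `B` on. -/
def namesFrom (B m : ℕ) : Fin (m + 1) ↪ ℕ := ⟨fun j => B + j, fun i j h => by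
  rw [Fin.ext_iff]; exact Nat.add_left_cancel h⟩

theorem handshake_compositional {k : ℕ} (op : Op .sync k) (N : Set ℕ) :
    ∃ C : Ctx .async k, C.Linear ∧ ∀ S : Fin k → Proc .sync, (⋃ i, (S i).fn) = N →
      handshake (op.apply S) = C.fill fun i => handshake (S i) := by
  -- The context may depend on `N` but not on the arguments, so the names it introduces are taken
  -- above a bound for `N`. For infinite `N` there are no arguments to consider, as processes have
  -- finitely many free names.
  obtain ⟨B₀, hB₀⟩ : ∃ B, ∀ S : Fin k → Proc .sync, (⋃ i, (S i).fn) = N →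
      ∀ i, ∀ n ∈ (S i).fn, n < B := by
    by_cases hN : N.Finite
    · obtain ⟨B, hB⟩ := hN.bddAbove
      exact ⟨B + 1, fun S hS i n hn => Nat.lt_succ_of_le (hB (hS ▸ Set.mem_iUnion.2 ⟨i, hn⟩))⟩
    · exact ⟨0, fun S hS => absurd (hS ▸ Set.finite_iUnion fun i => (S i).fn_finite) hN⟩
  cases op with
  | nil => exact ⟨.node .nil Fin.elim0, fun i => i.elim0, fun _ _ => by
      simp [Op.apply, Ctx.fill, handshake]⟩
  | ok => exact ⟨.node .ok Fin.elim0, fun i => i.elim0, fun _ _ => by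
      simp [Op.apply, Ctx.fill, handshake]⟩
  | nu a => exact ⟨.node (.nu a) .hole, fun i => by
      rw [Fin.fin_one_eq_zero i]; simp [Ctx.occ], fun _ _ => handshake_nu a _⟩
  | par => exact ⟨.node .par .hole, fun i => by simp [Ctx.occ], fun _ _ => by
      simp [Op.apply, Ctx.fill, handshake]⟩
  | ite s t => exact ⟨.node (.ite s t) .hole, fun i => by simp [Ctx.occ], fun _ _ => by
      simp [Op.apply, Ctx.fill, handshake]⟩
  | rep => exact ⟨.node .rep .hole, fun i => by
      rw [Fin.fin_one_eq_zero i]; simp [Ctx.occ], fun _ _ => by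
      simp [Op.apply, Ctx.fill, handshake]⟩
  | sout n a =>
    obtain ⟨B, hB⟩ : ∃ B, B = B₀ + n + a + 1 := ⟨_, rfl⟩
    let z := namesFrom B 0
    let x := namesFrom (B + 1) 0
    have hz : z 0 = B := rfl
    have hx : x 0 = B + 1 := rfl
    refine ⟨.nuL [z 0] (.par (.aout n (z 0))
      (.node (.join z x) fun _ => .par (.aout (x 0) a) (.hole 0))), fun i => ?_, fun S hS => ?_⟩
    · rw [Fin.fin_one_eq_zero i]; simp [Ctx.occ]
    · have hb := hB₀ S hS 0
      refine handshake_sout_eq (x := x) (by omega) (by omega) (by omega) ?_ ?_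
      · exact fun h => by have := hb _ h; omega
      · exact fun h => by have := hb _ h; omega
  | @join _ m c x =>
    obtain ⟨B, hB⟩ := ((Set.finite_range c).union (Set.finite_Iio B₀)).bddAbove
    let y := namesFrom (B + 1) m
    let z := namesFrom (B + 1 + (m + 1)) m
    have hy : ∀ j, y j = B + 1 + j := fun _ => rfl
    have hz : ∀ j, z j = B + 1 + (m + 1) + j := fun _ => rfl
    -- The binding names `x` of the operator need not avoid `y` and `z`: they are bound innermost,
    -- and only around the argument.
    refine ⟨.nuL (List.ofFn y).reverse (.node (.join c z) fun _ =>
      .par (.parAll m fun j => .aout (z j) (y j)) (.node (.join y x) fun _ => .hole 0)),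
      fun i => ?_, fun S hS => ?_⟩
    · rw [Fin.fin_one_eq_zero i]; simp [Ctx.occ, Ctx.occ_parAll]
    · have hb : ∀ n ∈ (S 0).fn, n ≤ B := fun n hn => hB (Or.inr (hB₀ S hS 0 n hn))
      have hc : ∀ j, c j ≤ B := fun j => hB (Or.inl ⟨j, rfl⟩)
      rw [Ctx.fill_nuL]
      simp only [Ctx.fill, Op.apply, Ctx.fill_par, Ctx.fill_parAll, Ctx.fill_aout]
      refine handshake_joinNamed (fun i j e => ?_) (fun i j e => ?_) (fun i h => ?_) fun i h => ?_
      · have := hc j; have := hy i; omega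
      · have := hy i; have := hz j; omega
      · have := hb _ h; have := hy i; omega
      · have := hb _ h; have := hz i; omega

/-! ### Validity of the encoding. -/

/-- Completeness and name invariance hold with equality of processes, so they only need `beq` to be
reflexive. That `beq` contains structural equivalence is needed for soundness alone. -/
theorem handshakeEncoding_valid {beq : Proc .async → Proc .async → Prop} (hbeq : Equivalence beq)
    (h : ∀ T U, StructEq T U → beq T U) : handshakeEncoding.Valid beq where
  compositionality _ op N := handshake_compositional op N
  name_invariance σ hσ := by
    refine ⟨⟨σ, hσ, fun _ _ => rfl⟩, fun σ' _ ht S => ?_⟩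
    -- The policy is the identity on one-tuples, so `σ` transports only to itself.
    obtain rfl : σ = σ' := funext fun a => ht a ⟨0, Nat.one_pos⟩
    have e := handshake_rename S σ
    exact ⟨fun _ => e, fun _ => e ▸ hbeq.refl _⟩
  completeness _ S' hS := ⟨_, hS.handshake, hbeq.refl _⟩
  soundness S T hT := by
    obtain ⟨S', n, hS, hC⟩ := Completes.of_reds hT
    obtain ⟨T', hT', hE⟩ := hC.exists_reds
    exact ⟨S', hS, T', hT', h _ _ hE⟩
  divergence_reflection _ := Diverges.of_handshake
  success_sensitiveness _ := succeeds_handshake.symm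

end Joining

theorem mainTheorem3 :
    -- the handshake encoding is valid, whatever the reference behavioural equivalence
    (∀ beq : Joining.Proc .async → Joining.Proc .async → Prop, Equivalence beq →
      (∀ T U, Joining.StructEq T U → beq T U) → Joining.handshakeEncoding.Valid beq) ∧
    -- structural equivalence is preserved and reflected
    (∀ P Q : Joining.Proc .sync,
      Joining.StructEq P Q ↔
        Joining.StructEq (Joining.handshake P) (Joining.handshake Q)) ∧
    -- reductions are preserved
    (∀ P P' : Joining.Proc .sync, Joining.Red P P' →
      ∃ T, Relation.TransGen Joining.Red (Joining.handshake P) T ∧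
        Joining.StructEq T (Joining.handshake P')) ∧
    -- reductions are reflected
    (∀ (P : Joining.Proc .sync) (T : Joining.Proc .async), Joining.Red (Joining.handshake P) T →
      ∃ P', Joining.Red P P' ∧
        ∃ T', Joining.Reds T T' ∧ Joining.StructEq T' (Joining.handshake P')) :=
  ⟨fun _ hbeq h => Joining.handshakeEncoding_valid hbeq h,
    fun _ _ => ⟨Joining.StructEq.handshake, Joining.StructEq.of_handshake⟩,
    fun _ _ h => ⟨_, h.handshake, .refl _⟩,
    fun _ _ h => h.of_handshake⟩
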